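/- **Conventions.** All algebras are unital and over $\mathbb C$; repeated indices are summed. A *representation* over a bialgebra $(\mathcal A,\Delta)$ is a square matrix $v$ over $\mathcal A$ with $\Delta v_{ij}=v_{ik}\otimes v_{kj}$, $\epsilon(v_{ij})=\delta_{ij}$; $(v\otimes w)_{ij,kl}=v_{ik}w_{jl}$, and $\mathrm{Mor}(v,w)$ is the set of complex matrices $X$ with $Xv=wX$. For $a\in\mathcal A$ and $\rho\in\mathcal A'$ (linear functionals) put $a*\rho=(\rho\otimes\mathrm{id})\Delta a$, $\rho*a=(\mathrm{id}\otimes\rho)\Delta a$. Let $\mathcal A$ be a Hopf algebra with invertible antipode and $\Lambda=(\Lambda_{rs})_{r,s\in\mathcal I}$ ($\mathcal I$ finite) a representation. We say that $(\mathcal A,\Delta,\Lambda)$ satisfies a.–c. if: (a) every representation of $\mathcal A$ is completely reducible; (b) $\Lambda$ is irreducible; (c) $\mathrm{Mor}(v\otimes w,\Lambda\otimes v\otimes w)=\{0\}$ for all irreducible representations $v,w$. **Inhomogeneous quantum groups.** Data $\mathcal B,\mathcal A,\Delta,\Lambda,p,f,\eta,T$ *describe an inhomogeneous quantum group* if $(\mathcal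 A,\Delta,\Lambda)$ satisfies a.–c.; $\mathcal B$ is a bialgebra with $\mathcal A$ as a sub-bialgebra; $p=(p_s)_{s\in\mathcal I}$ are elements of $\mathcal B$, $f=(f_{st})$, $\eta=(\eta_s)$ are functionals on $\mathcal A$, $T=(T_{ij})$ are complex numbers; and 1. $\mathcal B$ is generated as an algebra by $\mathcal A$ and the $p_s$; $\begin{pmatrix}\Lambda&p\\0&1\end{pmatrix}$ is a representation over $\mathcal B$; some $p_i\notin\mathcal A$; and $\mathcal B^1\mathcal A\subset\mathcal B^1$, where $\mathcal B^1=\mathcal A\cdot\mathrm{span}\{1,p_i:i\in\mathcal I\}$; 2. $a\mapsto\begin{pmatrix}f(a)&\eta(a)\\0&\epsilon(a)\end{pmatrix}$ is a unital homomorphism, and for all $a\in\mathcal A$: $\Lambda_{st}(f_{tr}*a)=(a*f_{st})\Lambda_{tr}$ and $p_sa=(a*f_{st})p_t+a*\eta_s-\Lambda_{st}(\eta_t*a)$; 3. with $R_{ij,sm}=f_{im}(\Lambda_{js})$ one has $R^2=1$, and for $a_{ij}\in\mathcal A$ one has $a_{ij}p_ip_j\in\mathcal B^1$ if and only if $a_{ij}R_{ij,sm}+a_{sm}=0$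 for all $s,m$; 4. $RT=-T$ and, for all $k,l$, $(R-1)_{kl,ij}\bigl(p_ip_j-\eta_i(\Lambda_{js})p_s+T_{ij}-\Lambda_{im}\Lambda_{jn}T_{mn}\bigr)=0$. Write $Z_{ij,m}=\eta_i(\Lambda_{jm})$. **Proposition.** 1) Let $\mathcal B,\mathcal A,\Delta,\Lambda,p,f,\eta,T$ and $\hat{\mathcal B},\hat{\mathcal A},\hat\Delta,\hat\Lambda,\hat p,\hat f,\hat\eta,\hat T$ describe two inhomogeneous quantum groups and let $\varphi:\mathcal B\to\hat{\mathcal B}$ be an isomorphism of bialgebras. Then $\varphi(\mathcal A)=\hat{\mathcal A}$ and $\varphi(\mathcal B^1)=\hat{\mathcal B}^1$; so $\varphi$ restricts to an isomorphism of bialgebras $\varphi_{\mathcal A}:\mathcal A\to\hat{\mathcal A}$. 2) If moreover $\varphi(\Lambda)=M\hat\Lambda M^{-1}$ for an invertible complex matrix $M$ (with both index sets equal to $\mathcal I$), then there are $c\in\mathbb C\setminus\{0\}$ and $h\in\mathbb C^{\mathcal I}$ such that $$\varphi(p)=M(c\hat p+h-\hat\Lambda h),$$ $$\hat f=(M^{-1}fM)\circ\varphi_{\mathcal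 A}^{-1},\qquad \hat\eta=\tfrac1cM^{-1}(\eta+fMh-\epsilon Mh)\circ\varphi_{\mathcal A}^{-1},$$ the matrix $\hat R_{ij,sm}=\hat f_{im}(\hat\Lambda_{js})$ equals $(M^{-1}\otimes M^{-1})R(M\otimes M)$, and one can choose $$\hat T=\tfrac1{c^2}(M^{-1}\otimes M^{-1})T+\tfrac1{2c^2}(1-\hat R)\bigl[-(M^{-1}\otimes M^{-1})ZMh+h\otimes h\bigr],$$ that is, $\hat{\mathcal B},\hat{\mathcal A},\hat\Delta,\hat\Lambda,\hat p,\hat f,\hat\eta$ together with this $\hat T$ (in place of the given one) describe an inhomogeneous quantum group. 3) Conversely, let $\mathcal B,\mathcal A,\Delta,\Lambda,p,f,\eta,T$ describe an inhomogeneous quantum group, let $\hat{\mathcal A}$ be a Hopf algebra with invertible antipode such that $(\hat{\mathcal A},\hat\Delta,\hat\Lambda)$ satisfies a.–c., let $\varphi_{\mathcal A}:\mathcal A\to\hat{\mathcal A}$ be an isomorphism of bialgebras with $\varphi_{\mathcal A}(\Lambda)=M\hat\Lambda M^{-1}$ for an invertible complex matrix $M$, and let $c\in\mathbb C\setminus\{0\}$,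 $h\in\mathbb C^{\mathcal I}$. Then there exist an inhomogeneous quantum group described by some $\hat{\mathcal B},\hat{\mathcal A},\hat\Delta,\hat\Lambda,\hat p,\hat f,\hat\eta,\hat T$ and an isomorphism of bialgebras $\varphi:\mathcal B\to\hat{\mathcal B}$ such that $\varphi|_{\mathcal A}=\varphi_{\mathcal A}$ and all the formulas displayed in 2) hold (with $\hat R=(M^{-1}\otimes M^{-1})R(M\otimes M)$). -/

import Mathlib

open scoped TensorProduct Kronecker

universe w

namespace InhomQG

/-! ### Matrix representations of a coalgebra over the complex numbers -/

/-- A square matrix `v` over a coalgebra is a representation: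
`Δ v_ij = ∑ k, v_ik ⊗ v_kj` and `ε (v_ij) = δ_ij`. -/
def IsRep {C n : Type*} [Ring C] [Bialgebra ℂ C] [Fintype n] [DecidableEq n]
    (v : Matrix n n C) : Prop :=
  (∀ i j, Coalgebra.comul (R := ℂ) (v i j) = ∑ k, v i k ⊗ₜ[ℂ] v k j) ∧
    ∀ i j, Coalgebra.counit (R := ℂ) (v i j) = if i = j then 1 else 0

/-- `W ⊆ ℂⁿ` is invariant under `v`: all the complex matrices `ρ (v)`, for `ρ` a linear functional,
map `W` into itself (equivalently, `v x` lies in `A ⊗ W` for `x` in `W`). -/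
def IsInvariant {C n : Type*} [Ring C] [Algebra ℂ C] [Fintype n]
    (v : Matrix n n C) (W : Submodule ℂ (n → ℂ)) : Prop :=
  ∀ ρ : C →ₗ[ℂ] ℂ, ∀ x ∈ W, (v.map ρ).mulVec x ∈ W

/-- Irreducible representation (of nonzero dimension). -/
def IsIrrep {C n : Type*} [Ring C] [Bialgebra ℂ C] [Fintype n] [DecidableEq n]
    (v : Matrix n n C) : Prop :=
  IsRep v ∧ Nonempty n ∧ ∀ W : Submodule ℂ (n → ℂ), IsInvariant v W → W = ⊥ ∨ W = ⊤

/-- Every invariant subspace has an invariant complement. -/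
def IsCompletelyReducible {C n : Type*} [Ring C] [Algebra ℂ C] [Fintype n]
    (v : Matrix n n C) : Prop :=
  ∀ W : Submodule ℂ (n → ℂ), IsInvariant v W →
    ∃ W' : Submodule ℂ (n → ℂ), IsInvariant v W' ∧ IsCompl W W'

/-- `X` intertwines `v` with `w`, that is `X v = w X`. -/
def IsMor {C n m : Type*} [Ring C] [Algebra ℂ C] [Fintype n] [Fintype m]
    (v : Matrix n n C) (w : Matrix m m C) (X : Matrix m n ℂ) : Prop :=
  X.map (algebraMap ℂ C) * v = w * X.map (algebraMap ℂ C)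

/-- The standing assumptions on the homogeneous part `(A, Δ)` and on the distinguished
representation `Λ`. In `mor_eq_zero`, `v ⊗ₖ w` is the tensor product of representations
`(v ⊗ₖ w)_{ij,kl} = v_ik w_jl`. -/
structure IsHomogeneousPart {A I : Type*} [Ring A] [HopfAlgebra ℂ A] [Fintype I] [DecidableEq I]
    (Λ : Matrix I I A) : Prop where
  /-- the coinverse is invertible -/
  antipode_bijective : Function.Bijective (HopfAlgebra.antipode ℂ (A := A))
  /-- all representations are completely reducible -/
  completelyReducible : ∀ (n : ℕ) (v : Matrix (Fin n) (Fin n) A), IsRep v →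
    IsCompletelyReducible v
  /-- the distinguished representation is irreducible -/
  irreducible : IsIrrep Λ
  /-- `Mor (v ⊗ w, Λ ⊗ v ⊗ w) = 0` for irreducible `v`, `w` -/
  mor_eq_zero : ∀ (n m : ℕ) (v : Matrix (Fin n) (Fin n) A) (w : Matrix (Fin m) (Fin m) A),
    IsIrrep v → IsIrrep w →
    ∀ X : Matrix (I × (Fin n × Fin m)) (Fin n × Fin m) ℂ,
      IsMor (v ⊗ₖ w) (Λ ⊗ₖ (v ⊗ₖ w)) X → X = 0

/-! ### Convolutions -/

section Convolution

variable {A : Type*} [Ring A] [Bialgebra ℂ A]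

/-- `a * ρ = (ρ ⊗ id) Δ a`. -/
noncomputable def rconv (a : A) (ρ : A →ₗ[ℂ] ℂ) : A :=
  TensorProduct.lid ℂ A (ρ.rTensor A (Coalgebra.comul (R := ℂ) a))

/-- `ρ * a = (id ⊗ ρ) Δ a`. -/
noncomputable def lconv (ρ : A →ₗ[ℂ] ℂ) (a : A) : A :=
  TensorProduct.rid ℂ A (ρ.lTensor A (Coalgebra.comul (R := ℂ) a))

end Convolution

/-! ### The numerical matrices attached to `Λ`, `f`, `η` -/

section Numerical

variable {A I : Type*} [Ring A] [Algebra ℂ A]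

/-- The functional `f_st` of a matrix `f` of functionals. -/
noncomputable def fcomp (f : A →ₗ[ℂ] Matrix I I ℂ) (s t : I) : A →ₗ[ℂ] ℂ where
  toFun a := f a s t
  map_add' a b := by simp
  map_smul' c a := by simp

/-- The functional `η_s` of a vector `η` of functionals. -/
noncomputable def ηcomp (η : A →ₗ[ℂ] (I → ℂ)) (s : I) : A →ₗ[ℂ] ℂ where
  toFun a := η a s
  map_add' a b := by simp
  map_smul' c a := by simp

/-- `R_{ij,sm} = f_im (Λ_js)`. -/
def Rmat (Λ : Matrix I I A) (f : A →ₗ[ℂ] Matrix I I ℂ) : Matrix (I × I) (I × I) ℂ :=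
  fun x y => f (Λ x.2 y.1) x.1 y.2

/-- `Z_{ij,m} = η_i (Λ_jm)`. -/
def Zmat (Λ : Matrix I I A) (η : A →ₗ[ℂ] (I → ℂ)) : Matrix (I × I) I ℂ :=
  fun x m => η (Λ x.2 m) x.1

end Numerical

/-! ### Inhomogeneous quantum groups -/

section Main

variable {A B I : Type*} [Ring A] [HopfAlgebra ℂ A] [Ring B] [Bialgebra ℂ B]

/-- `B¹ = A · span {1, p_i}`, where `A` sits in `B` through `ι`. -/
def filtOne (ι : A →ₐc[ℂ] B) (p : I → B) : Submodule ℂ B :=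
  Submodule.span ℂ (Set.range ι ∪ {x | ∃ (a : A) (i : I), x = ι a * p i})

variable [Fintype I] [DecidableEq I]

/-- `(B, A, Δ, Λ, p, f, η, T)` describes an inhomogeneous quantum group. The Hopf algebra `A` sits in
the bialgebra `B` through `ι`; the matrix `f = (f_st)` of functionals on `A` is recorded as a map to
complex matrices, and the vector `η = (η_s)` as a map to complex vectors. -/
structure IsInhomogeneousQuantumGroup (Λ : Matrix I I A) (ι : A →ₐc[ℂ] B) (p : I → B)
    (f : A →ₗ[ℂ] Matrix I I ℂ) (η : A →ₗ[ℂ] (I → ℂ)) (T : I × I → ℂ) : Prop where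
  homogeneousPart : IsHomogeneousPart Λ
  /-- `B` is generated as an algebra by `A` and the `p_s` -/
  generated : Algebra.adjoin ℂ (Set.range ι ∪ Set.range p) = ⊤
  /-- `A` is a sub-bialgebra of `B` -/
  injective : Function.Injective ι
  /-- `𝒫 = (Λ p; 0 1)` is a representation -/
  rep : IsRep (Matrix.fromBlocks (Λ.map ι) (Matrix.of fun i (_ : Unit) => p i) 0 1 :
    Matrix (I ⊕ Unit) (I ⊕ Unit) B)
  exists_notMem : ∃ i, p i ∉ Set.range ι
  /-- `Γ A ⊆ Γ` for `Γ = A · span {p_i} + A` -/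
  mul_mem : ∀ x ∈ filtOne ι p, ∀ a : A, x * ι a ∈ filtOne ι p
  /-- `a ↦ (f(a) η(a); 0 ε(a))` is a unital homomorphism -/
  f_one : f 1 = 1
  f_mul : ∀ a b, f (a * b) = f a * f b
  η_one : η 1 = 0
  η_mul : ∀ a b, η (a * b) = Coalgebra.counit (R := ℂ) b • η a + (f a).mulVec (η b)
  /-- `Λ_st (f_tr * a) = (a * f_st) Λ_tr` -/
  Λ_f : ∀ (a : A) (s r : I),
    ∑ t, Λ s t * lconv (fcomp f t r) a = ∑ t, rconv a (fcomp f s t) * Λ t r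
  /-- `p_s a = (a * f_st) p_t + a * η_s - Λ_st (η_t * a)` -/
  p_mul : ∀ (a : A) (s : I),
    p s * ι a = ∑ t, ι (rconv a (fcomp f s t)) * p t +
      ι (rconv a (ηcomp η s) - ∑ t, Λ s t * lconv (ηcomp η t) a)
  R_sq : Rmat Λ f * Rmat Λ f = 1
  /-- The space of leading terms of the quadratic relations of `B` is all of `ker (ρ + id)`:
  the combination `∑ a_ij p_i p_j` can be expressed through `1` and the `p_i`
  exactly when `a (R + 1) = 0`. -/
  leading_terms : ∀ a : I × I → A,
    ∑ x, ι (a x) * (p x.1 * p x.2) ∈ filtOne ι p ↔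
      Matrix.vecMul a ((Rmat Λ f + 1).map (algebraMap ℂ A)) = 0
  /-- `R T = -T` -/
  R_T : (Rmat Λ f).mulVec T = -T
  /-- `(R - 1)_{kl,ij} (p_i p_j - η_i(Λ_js) p_s + T_ij - Λ_im Λ_jn T_mn) = 0` -/
  quadratic : ∀ y : I × I,
    ∑ x, (Rmat Λ f - 1) y x •
      (p x.1 * p x.2 - ∑ s, Zmat Λ η x s • p s + T x • 1
        - ∑ z, T z • ι (Λ x.1 z.1 * Λ x.2 z.2)) = 0

end Main

/-! ### The transformed data -/

section Transform

variable {I : Type*} [Fintype I] [DecidableEq I]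

/-- `(M⁻¹ ⊗ M⁻¹) R (M ⊗ M)`. -/
noncomputable def hatR (M : Matrix I I ℂ) (R : Matrix (I × I) (I × I) ℂ) :
    Matrix (I × I) (I × I) ℂ :=
  (M⁻¹ ⊗ₖ M⁻¹) * R * (M ⊗ₖ M)

/-- `c⁻² (M⁻¹ ⊗ M⁻¹) T + (2c²)⁻¹ (1 - R̂) [-(M⁻¹ ⊗ M⁻¹) Z M h + h ⊗ h]`,
where `R̂ = (M⁻¹ ⊗ M⁻¹) R (M ⊗ M)`. -/
noncomputable def hatT (M : Matrix I I ℂ) (c : ℂ) (h : I → ℂ) (R : Matrix (I × I) (I × I) ℂ)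
    (Z : Matrix (I × I) I ℂ) (T : I × I → ℂ) : I × I → ℂ :=
  (1 / c ^ 2) • (M⁻¹ ⊗ₖ M⁻¹).mulVec T +
    (1 / (2 * c ^ 2)) • (1 - hatR M R).mulVec
      (-((M⁻¹ ⊗ₖ M⁻¹) * Z * M).mulVec h + fun x => h x.1 * h x.2)

/-- `c⁻¹ M⁻¹ (η + f M h - ε M h)` for the values `f`, `η`, `ε` at a given element. -/
noncomputable def hatη (M : Matrix I I ℂ) (c : ℂ) (h : I → ℂ) (f : Matrix I I ℂ) (η : I → ℂ)
    (ε : ℂ) : I → ℂ :=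
  (1 / c) • M⁻¹.mulVec (η + f.mulVec (M.mulVec h) - ε • M.mulVec h)

end Transform

end InhomQG

/-! The algebra `B` is filtered by degree in the `p_i`. The point is to recognise degrees zero and
one from the coalgebra structure and complete reducibility, which an isomorphism of bialgebras
respects.

Degree zero: modulo lower degree in the first leg, `Δ x` has its second leg in `A`, so slicing the
second leg by a functional that vanishes on `A` lowers the degree (`comul_filt_right`). Hence every
nonzero subrepresentation over `B` contains a nonzero vector whose coefficients lie in `A`. A
bialgebra embedded in `B` all of whose representations are completely reducible therefore lands in
`A` (`map_mem_of_injective`). Used for `φ` and its inverse, this matches the two homogeneous parts.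

Degree one: let `γ_t` be the counit of the coefficient of `p_t`, extended from `B¹` to `B`. By the
quadratic relation, the operator `x ↦ ∑ (γ_t ⊗ id)(Δ x) p_t` multiplies leading terms of degree `n`
by `n` (`euler_sub_mem`). If `Δ x` lies in `A ⊗ B + B ⊗ A`, it sends `x` into `B¹`, and
characteristic zero forces `x` itself into `B¹`. The elements `φ (p_i)` have such a coproduct. That
`γ_t` exists is the independence of `1, p_i` over `A` (`eq_zero_of_sum_mem`), which uses
irreducibility of `Λ` and the inverse of the antipode.

A family in `B¹` with the coproduct of the `p_i` equals `c p + h - Λ h` (`exists_eq_of_comul`):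
Schur's lemma gives `c`, and complete reducibility makes the remaining cocycle in `A` a coboundary.
The commutation relations determine `f` by independence, and `η` by the vanishing of `Mor`
(`functionals_unique`), so it suffices to transport the data along `φ` and compare. The transport
(`transport`) is the translation `p - k + Λ k` with `k = M h` (`shift`), followed by `φ`, followed
by a change of basis by `c M` (`change_basis`). Its main computation is the behaviour of the
quadratic relation under translation (`quadratic_shift`). The converse is the same transport with
`φ` the identity of `B`. -/

namespace InhomQG

/-! ### Slices of tensors by functionals -/

section Slices

variable {V W : Type*} [AddCommGroup V] [Module ℂ V] [AddCommGroup W] [Module ℂ W]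

/-- `ρ ⊗ id`. -/
noncomputable def sliceLeft (W : Type*) [AddCommGroup W] [Module ℂ W] (ρ : V →ₗ[ℂ] ℂ) :
    V ⊗[ℂ] W →ₗ[ℂ] W :=
  (TensorProduct.lid ℂ W).toLinearMap ∘ₗ ρ.rTensor W

/-- `id ⊗ ρ`. -/
noncomputable def sliceRight (V : Type*) [AddCommGroup V] [Module ℂ V] (ρ : W →ₗ[ℂ] ℂ) :
    V ⊗[ℂ] W →ₗ[ℂ] V :=
  (TensorProduct.rid ℂ V).toLinearMap ∘ₗ ρ.lTensor V

@[simp] theorem sliceLeft_tmul (ρ : V →ₗ[ℂ] ℂ) (v : V) (x : W) :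
    sliceLeft W ρ (v ⊗ₜ x) = ρ v • x := by simp [sliceLeft]

@[simp] theorem sliceRight_tmul (ρ : W →ₗ[ℂ] ℂ) (v : V) (x : W) :
    sliceRight V ρ (v ⊗ₜ x) = ρ x • v := by simp [sliceRight]

theorem sliceRight_ext {z t : V ⊗[ℂ] W}
    (h : ∀ ρ : W →ₗ[ℂ] ℂ, sliceRight V ρ z = sliceRight V ρ t) : z = t := by
  classical
  let b := Module.Basis.ofVectorSpace ℂ W
  apply (TensorProduct.equivFinsuppOfBasisRight (M := V) b).injective
  ext i
  simpa only [TensorProduct.equivFinsuppOfBasisRight_apply, sliceRight, LinearMap.comp_apply,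
    LinearEquiv.coe_coe] using h (b.coord i)

theorem eq_of_forall_dual {x y : V} (h : ∀ ρ : V →ₗ[ℂ] ℂ, ρ x = ρ y) : x = y := by
  rw [← sub_eq_zero, ← Module.forall_dual_apply_eq_zero_iff ℂ]
  intro φ
  rw [map_sub, h φ, sub_self]

/-- Over a field, functionals separate a subspace from any point outside it. This is how membership
in `A` is tested by functionals vanishing on `A`. -/
theorem mem_of_forall_dual {S : Submodule ℂ V} {x : V}
    (h : ∀ ρ : V →ₗ[ℂ] ℂ, (∀ y ∈ S, ρ y = 0) → ρ x = 0) : x ∈ S := by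
  by_contra hx
  obtain ⟨ρ, hρ, hS⟩ := Submodule.exists_le_ker_of_notMem hx
  exact hρ (h ρ fun y hy => hS hy)

theorem apply_sliceLeft (ρ : V →ₗ[ℂ] ℂ) (σ : W →ₗ[ℂ] ℂ) (z : V ⊗[ℂ] W) :
    σ (sliceLeft W ρ z) = ρ (sliceRight V σ z) := by
  induction z with
  | zero => simp
  | tmul x y => simp [mul_comm]
  | add x y hx hy => simp [hx, hy]

end Slices

/-! ### Convolutions and matrix coefficients in a bialgebra. -/

section Coalgebra

variable {A : Type*} [Ring A] [Bialgebra ℂ A]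

theorem rconv_eq (a : A) (ρ : A →ₗ[ℂ] ℂ) :
    rconv a ρ = sliceLeft A ρ (Coalgebra.comul (R := ℂ) a) := rfl

theorem lconv_eq (ρ : A →ₗ[ℂ] ℂ) (a : A) :
    lconv ρ a = sliceRight A ρ (Coalgebra.comul (R := ℂ) a) := rfl

@[simp] theorem sliceLeft_counit (a : A) :
    sliceLeft A (Coalgebra.counit (R := ℂ)) (Coalgebra.comul (R := ℂ) a) = a := by
  simp [sliceLeft]

@[simp] theorem sliceRight_counit (a : A) :
    sliceRight A (Coalgebra.counit (R := ℂ)) (Coalgebra.comul (R := ℂ) a) = a := by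
  simp [sliceRight]

theorem counit_rconv (a : A) (ρ : A →ₗ[ℂ] ℂ) :
    Coalgebra.counit (R := ℂ) (rconv a ρ) = ρ a := by
  rw [rconv_eq, apply_sliceLeft, sliceRight_counit]

theorem counit_lconv (ρ : A →ₗ[ℂ] ℂ) (a : A) :
    Coalgebra.counit (R := ℂ) (lconv ρ a) = ρ a := by
  rw [lconv_eq, ← apply_sliceLeft, sliceLeft_counit]

/-- `σ * (ρ * a) = (σ * ρ) * a`. -/
theorem lconv_lconv (σ ρ : A →ₗ[ℂ] ℂ) (a : A) :
    lconv σ (lconv ρ a) =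
      lconv (LinearMap.mul' ℂ ℂ ∘ₗ TensorProduct.map σ ρ ∘ₗ Coalgebra.comul (R := ℂ)) a := by
  have h1 : ∀ z : A ⊗[ℂ] A, Coalgebra.comul (R := ℂ) (sliceRight A ρ z) =
      sliceRight (A ⊗[ℂ] A) ρ ((Coalgebra.comul (R := ℂ)).rTensor A z) := by
    intro z
    induction z with
    | zero => simp
    | tmul x y => simp
    | add x y hx hy => simp [hx, hy]
  have h2 : ∀ z : (A ⊗[ℂ] A) ⊗[ℂ] A, sliceRight A σ (sliceRight (A ⊗[ℂ] A) ρ z) =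
      sliceRight A (LinearMap.mul' ℂ ℂ ∘ₗ TensorProduct.map σ ρ) (TensorProduct.assoc ℂ A A A z) := by
    intro z
    induction z with
    | zero => simp
    | add x y hx hy => simp [hx, hy]
    | tmul x y =>
      induction x with
      | zero => simp
      | add x y hx hy => rw [TensorProduct.add_tmul, map_add, map_add, map_add, map_add, hx, hy]
      | tmul x x' => simp [smul_smul, mul_comm]
  have h3 : ∀ z : A ⊗[ℂ] A, sliceRight A (LinearMap.mul' ℂ ℂ ∘ₗ TensorProduct.map σ ρ)
      ((Coalgebra.comul (R := ℂ)).lTensor A z) = sliceRight A (LinearMap.mul' ℂ ℂ ∘ₗ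
        TensorProduct.map σ ρ ∘ₗ Coalgebra.comul (R := ℂ)) z := by
    intro z
    induction z with
    | zero => simp
    | tmul x y => simp
    | add x y hx hy => simp [hx, hy]
  rw [lconv_eq, lconv_eq, lconv_eq, h1, h2, Coalgebra.coassoc_apply, h3]

theorem comul_sliceLeft (ρ : A →ₗ[ℂ] ℂ) (z : A ⊗[ℂ] A) :
    Coalgebra.comul (R := ℂ) (sliceLeft A ρ z) =
      sliceLeft (A ⊗[ℂ] A) ρ ((Coalgebra.comul (R := ℂ)).lTensor A z) := by
  induction z with
  | zero => simp
  | tmul x y => simp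
  | add x y hx hy => simp [hx, hy]

/-- The fundamental theorem on coalgebras: every element is a linear combination of the matrix
elements of a representation. -/
theorem exists_rep (a : A) : ∃ (n : ℕ) (v : Matrix (Fin n) (Fin n) A), IsRep v ∧
    a ∈ Submodule.span ℂ (Set.range fun x : Fin n × Fin n => v x.1 x.2) := by
  classical
  let Φ : (A →ₗ[ℂ] ℂ) →ₗ[ℂ] A :=
    { toFun := fun ρ => lconv ρ a
      map_add' := fun ρ σ => by simp [lconv, LinearMap.lTensor_add]
      map_smul' := fun c ρ => by simp [lconv, LinearMap.lTensor_smul] }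
  -- The subcomodule generated by `a`; it is finite-dimensional because `Δ a` is a finite sum of
  -- simple tensors.
  let V := LinearMap.range Φ
  have hfin : Module.Finite ℂ V := by
    obtain ⟨S, hS⟩ := TensorProduct.exists_finset (R := ℂ) (Coalgebra.comul (R := ℂ) a)
    have hle : V ≤ Submodule.span ℂ (S.image Prod.fst : Set A) := by
      rintro _ ⟨ρ, rfl⟩
      change lconv ρ a ∈ _
      rw [lconv_eq, hS, map_sum]
      refine Submodule.sum_mem _ fun x hx => ?_
      rw [sliceRight_tmul]
      refine Submodule.smul_mem _ _ (Submodule.subset_span ?_)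
      simp only [Finset.coe_image, Set.mem_image, SetLike.mem_coe]
      exact ⟨x, hx, rfl⟩
    have : Module.Finite ℂ (Submodule.span ℂ (S.image Prod.fst : Set A)) :=
      Module.Finite.span_of_finite ℂ (Finset.finite_toSet _)
    exact Submodule.finiteDimensional_of_le hle
  let b := Module.finBasis ℂ V
  have hstab : ∀ (σ : A →ₗ[ℂ] ℂ), ∀ x ∈ V, lconv σ x ∈ V := by
    rintro σ _ ⟨ρ, rfl⟩
    exact ⟨_, (lconv_lconv σ ρ a).symm⟩
  have haV : a ∈ V := ⟨Coalgebra.counit (R := ℂ), sliceRight_counit a⟩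
  choose β hβ using fun i => LinearMap.exists_extend (b.coord i)
  have hβ' : ∀ i, ∀ y : V, β i y = b.repr y i := fun i y => by
    have := LinearMap.congr_fun (hβ i) y
    simpa using this
  have hsum : ∀ y ∈ V, y = ∑ i, β i y • (b i : A) := by
    intro y hy
    have := congrArg Subtype.val (b.sum_repr ⟨y, hy⟩)
    simp only [Submodule.coe_sum, Submodule.coe_smul] at this
    rw [← this]
    refine (Finset.sum_congr rfl fun i _ => ?_)
    rw [this, ← hβ' i ⟨y, hy⟩]
  -- The coefficients of the coaction `Δ b_j = ∑ b_i ⊗ v_ij`. Once the coordinates of `V` are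
  -- extended to `A`, they are slices of `Δ b_j`, and coassociativity yields the representation
  -- property.
  let v : Matrix (Fin (Module.finrank ℂ V)) (Fin (Module.finrank ℂ V)) A :=
    fun i j => rconv (b j : A) (β i)
  have hΔ : ∀ j, Coalgebra.comul (R := ℂ) (b j : A) = ∑ i, (b i : A) ⊗ₜ[ℂ] v i j := by
    intro j
    refine sliceRight_ext fun σ => ?_
    rw [← lconv_eq, hsum _ (hstab σ _ (b j).2), map_sum]
    refine Finset.sum_congr rfl fun i _ => ?_
    rw [sliceRight_tmul, lconv_eq, ← apply_sliceLeft]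
    rfl
  have hcoef : ∀ i j, β i (b j : A) = if i = j then 1 else 0 := by
    intro i j
    rw [hβ', b.repr_self, Finsupp.single_apply]
    simp only [eq_comm]
  refine ⟨_, v, ⟨fun i j => ?_, fun i j => ?_⟩, ?_⟩
  · change Coalgebra.comul (R := ℂ) (sliceLeft A (β i) (Coalgebra.comul (R := ℂ) (b j : A))) = _
    rw [comul_sliceLeft, ← Coalgebra.coassoc_apply, hΔ, map_sum, map_sum, map_sum]
    refine Finset.sum_congr rfl fun k _ => ?_
    rw [LinearMap.rTensor_tmul]
    have : ∀ (z : A ⊗[ℂ] A) (y : A), sliceLeft (A ⊗[ℂ] A) (β i) (TensorProduct.assoc ℂ A A A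
        (z ⊗ₜ y)) = sliceLeft A (β i) z ⊗ₜ y := by
      intro z y
      induction z with
      | zero => simp
      | tmul x y => simp [TensorProduct.smul_tmul']
      | add x y hx hy => simp [hx, hy, TensorProduct.add_tmul]
    rw [this]
    rfl
  · change Coalgebra.counit (R := ℂ) (rconv (b j : A) (β i)) = _
    rw [counit_rconv, hcoef]
  · rw [hsum a haV]
    refine Submodule.sum_mem _ fun j _ => Submodule.smul_mem _ _ ?_
    rw [← sliceLeft_counit (b j : A), hΔ, map_sum]
    refine Submodule.sum_mem _ fun i _ => ?_
    rw [sliceLeft_tmul]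
    exact Submodule.smul_mem _ _ (Submodule.subset_span ⟨(i, j), rfl⟩)

end Coalgebra

end InhomQG

namespace InhomQG

/-! ### The filtration of an inhomogeneous quantum group by degree in the `p_i` -/

section Filtration

variable {A B I : Type*} [Ring A] [HopfAlgebra ℂ A] [Ring B] [Bialgebra ℂ B]

/-- The copy of `A` in `B` as a subspace. -/
def imA (ι : A →ₐc[ℂ] B) : Submodule ℂ B := LinearMap.range (ι : A →ₗ[ℂ] B)

theorem mem_imA {ι : A →ₐc[ℂ] B} {x : B} : x ∈ imA ι ↔ ∃ a, ι a = x := Iff.rfl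

theorem map_mem_imA (ι : A →ₐc[ℂ] B) (a : A) : ι a ∈ imA ι := ⟨a, rfl⟩

/-- The elements of degree at most `n` in the `p_i` form `filt ι p (n + 2)`. -/
def filt (ι : A →ₐc[ℂ] B) (p : I → B) : ℕ → Submodule ℂ B
  -- Indices 0 and 1 stand for the degrees `-2` and `-1`, so that estimates one or two degrees down
  -- need no separate low cases.
  | 0 => ⊥
  | 1 => ⊥
  | 2 => imA ι
  | n + 3 => filt ι p (n + 2) ⊔ ⨆ i, (filt ι p (n + 2)).map (LinearMap.mulRight ℂ (p i))

theorem filt_mono (ι : A →ₐc[ℂ] B) (p : I → B) : Monotone (filt ι p) := by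
  refine monotone_nat_of_le_succ fun n => ?_
  match n with
  | 0 => exact bot_le
  | 1 => exact bot_le
  | n + 2 => exact le_sup_left

theorem filt_mul_p (ι : A →ₐc[ℂ] B) (p : I → B) (n : ℕ) {x : B} (hx : x ∈ filt ι p n) (i : I) :
    x * p i ∈ filt ι p (n + 1) := by
  match n, hx with
  | 0, hx => rw [(Submodule.mem_bot ℂ).1 hx, zero_mul]; exact zero_mem _
  | 1, hx => rw [(Submodule.mem_bot ℂ).1 hx, zero_mul]; exact zero_mem _
  | n + 2, hx =>
    exact Submodule.mem_sup_right (Submodule.mem_iSup_of_mem i ⟨x, hx, rfl⟩)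

/-- The filtration grows by right multiplication by the `p_i` alone, so a degree estimate has to be
checked on `A` and carried through one such multiplication. -/
theorem filt_induction (ι : A →ₐc[ℂ] B) (p : I → B) {L : ℕ → Submodule ℂ B}
    (h2 : imA ι ≤ L 2) (hL : ∀ n, L (n + 2) ≤ L (n + 3))
    (hp : ∀ n, ∀ x ∈ filt ι p (n + 2), x ∈ L (n + 2) → ∀ i, x * p i ∈ L (n + 3)) (n : ℕ) :
    filt ι p n ≤ L n := by
  match n with
  | 0 => exact bot_le
  | 1 => exact bot_le
  | n + 2 =>
    induction n with
    | zero => exact h2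
    | succ n ih =>
      refine sup_le (ih.trans (hL n)) (iSup_le fun i => ?_)
      rintro _ ⟨x, hx, rfl⟩
      exact hp n x hx (ih hx) i

theorem filtOne_eq (ι : A →ₐc[ℂ] B) (p : I → B) : filtOne ι p = filt ι p 3 := by
  apply le_antisymm
  · refine Submodule.span_le.2 ?_
    rintro x (⟨a, rfl⟩ | ⟨a, i, rfl⟩)
    · exact filt_mono ι p (by norm_num : 2 ≤ 3) (map_mem_imA ι a)
    · exact filt_mul_p ι p 2 (map_mem_imA ι a) i
  · refine sup_le ?_ (iSup_le fun i => ?_)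
    · rintro _ ⟨a, rfl⟩
      exact Submodule.subset_span (Or.inl ⟨a, rfl⟩)
    · rintro _ ⟨_, ⟨a, rfl⟩, rfl⟩
      exact Submodule.subset_span (Or.inr ⟨a, i, rfl⟩)

theorem mem_filtOne [Fintype I] {ι : A →ₐc[ℂ] B} {p : I → B} {x : B} :
    x ∈ filtOne ι p ↔ ∃ (a : A) (b : I → A), x = ι a + ∑ i, ι (b i) * p i := by
  constructor
  · intro hx
    classical
    induction hx using Submodule.span_induction with
    | mem x hx =>
      rcases hx with ⟨a, rfl⟩ | ⟨a, i, rfl⟩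
      · exact ⟨a, 0, by simp⟩
      · refine ⟨0, Pi.single i a, ?_⟩
        rw [Finset.sum_eq_single i]
        · simp
        · intro j _ hj
          simp [Pi.single_eq_of_ne hj]
        · simp
    | zero => exact ⟨0, 0, by simp⟩
    | add x y _ _ hx hy =>
      obtain ⟨a, b, rfl⟩ := hx
      obtain ⟨a', b', rfl⟩ := hy
      refine ⟨a + a', b + b', ?_⟩
      simp only [map_add, Pi.add_apply, add_mul, Finset.sum_add_distrib]
      abel
    | smul c x _ hx =>
      obtain ⟨a, b, rfl⟩ := hx
      refine ⟨c • a, c • b, ?_⟩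
      simp only [map_smul, Pi.smul_apply, smul_mul_assoc, smul_add, Finset.smul_sum]
  · rintro ⟨a, b, rfl⟩
    exact add_mem (Submodule.subset_span (Or.inl ⟨a, rfl⟩)) (Submodule.sum_mem _ fun i _ =>
      Submodule.subset_span (Or.inr ⟨b i, i, rfl⟩))

theorem map_mem_filtOne (ι : A →ₐc[ℂ] B) (p : I → B) (a : A) : ι a ∈ filtOne ι p :=
  Submodule.subset_span (Or.inl ⟨a, rfl⟩)

theorem map_mul_mem_filtOne (ι : A →ₐc[ℂ] B) (p : I → B) (a : A) (i : I) :
    ι a * p i ∈ filtOne ι p :=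
  Submodule.subset_span (Or.inr ⟨a, i, rfl⟩)

theorem p_mem_filtOne (ι : A →ₐc[ℂ] B) (p : I → B) (i : I) : p i ∈ filtOne ι p := by
  simpa using map_mul_mem_filtOne ι p 1 i

theorem mul_mem_filtOne (ι : A →ₐc[ℂ] B) (p : I → B) (a : A) {x : B} (hx : x ∈ filtOne ι p) :
    ι a * x ∈ filtOne ι p := by
  induction hx using Submodule.span_induction with
  | mem x hx =>
    rcases hx with ⟨b, rfl⟩ | ⟨b, i, rfl⟩
    · rw [← map_mul]
      exact map_mem_filtOne ι p _
    · rw [← mul_assoc, ← map_mul]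
      exact map_mul_mem_filtOne ι p _ i
  | zero => simp
  | add x y _ _ hx hy => rw [mul_add]; exact add_mem hx hy
  | smul c x _ hx => rw [mul_smul_comm]; exact Submodule.smul_mem _ _ hx

theorem mul_mem_imA {ι : A →ₐc[ℂ] B} {x y : B} (hx : x ∈ imA ι) (hy : y ∈ imA ι) :
    x * y ∈ imA ι := by
  obtain ⟨a, rfl⟩ := hx
  obtain ⟨b, rfl⟩ := hy
  exact ⟨a * b, map_mul ι a b⟩

theorem comul_map (ι : A →ₐc[ℂ] B) (a : A) : Coalgebra.comul (R := ℂ) (ι a) =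
    TensorProduct.map (ι : A →ₗ[ℂ] B) (ι : A →ₗ[ℂ] B) (Coalgebra.comul (R := ℂ) a) :=
  (CoalgHomClass.map_comp_comul_apply ι a).symm

theorem counit_map (ι : A →ₐc[ℂ] B) (a : A) : Coalgebra.counit (R := ℂ) (ι a) =
    Coalgebra.counit (R := ℂ) a :=
  CoalgHomClass.counit_comp_apply ι a

variable [Fintype I] [DecidableEq I] {Λ : Matrix I I A} {ι : A →ₐc[ℂ] B} {p : I → B}
    {f : A →ₗ[ℂ] Matrix I I ℂ} {η : A →ₗ[ℂ] (I → ℂ)} {T : I × I → ℂ}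

namespace IsInhomogeneousQuantumGroup

theorem isRep (H : IsInhomogeneousQuantumGroup Λ ι p f η T) : IsRep Λ :=
  H.homogeneousPart.irreducible.1

theorem comul_p (H : IsInhomogeneousQuantumGroup Λ ι p f η T) (i : I) :
    Coalgebra.comul (R := ℂ) (p i) = ∑ j, ι (Λ i j) ⊗ₜ[ℂ] p j + p i ⊗ₜ[ℂ] 1 := by
  simpa using H.rep.1 (Sum.inl i) (Sum.inr ())

theorem counit_p (H : IsInhomogeneousQuantumGroup Λ ι p f η T) (i : I) :
    Coalgebra.counit (R := ℂ) (p i) = 0 := by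
  simpa using H.rep.2 (Sum.inl i) (Sum.inr ())

/-- The commutation relation moves `p_s` past `a` and produces new coefficients in `A` with at most
one `p_t`. The induction must therefore treat all `a` simultaneously. -/
theorem filt_mul_map (H : IsInhomogeneousQuantumGroup Λ ι p f η T) (n : ℕ) {x : B}
    (hx : x ∈ filt ι p n) (a : A) : x * ι a ∈ filt ι p n := by
  let L : ℕ → Submodule ℂ B := fun n => ⨅ a, (filt ι p n).comap (LinearMap.mulRight ℂ (ι a))
  have hL : ∀ n x, x ∈ L n ↔ ∀ a, x * ι a ∈ filt ι p n := fun n x => by simp [L]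
  refine (hL n x).1 (filt_induction ι p (L := L) ?_ ?_ ?_ n hx) a
  · intro x hx
    rw [hL]
    exact fun a => mul_mem_imA hx (map_mem_imA ι a)
  · intro n x hx
    rw [hL] at hx ⊢
    exact fun a => filt_mono ι p (Nat.le_succ _) (hx a)
  · intro n x hx hxL i
    rw [hL] at hxL ⊢
    intro a
    rw [mul_assoc, H.p_mul, mul_add, Finset.mul_sum]
    refine add_mem (Submodule.sum_mem _ fun t _ => ?_) (filt_mono ι p (Nat.le_succ _) (hxL _))
    rw [← mul_assoc]
    exact filt_mul_p ι p _ (hxL _) t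

theorem filt_mul_filtOne (H : IsInhomogeneousQuantumGroup Λ ι p f η T) (n : ℕ) {x y : B}
    (hx : x ∈ filt ι p n) (hy : y ∈ filtOne ι p) : x * y ∈ filt ι p (n + 1) := by
  obtain ⟨a, b, rfl⟩ := mem_filtOne.1 hy
  rw [mul_add, Finset.mul_sum]
  refine add_mem (filt_mono ι p (Nat.le_succ _) (H.filt_mul_map n hx a))
    (Submodule.sum_mem _ fun i _ => ?_)
  rw [← mul_assoc]
  exact filt_mul_p ι p n (H.filt_mul_map n hx _) i

theorem exists_mem_filt (H : IsInhomogeneousQuantumGroup Λ ι p f η T) (x : B) :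
    ∃ n, x ∈ filt ι p (n + 2) := by
  -- Right multiplication by any `b` has bounded degree. The quantifier over `m` allows the bounds
  -- of two factors to be composed; the case of `1 * x` is the claim.
  have key : ∀ b : B, ∀ m, ∃ n, ∀ y ∈ filt ι p (m + 2), y * b ∈ filt ι p (n + 2) := by
    intro b
    have hb : b ∈ Algebra.adjoin ℂ (Set.range ι ∪ Set.range p) := by
      rw [H.generated]; trivial
    induction hb using Algebra.adjoin_induction with
    | mem b hb =>
      rcases hb with ⟨a, rfl⟩ | ⟨i, rfl⟩
      · exact fun m => ⟨m, fun y hy => H.filt_mul_map _ hy a⟩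
      · exact fun m => ⟨m + 1, fun y hy => filt_mul_p ι p _ hy i⟩
    | algebraMap r =>
      refine fun m => ⟨m, fun y hy => ?_⟩
      rw [← Algebra.commutes, ← Algebra.smul_def]
      exact Submodule.smul_mem _ _ hy
    | add b c _ _ hb hc =>
      intro m
      obtain ⟨n, hn⟩ := hb m
      obtain ⟨k, hk⟩ := hc m
      refine ⟨max n k, fun y hy => ?_⟩
      rw [mul_add]
      exact add_mem (filt_mono ι p (by omega) (hn y hy)) (filt_mono ι p (by omega) (hk y hy))
    | mul b c _ _ hb hc =>
      intro m
      obtain ⟨n, hn⟩ := hb m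
      obtain ⟨k, hk⟩ := hc n
      refine ⟨k, fun y hy => ?_⟩
      rw [← mul_assoc]
      exact hk _ (hn y hy)
  obtain ⟨n, hn⟩ := key x 0
  refine ⟨n, ?_⟩
  have := hn 1 ⟨1, map_one ι⟩
  rwa [one_mul] at this

end IsInhomogeneousQuantumGroup

/-- The span of the `x ⊗ y` with `x ∈ U` and `y ∈ U'`. -/
abbrev tens (U U' : Submodule ℂ B) : Submodule ℂ (B ⊗[ℂ] B) :=
  Submodule.map₂ (TensorProduct.mk ℂ B B) U U'

theorem tmul_mem_tens {U U' : Submodule ℂ B} {x y : B} (hx : x ∈ U) (hy : y ∈ U') :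
    x ⊗ₜ[ℂ] y ∈ tens U U' :=
  Submodule.apply_mem_map₂ _ hx hy

theorem tens_mul_tmul {U U' V V' : Submodule ℂ B} {x y : B} (hx : ∀ u ∈ U, u * x ∈ V)
    (hy : ∀ u ∈ U', u * y ∈ V') {z : B ⊗[ℂ] B} (hz : z ∈ tens U U') :
    z * x ⊗ₜ[ℂ] y ∈ tens V V' := by
  have : tens U U' ≤ (tens V V').comap (LinearMap.mulRight ℂ (x ⊗ₜ[ℂ] y)) := by
    refine Submodule.map₂_le.2 fun u hu u' hu' => ?_
    simp only [TensorProduct.mk_apply, Submodule.mem_comap, LinearMap.mulRight_apply,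
      Algebra.TensorProduct.tmul_mul_tmul]
    exact tmul_mem_tens (hx u hu) (hy u' hu')
  exact this hz

theorem sliceRight_mem_of_mem_tens {U U' : Submodule ℂ B} (ρ : B →ₗ[ℂ] ℂ) {z : B ⊗[ℂ] B}
    (hz : z ∈ tens U U') : sliceRight B ρ z ∈ U := by
  have : tens U U' ≤ U.comap (sliceRight B ρ) := by
    refine Submodule.map₂_le.2 fun u hu u' _ => ?_
    simpa using Submodule.smul_mem _ _ hu
  exact this hz

theorem sliceLeft_mem_of_mem_tens {U U' : Submodule ℂ B} (ρ : B →ₗ[ℂ] ℂ) {z : B ⊗[ℂ] B}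
    (hz : z ∈ tens U U') : sliceLeft B ρ z ∈ U' := by
  have : tens U U' ≤ U'.comap (sliceLeft B ρ) := by
    refine Submodule.map₂_le.2 fun u _ u' hu' => ?_
    simpa using Submodule.smul_mem _ _ hu'
  exact this hz

theorem sliceRight_eq_zero_of_mem_tens {U U' : Submodule ℂ B} (ρ : B →ₗ[ℂ] ℂ)
    (hρ : ∀ y ∈ U', ρ y = 0) {z : B ⊗[ℂ] B} (hz : z ∈ tens U U') : sliceRight B ρ z = 0 := by
  have : tens U U' ≤ (⊥ : Submodule ℂ B).comap (sliceRight B ρ) := by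
    refine Submodule.map₂_le.2 fun u _ u' hu' => ?_
    simp [hρ u' hu']
  exact (Submodule.mem_bot ℂ).1 (this hz)

theorem sliceLeft_eq_zero_of_mem_tens {U U' : Submodule ℂ B} (ρ : B →ₗ[ℂ] ℂ)
    (hρ : ∀ y ∈ U, ρ y = 0) {z : B ⊗[ℂ] B} (hz : z ∈ tens U U') : sliceLeft B ρ z = 0 := by
  have : tens U U' ≤ (⊥ : Submodule ℂ B).comap (sliceLeft B ρ) := by
    refine Submodule.map₂_le.2 fun u hu u' _ => ?_
    simp [hρ u hu]
  exact (Submodule.mem_bot ℂ).1 (this hz)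

theorem comul_map_mem (ι : A →ₐc[ℂ] B) (a : A) :
    Coalgebra.comul (R := ℂ) (ι a) ∈ tens (imA ι) (imA ι) := by
  rw [comul_map]
  generalize Coalgebra.comul (R := ℂ) a = z
  induction z with
  | zero => simp
  | tmul x y => exact tmul_mem_tens (map_mem_imA ι x) (map_mem_imA ι y)
  | add x y hx hy => rw [map_add]; exact add_mem hx hy

namespace IsInhomogeneousQuantumGroup

/-- Multiplicativity of `Δ` reduces an estimate on `Δ (Bⁿ)` to right multiplication by the two kinds
of terms in `Δ p_i = ∑ Λ_ij ⊗ p_j + p_i ⊗ 1`. -/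
theorem comul_filt (H : IsInhomogeneousQuantumGroup Λ ι p f η T)
    {L : ℕ → Submodule ℂ (B ⊗[ℂ] B)}
    (h2 : tens (imA ι) (imA ι) ≤ L 2) (hL : ∀ n, L (n + 2) ≤ L (n + 3))
    (hl : ∀ n, ∀ z ∈ L (n + 2), ∀ i j, z * ι (Λ i j) ⊗ₜ[ℂ] p j ∈ L (n + 3))
    (hr : ∀ n, ∀ z ∈ L (n + 2), ∀ i, z * p i ⊗ₜ[ℂ] 1 ∈ L (n + 3))
    (n : ℕ) {x : B} (hx : x ∈ filt ι p n) : Coalgebra.comul (R := ℂ) x ∈ L n := by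
  refine filt_induction ι p (L := fun n => (L n).comap (Coalgebra.comul (R := ℂ))) ?_
    (fun n => Submodule.comap_mono (hL n)) ?_ n hx
  · rintro _ ⟨a, rfl⟩
    exact h2 (comul_map_mem ι a)
  · intro n x _ hxL i
    rw [Submodule.mem_comap] at hxL ⊢
    rw [Bialgebra.comul_mul, H.comul_p, mul_add, Finset.mul_sum]
    exact add_mem (Submodule.sum_mem _ fun j _ => hl n _ hxL i j) (hr n _ hxL i)

/-- `Δ (Bⁿ) ⊆ Bⁿ ⊗ A + Bⁿ⁻¹ ⊗ B`. -/
theorem comul_filt_right (H : IsInhomogeneousQuantumGroup Λ ι p f η T) (n : ℕ) {x : B}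
    (hx : x ∈ filt ι p (n + 1)) : Coalgebra.comul (R := ℂ) x ∈
      tens (filt ι p (n + 1)) (imA ι) ⊔ tens (filt ι p n) ⊤ := by
  -- The factor `Λ_ij ⊗ p_j` does not raise the degree of the first leg, so it pushes everything
  -- into the second summand; `p_i ⊗ 1` preserves each summand.
  refine H.comul_filt (L := fun n => tens (filt ι p n) (imA ι) ⊔ tens (filt ι p (n - 1)) ⊤)
    le_sup_left ?_ ?_ ?_ (n + 1) hx
  · intro n
    exact sup_le_sup (Submodule.map₂_le_map₂_left (filt_mono ι p (by omega)))
      (Submodule.map₂_le_map₂_left (filt_mono ι p (by omega)))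
  · intro n z hz i j
    obtain ⟨y, hy, t, ht, rfl⟩ := Submodule.mem_sup.1 hz
    rw [add_mul]
    refine Submodule.mem_sup_right (add_mem ?_ ?_)
    · exact tens_mul_tmul (fun u hu => H.filt_mul_map _ hu _) (fun _ _ => Submodule.mem_top) hy
    · exact tens_mul_tmul (fun u hu => filt_mono ι p (by omega) (H.filt_mul_map _ hu _))
        (fun _ _ => Submodule.mem_top) ht
  · intro n z hz i
    obtain ⟨y, hy, t, ht, rfl⟩ := Submodule.mem_sup.1 hz
    rw [add_mul]
    refine add_mem (Submodule.mem_sup_left ?_) (Submodule.mem_sup_right ?_)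
    · exact tens_mul_tmul (fun u hu => filt_mul_p ι p _ hu i) (fun u hu => by rwa [mul_one]) hy
    · exact tens_mul_tmul (fun u hu => filt_mul_p ι p _ hu i) (fun _ _ => Submodule.mem_top) ht

/-- `Δ (Bⁿ) ⊆ A ⊗ Bⁿ + B¹ ⊗ Bⁿ⁻¹ + B ⊗ Bⁿ⁻²`. -/
theorem comul_filt_left (H : IsInhomogeneousQuantumGroup Λ ι p f η T) (n : ℕ) {x : B}
    (hx : x ∈ filt ι p (n + 2)) : Coalgebra.comul (R := ℂ) x ∈
      tens (imA ι) (filt ι p (n + 2)) ⊔ tens (filtOne ι p) (filt ι p (n + 1)) ⊔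
        tens ⊤ (filt ι p n) := by
  -- The first leg is tracked up to degree one and then forgotten: `Λ_ij ⊗ p_j` preserves each
  -- summand, while `p_i ⊗ 1` moves a term to the next summand.
  refine H.comul_filt (L := fun n => tens (imA ι) (filt ι p n) ⊔
    tens (filtOne ι p) (filt ι p (n - 1)) ⊔ tens ⊤ (filt ι p (n - 2)))
    (le_sup_of_le_left le_sup_left) ?_ ?_ ?_ (n + 2) hx
  · intro n
    exact sup_le_sup (sup_le_sup (Submodule.map₂_le_map₂_right (filt_mono ι p (by omega)))
      (Submodule.map₂_le_map₂_right (filt_mono ι p (by omega))))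
      (Submodule.map₂_le_map₂_right (filt_mono ι p (by omega)))
  · intro n z hz i j
    obtain ⟨w, hw, t, ht, rfl⟩ := Submodule.mem_sup.1 hz
    obtain ⟨y, hy, s, hs, rfl⟩ := Submodule.mem_sup.1 hw
    rw [add_mul, add_mul]
    refine add_mem (Submodule.mem_sup_left (add_mem (Submodule.mem_sup_left ?_)
      (Submodule.mem_sup_right ?_))) (Submodule.mem_sup_right ?_)
    · exact tens_mul_tmul (fun u hu => mul_mem_imA hu (map_mem_imA ι _))
        (fun u hu => filt_mul_p ι p _ hu j) hy
    · exact tens_mul_tmul (fun u hu => H.mul_mem u hu _) (fun u hu => filt_mul_p ι p _ hu j) hs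
    · exact tens_mul_tmul (fun _ _ => Submodule.mem_top) (fun u hu => filt_mul_p ι p _ hu j) ht
  · intro n z hz i
    obtain ⟨w, hw, t, ht, rfl⟩ := Submodule.mem_sup.1 hz
    obtain ⟨y, hy, s, hs, rfl⟩ := Submodule.mem_sup.1 hw
    rw [add_mul, add_mul]
    refine add_mem (add_mem (Submodule.mem_sup_left (Submodule.mem_sup_right ?_))
      (Submodule.mem_sup_right ?_)) (Submodule.mem_sup_right ?_)
    · refine tens_mul_tmul ?_ (fun u hu => by rwa [mul_one]) hy
      rintro _ ⟨a, rfl⟩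
      exact map_mul_mem_filtOne ι p a i
    · exact tens_mul_tmul (fun _ _ => Submodule.mem_top) (fun u hu => by rwa [mul_one]) hs
    · exact tens_mul_tmul (fun _ _ => Submodule.mem_top)
        (fun u hu => by rw [mul_one]; exact filt_mono ι p (by omega) hu) ht

end IsInhomogeneousQuantumGroup

end Filtration

end InhomQG

namespace InhomQG

/-! ### Linear independence of `1` and the `p_i` over `A`. -/

section Independence

variable {A B I : Type*} [Ring A] [HopfAlgebra ℂ A] [Ring B] [Bialgebra ℂ B]
variable [Fintype I] [DecidableEq I] {Λ : Matrix I I A} {ι : A →ₐc[ℂ] B} {p : I → B}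
    {f : A →ₗ[ℂ] Matrix I I ℂ} {η : A →ₗ[ℂ] (I → ℂ)} {T : I × I → ℂ}

theorem exists_retraction {ι : A →ₐc[ℂ] B} (h : Function.Injective ι) :
    ∃ r : B →ₗ[ℂ] A, ∀ a, r (ι a) = a := by
  obtain ⟨r, hr⟩ := LinearMap.exists_leftInverse_of_injective (ι : A →ₗ[ℂ] B)
    (LinearMap.ker_eq_bot.2 h)
  exact ⟨r, fun a => LinearMap.congr_fun hr a⟩

theorem mulVec_map_apply {n C : Type*} [Fintype n] [Ring C] [Algebra ℂ C] (v : Matrix n n C)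
    (ρ : C →ₗ[ℂ] ℂ) (x : n → ℂ) (i : n) :
    (v.map ρ).mulVec x i = ρ (∑ j, x j • v i j) := by
  simp [Matrix.mulVec, dotProduct, mul_comm]

/-- `S⁻¹(a₂) a₁ = ε(a)`. -/
theorem exists_antipode_inv (h : Function.Bijective (HopfAlgebra.antipode ℂ (A := A))) :
    ∃ S' : A →ₗ[ℂ] A, ∀ a, (LinearMap.mul' ℂ A ∘ₗ S'.rTensor A ∘ₗ
      (TensorProduct.comm ℂ A A).toLinearMap) (Coalgebra.comul (R := ℂ) a) =
        algebraMap ℂ A (Coalgebra.counit (R := ℂ) a) := by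
  let e := LinearEquiv.ofBijective (HopfAlgebra.antipode ℂ (A := A)) h
  have he : ∀ x, HopfAlgebra.antipode ℂ (e.symm x) = x := fun x => e.apply_symm_apply x
  refine ⟨e.symm.toLinearMap, fun a => h.1 ?_⟩
  -- The antipode reverses products, so it carries `S⁻¹(a₂) a₁` to `S(a₁) a₂`; injectivity of `S`
  -- then gives the claim.
  have key : ∀ z : A ⊗[ℂ] A, HopfAlgebra.antipode ℂ ((LinearMap.mul' ℂ A ∘ₗ
      e.symm.toLinearMap.rTensor A ∘ₗ (TensorProduct.comm ℂ A A).toLinearMap) z) =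
      LinearMap.mul' ℂ A ((HopfAlgebra.antipode ℂ).rTensor A z) := by
    intro z
    induction z with
    | zero => simp
    | tmul x y => simp [HopfAlgebra.antipode_mul_antidistrib, he]
    | add x y hx hy => rw [map_add, map_add, hx, hy, map_add, map_add]
  rw [key, HopfAlgebra.mul_antipode_rTensor_comul_apply, Algebra.algebraMap_eq_smul_one, map_smul,
    HopfAlgebra.antipode_one]

namespace IsInhomogeneousQuantumGroup

/-- The space `K` of complex relations modulo `A` is stable under the transposes of the matrices `ρ
(Λ)`, so its annihilator `W` is invariant under `Λ`. Irreducibility leaves `K = 0`, since `W = 0`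
would put every `p_i` into `A`. -/
theorem eq_zero_of_sum_smul_mem (H : IsInhomogeneousQuantumGroup Λ ι p f η T) {c : I → ℂ}
    (hc : ∑ i, c i • p i ∈ imA ι) : c = 0 := by
  obtain ⟨r, hr⟩ := exists_retraction H.injective
  let K : Submodule ℂ (I → ℂ) := (imA ι).comap (Fintype.linearCombination ℂ p)
  have hK : ∀ c, c ∈ K ↔ ∑ i, c i • p i ∈ imA ι := fun c => Iff.rfl
  let W : Submodule ℂ (I → ℂ) :=
    { carrier := {x | ∀ c ∈ K, ∑ i, c i * x i = 0}
      add_mem' := fun {x y} hx hy c hc => by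
        simp only [Pi.add_apply, mul_add, Finset.sum_add_distrib, hx c hc, hy c hc, add_zero]
      zero_mem' := fun c _ => by simp
      smul_mem' := fun s x hx c hc => by
        simp only [Pi.smul_apply, smul_eq_mul, mul_left_comm _ s, ← Finset.mul_sum, hx c hc,
          mul_zero] }
  have hW : ∀ x, x ∈ W ↔ ∀ c ∈ K, ∑ i, c i * x i = 0 := fun x => Iff.rfl
  have hinv : IsInvariant Λ W := by
    intro ρ x hx
    rw [hW] at hx ⊢
    intro c hc
    -- Slicing the first leg of `Δ (∑ c_i p_i)` by `ρ` replaces `c` by its product with `ρ (Λ)`, up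
    -- to a constant. The retraction `r` lets `ρ` act on `B`.
    have hc' : (fun j => ∑ i, c i * ρ (Λ i j)) ∈ K := by
      rw [hK] at hc ⊢
      obtain ⟨a, ha⟩ := hc
      have h1 := sliceLeft_mem_of_mem_tens (ρ ∘ₗ r) (comul_map_mem ι a)
      have h2 : ι a = ∑ i, c i • p i := ha
      rw [h2, map_sum, map_sum] at h1
      have h3 : ∀ i, sliceLeft B (ρ ∘ₗ r) (Coalgebra.comul (R := ℂ) (c i • p i)) =
          ∑ j, (c i * ρ (Λ i j)) • p j + (c i * ρ (r (p i))) • 1 := by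
        intro i
        simp [H.comul_p, hr, smul_smul, Finset.smul_sum]
      simp only [h3, Finset.sum_add_distrib] at h1
      rw [Finset.sum_comm] at h1
      simp only [Finset.sum_smul]
      refine (Submodule.add_mem_iff_left _ ?_).1 h1
      exact Submodule.sum_mem _ fun i _ => Submodule.smul_mem _ _ ⟨1, map_one ι⟩
    have := hx _ hc'
    rw [← this]
    simp only [Matrix.mulVec, dotProduct, Matrix.map_apply, Finset.mul_sum, Finset.sum_mul]
    rw [Finset.sum_comm]
    simp only [mul_assoc]
  rcases H.homogeneousPart.irreducible.2.2 W hinv with h | h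
  · exfalso
    obtain ⟨i, hi⟩ := H.exists_notMem
    have hi' : Pi.single i (1 : ℂ) ∉ K := by
      rw [hK]
      have : ∑ j, (Pi.single i (1 : ℂ) : I → ℂ) j • p j = p i := by
        rw [Finset.sum_eq_single i]
        · simp
        · intro j _ hj; simp [Pi.single_eq_of_ne hj]
        · simp
      rw [this]
      exact hi
    obtain ⟨g, hg, hgK⟩ := Submodule.exists_le_ker_of_notMem hi'
    have hx : (fun j => g (Pi.single j 1)) ∈ W := by
      rw [hW]
      intro c hc
      have : g c = 0 := hgK hc
      rw [← this]
      conv_rhs => rw [← Finset.univ_sum_single c]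
      rw [map_sum]
      refine Finset.sum_congr rfl fun j _ => ?_
      rw [← smul_eq_mul, ← map_smul, ← Pi.single_smul, smul_eq_mul, mul_one]
    rw [h, Submodule.mem_bot] at hx
    exact hg (congrFun hx i)
  · funext i
    have hx : Pi.single i (1 : ℂ) ∈ W := by rw [h]; trivial
    have := (hW _).1 hx c hc
    simpa [Pi.single_apply] using this

/-- In `Δ (∑ b_i p_i)` the terms with `Λ_ij ⊗ p_j` already have first leg in `A`, and so does the
total; the remaining terms must follow. This is the input for removing the coefficients `b_i`. -/
theorem sum_comul_mul_mem (H : IsInhomogeneousQuantumGroup Λ ι p f η T) {b : I → A}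
    (hb : ∑ i, ι (b i) * p i ∈ imA ι) :
    ∑ i, TensorProduct.map (ι : A →ₗ[ℂ] B) (ι : A →ₗ[ℂ] B) (Coalgebra.comul (R := ℂ) (b i)) *
      p i ⊗ₜ[ℂ] 1 ∈ tens (imA ι) ⊤ := by
  obtain ⟨a, ha⟩ := hb
  have h2 : ι a = ∑ i, ι (b i) * p i := ha
  have h1 : Coalgebra.comul (R := ℂ) (ι a) ∈ tens (imA ι) ⊤ :=
    Submodule.map₂_le_map₂_right le_top (comul_map_mem ι a)
  rw [h2, map_sum] at h1
  simp only [Bialgebra.comul_mul, H.comul_p, mul_add, Finset.sum_add_distrib] at h1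
  simp only [← comul_map]
  refine (Submodule.add_mem_iff_right _ ?_).1 h1
  refine Submodule.sum_mem _ fun i _ => ?_
  rw [Finset.mul_sum]
  exact Submodule.sum_mem _ fun j _ => tens_mul_tmul
    (fun u hu => mul_mem_imA hu (map_mem_imA ι _)) (fun _ _ => Submodule.mem_top)
    (comul_map_mem ι (b i))

/-- The elements `1` and `p_i` are linearly independent over `A`. -/
theorem eq_zero_of_sum_mem (H : IsInhomogeneousQuantumGroup Λ ι p f η T) {b : I → A}
    (hb : ∑ i, ι (b i) * p i ∈ imA ι) : b = 0 := by
  obtain ⟨r, hr⟩ := exists_retraction H.injective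
  obtain ⟨S', hS'⟩ := exists_antipode_inv H.homogeneousPart.antipode_bijective
  have counit_eq : ∀ b : I → A, ∑ i, ι (b i) * p i ∈ imA ι →
      ∀ i, Coalgebra.counit (R := ℂ) (b i) = 0 := by
    intro b hb
    -- On `A ⊗ A` this is `x ⊗ y ↦ S⁻¹(y) x`. It turns `Δ(b_i)(p_i ⊗ 1)` into `ε(b_i) p_i`, reducing
    -- coefficients in `A` to complex ones.
    let Θ : B ⊗[ℂ] B →ₗ[ℂ] B := LinearMap.mul' ℂ B ∘ₗ
      ((ι : A →ₗ[ℂ] B) ∘ₗ S' ∘ₗ r).rTensor B ∘ₗ (TensorProduct.comm ℂ B B).toLinearMap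
    have hΘ : tens (imA ι) ⊤ ≤ (imA ι).comap Θ := by
      refine Submodule.map₂_le.2 fun u hu u' _ => ?_
      simp only [Θ, TensorProduct.mk_apply, Submodule.mem_comap, LinearMap.comp_apply,
        LinearEquiv.coe_coe, TensorProduct.comm_tmul, LinearMap.rTensor_tmul, LinearMap.mul'_apply]
      exact mul_mem_imA (map_mem_imA ι _) hu
    have key : ∀ (z : A ⊗[ℂ] A) (x : B),
        Θ (TensorProduct.map (ι : A →ₗ[ℂ] B) (ι : A →ₗ[ℂ] B) z * x ⊗ₜ[ℂ] 1) =
          ι ((LinearMap.mul' ℂ A ∘ₗ S'.rTensor A ∘ₗ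
            (TensorProduct.comm ℂ A A).toLinearMap) z) * x := by
      intro z x
      induction z with
      | zero => simp
      | tmul y z => simp [Θ, hr, mul_assoc]
      | add y z hy hz => simp only [map_add, add_mul, hy, hz]
    have h := hΘ (H.sum_comul_mul_mem hb)
    rw [Submodule.mem_comap, map_sum] at h
    simp only [key, hS'] at h
    have h' : ∑ i, Coalgebra.counit (R := ℂ) (b i) • p i ∈ imA ι := by
      convert h using 2 with i
      rw [Algebra.algebraMap_eq_smul_one, map_smul, map_one, smul_mul_assoc, one_mul]
    exact congrFun (H.eq_zero_of_sum_smul_mem h')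
  funext i
  -- Slicing the second leg by `σ` shows that the `σ * b_i` satisfy the same hypothesis; their
  -- counits are the `σ (b_i)`, so these vanish.
  refine eq_of_forall_dual fun σ => ?_
  rw [Pi.zero_apply, map_zero, ← counit_lconv]
  refine counit_eq (fun i => lconv σ (b i)) ?_ i
  have h := sliceRight_mem_of_mem_tens (σ ∘ₗ r) (H.sum_comul_mul_mem hb)
  rw [map_sum] at h
  have key : ∀ (z : A ⊗[ℂ] A) (x : B), sliceRight B (σ ∘ₗ r)
      (TensorProduct.map (ι : A →ₗ[ℂ] B) (ι : A →ₗ[ℂ] B) z * x ⊗ₜ[ℂ] 1) =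
        ι (sliceRight A σ z) * x := by
    intro z x
    induction z with
    | zero => simp
    | tmul y z => simp [hr]
    | add y z hy hz => simp only [map_add, add_mul, hy, hz]
  simpa only [key, ← lconv_eq] using h

/-- By independence, the coefficient of `p_t` is a well-defined linear map on `B¹`. Its counit is
taken there, and the values outside `B¹` come from an arbitrary linear extension. -/
theorem exists_coord (H : IsInhomogeneousQuantumGroup Λ ι p f η T) :
    ∃ γ : I → B →ₗ[ℂ] ℂ, (∀ t a, γ t (ι a) = 0) ∧
      ∀ t a i, γ t (ι a * p i) = if i = t then Coalgebra.counit (R := ℂ) a else 0 := by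
  let Ψ : (A × (I → A)) →ₗ[ℂ] B :=
    LinearMap.coprod (ι : A →ₗ[ℂ] B) (∑ i, LinearMap.mulRight ℂ (p i) ∘ₗ
      (ι : A →ₗ[ℂ] B) ∘ₗ LinearMap.proj i)
  have hΨ : ∀ x, Ψ x = ι x.1 + ∑ i, ι (x.2 i) * p i := fun x => by simp [Ψ]
  have hker : LinearMap.ker Ψ = ⊥ := by
    rw [LinearMap.ker_eq_bot']
    rintro ⟨a, b⟩ hx
    rw [hΨ] at hx
    have hb : b = 0 := H.eq_zero_of_sum_mem
      ⟨-a, by simpa using neg_eq_of_add_eq_zero_right hx⟩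
    subst hb
    have ha : ι a = ι 0 := by simpa using hx
    rw [H.injective ha]
    rfl
  obtain ⟨g, hg⟩ := LinearMap.exists_leftInverse_of_injective Ψ hker
  have hg' : ∀ x, g (Ψ x) = x := fun x => LinearMap.congr_fun hg x
  refine ⟨fun t => Coalgebra.counit (R := ℂ) ∘ₗ LinearMap.proj t ∘ₗ LinearMap.snd ℂ _ _ ∘ₗ g,
    fun t a => ?_, fun t a i => ?_⟩
  · have : ι a = Ψ (a, 0) := by simp [hΨ]
    simp [this, hg']
  · have : ι a * p i = Ψ (0, Pi.single i a) := by
      rw [hΨ, Finset.sum_eq_single i]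
      · simp
      · intro j _ hj; simp [Pi.single_eq_of_ne hj]
      · simp
    rw [this]
    simp only [LinearMap.comp_apply, hg', LinearMap.snd_apply, LinearMap.proj_apply]
    split_ifs with hi
    · subst hi; simp
    · rw [Pi.single_eq_of_ne (Ne.symm hi), map_zero]

/-- The commutation relation replaces the coefficient of `p_t` by convolutions with the `f_st`, and
`ε(a * f_st) = f_st(a)`. This brings the matrix `R` into the degree count. -/
theorem coord_mul (H : IsInhomogeneousQuantumGroup Λ ι p f η T) {γ : I → B →ₗ[ℂ] ℂ}
    (h0 : ∀ t a, γ t (ι a) = 0)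
    (h1 : ∀ t a i, γ t (ι a * p i) = if i = t then Coalgebra.counit (R := ℂ) a else 0)
    {x : B} (hx : x ∈ filtOne ι p) (a : A) (t : I) :
    γ t (x * ι a) = ∑ s, γ s x * f a s t := by
  induction hx using Submodule.span_induction with
  | mem x hx =>
    rcases hx with ⟨b, rfl⟩ | ⟨b, i, rfl⟩
    · rw [← map_mul]
      simp only [h0, zero_mul, Finset.sum_const_zero]
    · rw [mul_assoc, H.p_mul, mul_add, map_add, ← map_mul, h0, add_zero, Finset.mul_sum, map_sum]
      simp only [← mul_assoc, ← map_mul, h1]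
      simp [Bialgebra.counit_mul, counit_rconv, fcomp]
  | zero => simp
  | add x y _ _ hx hy => simp only [add_mul, map_add, hx, hy, Finset.sum_add_distrib]
  | smul c x _ hx =>
    simp only [smul_mul_assoc, map_smul, hx, smul_eq_mul, Finset.mul_sum, mul_assoc]

/-- Only the leading part of the quadratic relation matters here: modulo degree one, `R` fixes the
vector of products `p_i p_j`. -/
theorem sum_Rmat_smul_sub_mem (H : IsInhomogeneousQuantumGroup Λ ι p f η T) (y : I × I) :
    ∑ x, Rmat Λ f y x • (p x.1 * p x.2) - p y.1 * p y.2 ∈ filtOne ι p := by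
  have h := H.quadratic y
  have h' : ∑ x, (Rmat Λ f - 1) y x • (p x.1 * p x.2) = ∑ x, (Rmat Λ f - 1) y x •
      (∑ s, Zmat Λ η x s • p s - T x • 1 + ∑ z, T z • ι (Λ x.1 z.1 * Λ x.2 z.2)) := by
    rw [← sub_eq_zero, ← Finset.sum_sub_distrib, ← h]
    refine Finset.sum_congr rfl fun x _ => ?_
    rw [← smul_sub]
    congr 1
    abel
  have h2 : ∑ x, (Rmat Λ f - 1) y x • (p x.1 * p x.2) =
      ∑ x, Rmat Λ f y x • (p x.1 * p x.2) - p y.1 * p y.2 := by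
    simp only [Matrix.sub_apply, sub_smul, Finset.sum_sub_distrib, Matrix.one_apply, ite_smul,
      one_smul, zero_smul, Finset.sum_ite_eq, Finset.mem_univ, if_true]
  rw [← h2, h']
  refine Submodule.sum_mem _ fun x _ => Submodule.smul_mem _ _ (add_mem (sub_mem ?_ ?_) ?_)
  · exact Submodule.sum_mem _ fun s _ => Submodule.smul_mem _ _ (p_mem_filtOne ι p s)
  · rw [← map_one ι]
    exact Submodule.smul_mem _ _ (map_mem_filtOne ι p 1)
  · exact Submodule.sum_mem _ fun z _ => Submodule.smul_mem _ _ (map_mem_filtOne ι p _)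

end IsInhomogeneousQuantumGroup

end Independence

/-! ### The degree operator and the coalgebraic description of degree one. -/

/-- `z ↦ ∑ (γ_t ⊗ id)(z) p_t`; composed with the comultiplication, it multiplies the leading terms
by their degree. -/
noncomputable def euler {B I : Type*} [Ring B] [Bialgebra ℂ B] [Fintype I] (p : I → B)
    (γ : I → B →ₗ[ℂ] ℂ) : B ⊗[ℂ] B →ₗ[ℂ] B :=
  ∑ t, LinearMap.mulRight ℂ (p t) ∘ₗ sliceLeft B (γ t)

theorem euler_apply {B I : Type*} [Ring B] [Bialgebra ℂ B] [Fintype I] (p : I → B)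
    (γ : I → B →ₗ[ℂ] ℂ) (z : B ⊗[ℂ] B) : euler p γ z = ∑ t, sliceLeft B (γ t) z * p t := by
  simp [euler]

section Euler

variable {A B I : Type*} [Ring A] [HopfAlgebra ℂ A] [Ring B] [Bialgebra ℂ B]
variable [Fintype I] [DecidableEq I] {Λ : Matrix I I A} {ι : A →ₐc[ℂ] B} {p : I → B}
    {f : A →ₗ[ℂ] Matrix I I ℂ} {η : A →ₗ[ℂ] (I → ℂ)} {T : I × I → ℂ}

namespace IsInhomogeneousQuantumGroup

/-- A Leibniz rule modulo lower degree, applied with `z = Δ x` and `x` of degree at most `n`: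
multiplication by `p_i` contributes one extra copy of `x p_i`. It is exact on `A ⊗ Bⁿ`, uses the
quadratic relation on `B¹ ⊗ Bⁿ⁻¹`, and is a pure degree count on `B ⊗ Bⁿ⁻²`. -/
theorem euler_mul_sub_mem (H : IsInhomogeneousQuantumGroup Λ ι p f η T) {γ : I → B →ₗ[ℂ] ℂ}
    (h0 : ∀ t a, γ t (ι a) = 0)
    (h1 : ∀ t a i, γ t (ι a * p i) = if i = t then Coalgebra.counit (R := ℂ) a else 0)
    (n : ℕ) {z : B ⊗[ℂ] B} (hz : z ∈ tens (imA ι) (filt ι p (n + 2)) ⊔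
      tens (filtOne ι p) (filt ι p (n + 1)) ⊔ tens ⊤ (filt ι p n)) (i : I) :
    euler p γ (z * Coalgebra.comul (R := ℂ) (p i)) - euler p γ z * p i -
      sliceLeft B (Coalgebra.counit (R := ℂ)) z * p i ∈ filt ι p (n + 2) := by
  let Ξ : B ⊗[ℂ] B →ₗ[ℂ] B :=
    euler p γ ∘ₗ LinearMap.mulRight ℂ (Coalgebra.comul (R := ℂ) (p i)) -
      LinearMap.mulRight ℂ (p i) ∘ₗ euler p γ -
      LinearMap.mulRight ℂ (p i) ∘ₗ sliceLeft B (Coalgebra.counit (R := ℂ))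
  have hΞ : ∀ x y, Ξ (x ⊗ₜ y) =
      ∑ j, ∑ t, γ t (x * ι (Λ i j)) • (y * (p j * p t)) + ∑ t, γ t (x * p i) • (y * p t) -
        ∑ t, γ t x • (y * (p t * p i)) - Coalgebra.counit (R := ℂ) x • (y * p i) := by
    intro x y
    simp only [Ξ, LinearMap.sub_apply, LinearMap.comp_apply, LinearMap.mulRight_apply, euler_apply,
      H.comul_p, mul_add, Finset.mul_sum, Algebra.TensorProduct.tmul_mul_tmul, map_add, map_sum,
      sliceLeft_tmul, smul_mul_assoc, mul_assoc, mul_one]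
  change Ξ z ∈ _
  have hle : tens (imA ι) (filt ι p (n + 2)) ⊔ tens (filtOne ι p) (filt ι p (n + 1)) ⊔
      tens ⊤ (filt ι p n) ≤ (filt ι p (n + 2)).comap Ξ := by
    refine sup_le (sup_le ?_ ?_) ?_
    · refine Submodule.map₂_le.2 ?_
      rintro _ ⟨a, rfl⟩ y hy
      rw [Submodule.mem_comap, TensorProduct.mk_apply, hΞ]
      change ∑ j, ∑ t, γ t (ι a * ι (Λ i j)) • (y * (p j * p t)) +
        ∑ t, γ t (ι a * p i) • (y * p t) - ∑ t, γ t (ι a) • (y * (p t * p i)) -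
          Coalgebra.counit (R := ℂ) (ι a) • (y * p i) ∈ _
      simp only [← map_mul, h0, h1, zero_smul, Finset.sum_const_zero, ite_smul, Finset.sum_ite_eq,
        Finset.mem_univ, if_true, zero_add, sub_zero, counit_map, sub_self, zero_mem]
    · refine Submodule.map₂_le.2 fun x hx y hy => ?_
      rw [Submodule.mem_comap, TensorProduct.mk_apply, hΞ]
      refine sub_mem ?_ (Submodule.smul_mem _ _ (filt_mul_p ι p _ hy i))
      rw [add_sub_right_comm]
      refine add_mem ?_ (Submodule.sum_mem _ fun t _ =>
        Submodule.smul_mem _ _ (filt_mul_p ι p _ hy t))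
      -- Here `γ_t(x Λ_ij) = ∑ γ_s(x) f_st(Λ_ij)`, and `f_st(Λ_ij)` is the entry of `R` at `(s, i),
      -- (j, t)`; so the difference is governed by `R` applied to `p p` minus `p p`.
      have : ∑ j, ∑ t, γ t (x * ι (Λ i j)) • (y * (p j * p t)) -
          ∑ t, γ t x • (y * (p t * p i)) = ∑ s, γ s x • (y *
            (∑ u, Rmat Λ f (s, i) u • (p u.1 * p u.2) - p s * p i)) := by
        simp only [mul_sub, smul_sub, Finset.sum_sub_distrib]
        congr 1
        simp only [H.coord_mul h0 h1 hx, Finset.sum_smul, Fintype.sum_prod_type, Finset.mul_sum,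
          Finset.smul_sum, mul_smul_comm, smul_smul, Rmat]
        refine (Finset.sum_congr rfl fun j _ => Finset.sum_comm).trans ?_
        rw [Finset.sum_comm]
      rw [this]
      refine Submodule.sum_mem _ fun s _ => Submodule.smul_mem _ _ ?_
      exact H.filt_mul_filtOne _ hy (H.sum_Rmat_smul_sub_mem (s, i))
    · refine Submodule.map₂_le.2 fun x _ y hy => ?_
      rw [Submodule.mem_comap, TensorProduct.mk_apply, hΞ]
      have hy1 : ∀ j, y * p j ∈ filt ι p (n + 2) := fun j =>
        filt_mono ι p (Nat.le_succ _) (filt_mul_p ι p _ hy j)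
      have hy2 : ∀ j k, y * (p j * p k) ∈ filt ι p (n + 2) := fun j k => by
        rw [← mul_assoc]
        exact filt_mul_p ι p _ (filt_mul_p ι p _ hy j) k
      refine sub_mem (sub_mem (add_mem ?_ ?_) ?_) (Submodule.smul_mem _ _ (hy1 i))
      · exact Submodule.sum_mem _ fun j _ => Submodule.sum_mem _ fun t _ =>
          Submodule.smul_mem _ _ (hy2 j t)
      · exact Submodule.sum_mem _ fun t _ => Submodule.smul_mem _ _ (hy1 t)
      · exact Submodule.sum_mem _ fun t _ => Submodule.smul_mem _ _ (hy2 t i)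
  exact hle hz

/-- Iterating the Leibniz rule counts the factors `p_i`: on `A` the operator vanishes, and each
further factor adds one to the eigenvalue on leading terms. -/
theorem euler_sub_mem (H : IsInhomogeneousQuantumGroup Λ ι p f η T) {γ : I → B →ₗ[ℂ] ℂ}
    (h0 : ∀ t a, γ t (ι a) = 0)
    (h1 : ∀ t a i, γ t (ι a * p i) = if i = t then Coalgebra.counit (R := ℂ) a else 0)
    (n : ℕ) {x : B} (hx : x ∈ filt ι p (n + 2)) :
    euler p γ (Coalgebra.comul (R := ℂ) x) - (n : ℂ) • x ∈ filt ι p (n + 1) := by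
  let L : ℕ → Submodule ℂ B := fun n => filt ι p n ⊓ (filt ι p (n - 1)).comap
    (euler p γ ∘ₗ Coalgebra.comul (R := ℂ) - ((n - 2 : ℕ) : ℂ) • LinearMap.id)
  have hL : ∀ n x, x ∈ L (n + 2) ↔ x ∈ filt ι p (n + 2) ∧
      euler p γ (Coalgebra.comul (R := ℂ) x) - (n : ℂ) • x ∈ filt ι p (n + 1) :=
    fun n x => Iff.rfl
  refine ((hL n x).1 (filt_induction ι p (L := L) ?_ ?_ ?_ (n + 2) hx)).2
  · rintro _ ⟨a, rfl⟩
    refine (hL 0 _).2 ⟨map_mem_imA ι a, ?_⟩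
    rw [Nat.cast_zero, zero_smul, sub_zero, euler_apply]
    refine Submodule.sum_mem _ fun t _ => ?_
    have : sliceLeft B (γ t) (Coalgebra.comul (R := ℂ) (ι a)) = 0 := by
      refine sliceLeft_eq_zero_of_mem_tens _ ?_ (comul_map_mem ι a)
      rintro _ ⟨a, rfl⟩
      exact h0 t a
    change sliceLeft B (γ t) (Coalgebra.comul (R := ℂ) (ι a)) * p t ∈ _
    rw [this, zero_mul]
    exact zero_mem _
  · intro n x hx
    rw [hL] at hx
    refine (hL (n + 1) x).2 ⟨filt_mono ι p (Nat.le_succ _) hx.1, ?_⟩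
    rw [Nat.cast_succ, add_smul, one_smul, ← sub_sub]
    exact sub_mem (filt_mono ι p (Nat.le_succ _) hx.2) hx.1
  · intro n x hx hxL i
    rw [hL] at hxL
    refine (hL (n + 1) _).2 ⟨filt_mul_p ι p _ hx i, ?_⟩
    have h2 := H.euler_mul_sub_mem h0 h1 n (H.comul_filt_left n hx) i
    have h3 := filt_mul_p ι p _ hxL.2 i
    rw [sliceLeft_counit] at h2
    have h4 := add_mem h2 h3
    rw [Bialgebra.comul_mul]
    convert h4 using 1
    rw [Nat.cast_succ, add_smul, one_smul, sub_mul, smul_mul_assoc]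
    abel

/-- An element `x` with `Δ x ∈ A ⊗ B + B ⊗ A` has degree at most one. -/
theorem mem_filtOne_of_comul_mem (H : IsInhomogeneousQuantumGroup Λ ι p f η T) {x : B}
    (hx : Coalgebra.comul (R := ℂ) x ∈ tens (imA ι) ⊤ ⊔ tens ⊤ (imA ι)) : x ∈ filtOne ι p := by
  obtain ⟨γ, h0, h1⟩ := H.exists_coord
  -- The functionals `γ_t` kill the part in `A ⊗ B`, and the part in `B ⊗ A` is sent to elements `a
  -- p_t`.
  have hE : euler p γ (Coalgebra.comul (R := ℂ) x) ∈ filtOne ι p := by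
    obtain ⟨y, hy, z, hz, hyz⟩ := Submodule.mem_sup.1 hx
    rw [← hyz, map_add]
    refine add_mem ?_ ?_
    · rw [euler_apply]
      refine Submodule.sum_mem _ fun t _ => ?_
      rw [sliceLeft_eq_zero_of_mem_tens _ _ hy, zero_mul]
      · exact zero_mem _
      · rintro _ ⟨a, rfl⟩
        exact h0 t a
    · rw [euler_apply]
      refine Submodule.sum_mem _ fun t _ => ?_
      obtain ⟨a, ha⟩ := sliceLeft_mem_of_mem_tens (γ t) hz
      rw [← ha]
      exact map_mul_mem_filtOne ι p a t
  obtain ⟨n, hn⟩ := H.exists_mem_filt x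
  induction n with
  | zero =>
    rw [filtOne_eq]
    exact filt_mono ι p (by norm_num) hn
  | succ n ih =>
    rcases Nat.eq_zero_or_pos n with rfl | hpos
    · rw [filtOne_eq]
      exact hn
    -- Here `x` has degree at most `n + 1` with `n ≥ 1`. Modulo degree `n` the operator is
    -- multiplication by `n + 1`, while its value has degree at most one; dividing by `n + 1` lowers
    -- the degree of `x`.
    · refine ih ?_
      have h2 := H.euler_sub_mem h0 h1 (n + 1) hn
      rw [filtOne_eq] at hE
      have h3 := filt_mono ι p (by omega : 3 ≤ n + 1 + 1) hE
      have h4 := (Submodule.sub_mem_iff_right _ h3).1 h2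
      exact (Submodule.smul_mem_iff _ (Nat.cast_ne_zero.2 (Nat.succ_ne_zero n))).1 h4

end IsInhomogeneousQuantumGroup

end Euler

end InhomQG

namespace InhomQG

/-! ### Isomorphisms preserve `A` and `B¹`. -/

section Isomorphism

/-- Slicing the coefficients of a vector amounts to moving the vector by `ρ (v)`. This links degree
estimates on `Δ` with invariant subspaces. -/
theorem IsRep.sliceRight_comul {C n : Type*} [Ring C] [Bialgebra ℂ C] [Fintype n] [DecidableEq n]
    {v : Matrix n n C} (hv : IsRep v) (ρ : C →ₗ[ℂ] ℂ) (x : n → ℂ) (i : n) :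
    sliceRight C ρ (Coalgebra.comul (R := ℂ) (∑ j, x j • v i j)) =
      ∑ k, (v.map ρ).mulVec x k • v i k := by
  simp only [map_sum, map_smul, hv.1, sliceRight_tmul, Finset.smul_sum, mulVec_map_apply,
    Finset.sum_smul, smul_smul, smul_eq_mul]
  rw [Finset.sum_comm]

theorem IsRep.map {C D n : Type*} [Ring C] [Bialgebra ℂ C] [Ring D] [Bialgebra ℂ D] [Fintype n]
    [DecidableEq n] {v : Matrix n n C} (hv : IsRep v) (ψ : C →ₐc[ℂ] D) : IsRep (v.map ψ) := by
  constructor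
  · intro i j
    rw [Matrix.map_apply, ← CoalgHomClass.map_comp_comul_apply, hv.1, map_sum]
    rfl
  · intro i j
    rw [Matrix.map_apply, CoalgHomClass.counit_comp_apply, hv.2]

theorem IsRep.eq_zero {C n : Type*} [Ring C] [Bialgebra ℂ C] [Fintype n] [DecidableEq n]
    {v : Matrix n n C} (hv : IsRep v) {x : n → ℂ} (hx : ∀ i, ∑ j, x j • v i j = 0) : x = 0 := by
  funext i
  have := congrArg (Coalgebra.counit (R := ℂ)) (hx i)
  simpa [hv.2] using this

variable {A B I : Type*} [Ring A] [HopfAlgebra ℂ A] [Ring B] [Bialgebra ℂ B]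
variable [Fintype I] [DecidableEq I] {Λ : Matrix I I A} {ι : A →ₐc[ℂ] B} {p : I → B}
    {f : A →ₗ[ℂ] Matrix I I ℂ} {η : A →ₗ[ℂ] (I → ℂ)} {T : I × I → ℂ}

namespace IsInhomogeneousQuantumGroup

/-- Every nonzero subrepresentation over `B` has nonzero intersection with the part over `A`. -/
theorem exists_ne_zero_of_isInvariant (H : IsInhomogeneousQuantumGroup Λ ι p f η T)
    {n : Type*} [Fintype n] [DecidableEq n] {u : Matrix n n B} (hu : IsRep u)
    {V : Submodule ℂ (n → ℂ)} (hV : IsInvariant u V) (hne : V ≠ ⊥) :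
    ∃ x ∈ V, x ≠ 0 ∧ ∀ i, ∑ j, x j • u i j ∈ imA ι := by
  classical
  have hex : ∃ m, ∃ x ∈ V, x ≠ 0 ∧ ∀ i, ∑ j, x j • u i j ∈ filt ι p m := by
    obtain ⟨x, hx, hx0⟩ := Submodule.exists_mem_ne_zero_of_ne_bot hne
    choose m hm using fun i => H.exists_mem_filt (∑ j, x j • u i j)
    exact ⟨Finset.univ.sup m + 2, x, hx, hx0, fun i =>
      filt_mono ι p (Nat.add_le_add_right (Finset.le_sup (Finset.mem_univ i)) 2) (hm i)⟩
  -- A nonzero vector of `V` whose coefficients have the least possible common degree.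
  obtain ⟨x, hx, hx0, hxm⟩ := Nat.find_spec hex
  have hmin : ∀ k < Nat.find hex, _ := fun k hk => Nat.find_min hex hk
  revert hxm hmin
  rcases Nat.find hex with _ | k
  · intro hxm _
    exact absurd (hu.eq_zero fun i => (Submodule.mem_bot ℂ).1 (hxm i)) hx0
  · intro hxm hmin
    refine ⟨x, hx, hx0, fun i => mem_of_forall_dual fun ρ hρ => ?_⟩
    -- Since `ρ` vanishes on `A`, the vector `ρ (u) x` of `V` has coefficients of smaller degree;
    -- minimality makes it zero. Its entries are the values of `ρ` on the coefficients of `x`.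
    have hy : (u.map ρ).mulVec x = 0 := by
      by_contra hy0
      refine hmin k (Nat.lt_succ_self k) ⟨_, hV ρ x hx, hy0, fun i => ?_⟩
      rw [← hu.sliceRight_comul]
      obtain ⟨y, hy, z, hz, hyz⟩ := Submodule.mem_sup.1 (H.comul_filt_right k (hxm i))
      rw [← hyz, map_add, sliceRight_eq_zero_of_mem_tens ρ hρ hy, zero_add]
      exact sliceRight_mem_of_mem_tens ρ hz
    rw [← mulVec_map_apply, hy, Pi.zero_apply]

/-- A bialgebra whose representations are completely reducible is mapped into `A`. -/
theorem map_mem_of_injective (H : IsInhomogeneousQuantumGroup Λ ι p f η T)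
    {C : Type*} [Ring C] [Bialgebra ℂ C] (ψ : C →ₐc[ℂ] B) (hψ : Function.Injective ψ)
    (hC : ∀ (n : ℕ) (v : Matrix (Fin n) (Fin n) C), IsRep v → IsCompletelyReducible v) (a : C) :
    ψ a ∈ imA ι := by
  obtain ⟨n, v, hv, ha⟩ := exists_rep a
  obtain ⟨r, hr⟩ := LinearMap.exists_leftInverse_of_injective (ψ : C →ₗ[ℂ] B)
    (LinearMap.ker_eq_bot.2 hψ)
  have hr' : ∀ a, r (ψ a) = a := fun a => LinearMap.congr_fun hr a
  have hu : IsRep (v.map ψ) := hv.map ψ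
  have hinv : ∀ W : Submodule ℂ (Fin n → ℂ), IsInvariant (v.map ψ) W ↔ IsInvariant v W := by
    intro W
    constructor
    · intro h ρ x hx
      have := h (ρ ∘ₗ r) x hx
      have h2 : (v.map ψ).map (ρ ∘ₗ r) = v.map ρ := by
        ext i j; simp [hr']
      rwa [h2] at this
    · intro h ρ x hx
      exact h (ρ ∘ₗ (ψ : C →ₗ[ℂ] B)) x hx
  -- The largest part of the representation whose coefficients lie in `A`. Any nonzero invariant
  -- complement would meet it, so it is everything.
  let W : Submodule ℂ (Fin n → ℂ) :=
    ⨅ i, (imA ι).comap (Fintype.linearCombination ℂ fun j => v.map ψ i j)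
  have hW : ∀ x, x ∈ W ↔ ∀ i, ∑ j, x j • v.map ψ i j ∈ imA ι := fun x => by
    simp [W, Fintype.linearCombination_apply]
  have hWinv : IsInvariant (v.map ψ) W := by
    intro ρ x hx
    rw [hW] at hx ⊢
    intro i
    obtain ⟨b, hb⟩ := hx i
    rw [← hu.sliceRight_comul, ← hb]
    exact sliceRight_mem_of_mem_tens ρ (comul_map_mem ι b)
  obtain ⟨W', hW', hcompl⟩ := hC n v hv W ((hinv W).1 hWinv)
  have hbot : W' = ⊥ := by
    by_contra hne
    obtain ⟨x, hx, hx0, hxA⟩ := H.exists_ne_zero_of_isInvariant hu ((hinv W').2 hW') hne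
    exact hx0 (Submodule.disjoint_def.1 hcompl.disjoint x ((hW x).2 hxA) hx)
  have htop : W = ⊤ := by
    have := hcompl.sup_eq_top
    rwa [hbot, sup_bot_eq] at this
  have hmem : ∀ i j, ψ (v i j) ∈ imA ι := by
    intro i j
    have := (hW (Pi.single j 1)).1 (by rw [htop]; trivial) i
    simpa [Pi.single_apply] using this
  have hle : Submodule.span ℂ (Set.range fun x : Fin n × Fin n => v x.1 x.2) ≤
      (imA ι).comap (ψ : C →ₗ[ℂ] B) := by
    refine Submodule.span_le.2 ?_
    rintro _ ⟨x, rfl⟩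
    exact hmem x.1 x.2
  exact hle ha

end IsInhomogeneousQuantumGroup

variable {A' B' I' : Type*} [Ring A'] [HopfAlgebra ℂ A'] [Ring B'] [Bialgebra ℂ B']
variable [Fintype I'] [DecidableEq I'] {Λ' : Matrix I' I' A'} {ι' : A' →ₐc[ℂ] B'} {p' : I' → B'}
    {f' : A' →ₗ[ℂ] Matrix I' I' ℂ} {η' : A' →ₗ[ℂ] (I' → ℂ)} {T' : I' × I' → ℂ}

namespace IsInhomogeneousQuantumGroup

theorem equiv_map_mem (H : IsInhomogeneousQuantumGroup Λ ι p f η T)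
    (H' : IsInhomogeneousQuantumGroup Λ' ι' p' f' η' T') (φ : B ≃ₐc[ℂ] B') (a : A) :
    φ (ι a) ∈ imA ι' :=
  H'.map_mem_of_injective ((φ : B →ₐc[ℂ] B').comp ι)
    (φ.injective.comp H.injective) H.homogeneousPart.completelyReducible a

/-- As `φ` sends `A` into the other homogeneous part, both kinds of terms of `Δ (φ (p_i))` have one
leg there, and the coalgebraic criterion for degree one applies. -/
theorem equiv_p_mem (H : IsInhomogeneousQuantumGroup Λ ι p f η T)
    (H' : IsInhomogeneousQuantumGroup Λ' ι' p' f' η' T') (φ : B ≃ₐc[ℂ] B') (i : I) :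
    φ (p i) ∈ filtOne ι' p' := by
  refine H'.mem_filtOne_of_comul_mem ?_
  rw [← CoalgHomClass.map_comp_comul_apply, H.comul_p, map_add, map_sum]
  refine add_mem (Submodule.sum_mem _ fun j _ => Submodule.mem_sup_left ?_)
    (Submodule.mem_sup_right ?_)
  · exact tmul_mem_tens (H.equiv_map_mem H' φ _) trivial
  · refine tmul_mem_tens trivial ⟨1, ?_⟩
    change ι' 1 = φ 1
    rw [map_one, map_one]

theorem equiv_filtOne_mem (H : IsInhomogeneousQuantumGroup Λ ι p f η T)
    (H' : IsInhomogeneousQuantumGroup Λ' ι' p' f' η' T') (φ : B ≃ₐc[ℂ] B') {x : B}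
    (hx : x ∈ filtOne ι p) : φ x ∈ filtOne ι' p' := by
  obtain ⟨a, b, rfl⟩ := mem_filtOne.1 hx
  rw [map_add, map_sum]
  refine add_mem ?_ (Submodule.sum_mem _ fun i _ => ?_)
  · obtain ⟨a', ha'⟩ := H.equiv_map_mem H' φ a
    rw [← ha']
    exact map_mem_filtOne ι' p' a'
  · obtain ⟨a', ha'⟩ := H.equiv_map_mem H' φ (b i)
    rw [map_mul, ← ha']
    exact mul_mem_filtOne ι' p' a' (H.equiv_p_mem H' φ i)

theorem image_range (H : IsInhomogeneousQuantumGroup Λ ι p f η T)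
    (H' : IsInhomogeneousQuantumGroup Λ' ι' p' f' η' T') (φ : B ≃ₐc[ℂ] B') :
    φ '' Set.range ι = Set.range ι' := by
  apply Set.Subset.antisymm
  · rintro _ ⟨_, ⟨a, rfl⟩, rfl⟩
    exact H.equiv_map_mem H' φ a
  · rintro _ ⟨a, rfl⟩
    exact ⟨φ.symm (ι' a), H'.equiv_map_mem H φ.symm a, φ.apply_symm_apply _⟩

theorem image_filtOne (H : IsInhomogeneousQuantumGroup Λ ι p f η T)
    (H' : IsInhomogeneousQuantumGroup Λ' ι' p' f' η' T') (φ : B ≃ₐc[ℂ] B') :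
    φ '' (filtOne ι p : Set B) = (filtOne ι' p' : Set B') := by
  apply Set.Subset.antisymm
  · rintro _ ⟨x, hx, rfl⟩
    exact H.equiv_filtOne_mem H' φ hx
  · intro x hx
    exact ⟨φ.symm x, H'.equiv_filtOne_mem H φ.symm hx, φ.apply_symm_apply _⟩

theorem existsUnique_restrict (H : IsInhomogeneousQuantumGroup Λ ι p f η T)
    (H' : IsInhomogeneousQuantumGroup Λ' ι' p' f' η' T') (φ : B ≃ₐc[ℂ] B') :
    ∃! φA : A ≃ₐc[ℂ] A', ∀ a, ι' (φA a) = φ (ι a) := by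
  choose g hg using fun a => mem_imA.1 (H.equiv_map_mem H' φ a)
  let gA : A →ₐ[ℂ] A' :=
    { toFun := g
      map_one' := H'.injective (by rw [hg, map_one, map_one, map_one])
      map_mul' := fun a b => H'.injective (by rw [hg, map_mul, map_mul, map_mul, hg, hg])
      map_zero' := H'.injective (by rw [hg, map_zero, map_zero, map_zero])
      map_add' := fun a b => H'.injective (by rw [hg, map_add, map_add, map_add, hg, hg])
      commutes' := fun r => H'.injective (by
        rw [hg, Algebra.algebraMap_eq_smul_one, Algebra.algebraMap_eq_smul_one, map_smul, map_smul,
          map_smul, map_one, map_one, map_one]) }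
  have hgA : ∀ a, ι' (gA a) = φ (ι a) := hg
  -- Compatibility with `Δ` can be checked after embedding both legs, by flatness over a field.
  have hinj : Function.Injective (TensorProduct.map (ι' : A' →ₗ[ℂ] B') (ι' : A' →ₗ[ℂ] B')) :=
    TensorProduct.map_injective_of_flat_flat _ _ H'.injective H'.injective
  let gB : A →ₐc[ℂ] A' := BialgHom.ofAlgHom gA
    (by
      ext a
      change Coalgebra.counit (R := ℂ) (gA a) = Coalgebra.counit (R := ℂ) a
      rw [← counit_map ι', hgA, CoalgHomClass.counit_comp_apply, counit_map])
    (by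
      apply AlgHom.ext
      intro a
      apply hinj
      change TensorProduct.map (ι' : A' →ₗ[ℂ] B') (ι' : A' →ₗ[ℂ] B')
        (TensorProduct.map gA.toLinearMap gA.toLinearMap (Coalgebra.comul (R := ℂ) a)) =
          TensorProduct.map (ι' : A' →ₗ[ℂ] B') (ι' : A' →ₗ[ℂ] B') (Coalgebra.comul (R := ℂ) (gA a))
      rw [← comul_map, hgA, ← CoalgHomClass.map_comp_comul_apply, comul_map]
      generalize Coalgebra.comul (R := ℂ) a = z
      induction z with
      | zero => simp
      | tmul x y =>
        simp only [TensorProduct.map_tmul]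
        change ι' (gA x) ⊗ₜ ι' (gA y) = φ (ι x) ⊗ₜ φ (ι y)
        rw [hgA, hgA]
      | add x y hx hy => simp only [map_add, hx, hy])
  have hgB : ∀ a, ι' (gB a) = φ (ι a) := hg
  have hbij : Function.Bijective gB := by
    constructor
    · intro a b hab
      apply H.injective
      apply φ.injective
      change φ (ι a) = φ (ι b)
      rw [← hgB, ← hgB, hab]
    · intro a'
      obtain ⟨a, ha⟩ := mem_imA.1 (H'.equiv_map_mem H φ.symm a')
      refine ⟨a, H'.injective ?_⟩
      rw [hgB, ha]
      exact φ.apply_symm_apply _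
  refine ⟨BialgEquiv.ofBijective gB hbij, hgB, fun ψ hψ => ?_⟩
  apply BialgEquiv.ext
  intro a
  apply H'.injective
  rw [hψ]
  exact (hgB a).symm

end IsInhomogeneousQuantumGroup

end Isomorphism

end InhomQG

namespace InhomQG

/-! ### Consequences of irreducibility and complete reducibility -/

section Reducibility

variable {A : Type*} [Ring A]

theorem IsRep.rconv_apply [Bialgebra ℂ A] {n : Type*} [Fintype n] [DecidableEq n] {v : Matrix n n A}
    (hv : IsRep v) (i j : n) (ρ : A →ₗ[ℂ] ℂ) : rconv (v i j) ρ = ∑ k, ρ (v i k) • v k j := by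
  rw [rconv_eq, hv.1, map_sum]
  simp only [sliceLeft_tmul]

theorem IsRep.lconv_apply [Bialgebra ℂ A] {n : Type*} [Fintype n] [DecidableEq n] {v : Matrix n n A}
    (hv : IsRep v) (i j : n) (ρ : A →ₗ[ℂ] ℂ) : lconv ρ (v i j) = ∑ k, ρ (v k j) • v i k := by
  rw [lconv_eq, hv.1, map_sum]
  simp only [sliceRight_tmul]

/-- Schur's lemma. -/
theorem IsIrrep.eq_smul_one [Bialgebra ℂ A] {n : Type*} [Fintype n] [DecidableEq n]
    {v : Matrix n n A} (hv : IsIrrep v) {C : Matrix n n ℂ}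
    (hC : ∀ i t, ∑ j, C i j • v j t = ∑ j, C j t • v i j) : ∃ c : ℂ, C = c • 1 := by
  have : Nonempty n := hv.2.1
  obtain ⟨c, hc⟩ := Module.End.exists_eigenvalue C.mulVecLin
  have hmem : ∀ x, x ∈ Module.End.eigenspace C.mulVecLin c ↔ C.mulVec x = c • x := fun x =>
    Module.End.mem_eigenspace_iff
  refine ⟨c, ?_⟩
  have hcomm : ∀ ρ : A →ₗ[ℂ] ℂ, C * v.map ρ = v.map ρ * C := by
    intro ρ
    ext i t
    have := congrArg ρ (hC i t)
    simpa [Matrix.mul_apply, mul_comm] using this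
  rcases hv.2.2 (Module.End.eigenspace C.mulVecLin c) (by
    intro ρ x hx
    rw [hmem] at hx ⊢
    rw [Matrix.mulVec_mulVec, hcomm, ← Matrix.mulVec_mulVec, hx, Matrix.mulVec_smul]) with h | h
  · exact absurd h hc
  · ext i j
    have := (hmem (Pi.single j 1)).1 (by rw [h]; trivial)
    have := congrFun this i
    simpa [Matrix.one_apply, Pi.single_apply] using this

theorem IsRep.submatrix [Bialgebra ℂ A] {n m : Type*} [Fintype n] [DecidableEq n] [Fintype m]
    [DecidableEq m] {v : Matrix n n A} (hv : IsRep v) (e : m ≃ n) : IsRep (v.submatrix e e) := by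
  constructor
  · intro i j
    rw [Matrix.submatrix_apply, hv.1]
    exact (e.sum_comp fun k => v (e i) k ⊗ₜ[ℂ] v k (e j)).symm
  · intro i j
    rw [Matrix.submatrix_apply, hv.2]
    simp

/-- Reindexing along an equivalence with `Fin n`; it is needed for the index type `I ⊕ Unit`. -/
theorem IsHomogeneousPart.isCompletelyReducible [HopfAlgebra ℂ A] {I : Type*} [Fintype I]
    [DecidableEq I] {Λ : Matrix I I A} (h : IsHomogeneousPart Λ) {n : Type*} [Fintype n]
    [DecidableEq n] {v : Matrix n n A} (hv : IsRep v) : IsCompletelyReducible v := by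
  intro W hW
  let e := (Fintype.equivFin n).symm
  let L : (n → ℂ) ≃ₗ[ℂ] (Fin (Fintype.card n) → ℂ) := LinearEquiv.funCongrLeft ℂ ℂ e
  have hL : ∀ (ρ : A →ₗ[ℂ] ℂ) x, ((v.submatrix e e).map ρ).mulVec (L x) =
      L ((v.map ρ).mulVec x) := by
    intro ρ x
    funext i
    exact e.sum_comp fun k => ρ (v (e i) k) * x k
  obtain ⟨W', hW', hc⟩ := h.completelyReducible _ _ (hv.submatrix e) (W.map L.toLinearMap) (by
    rintro ρ _ ⟨x, hx, rfl⟩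
    exact ⟨_, hW ρ x hx, (hL ρ x).symm⟩)
  refine ⟨W'.comap L.toLinearMap, fun ρ x hx => ?_, ?_⟩
  · have := hW' ρ (L x) hx
    rwa [hL] at this
  · constructor
    · rw [Submodule.disjoint_def]
      intro x hx hx'
      have := Submodule.disjoint_def.1 hc.disjoint (L x) ⟨x, hx, rfl⟩ hx'
      exact L.map_eq_zero_iff.1 this
    · rw [codisjoint_iff, Submodule.eq_top_iff']
      intro x
      have hx : L x ∈ W.map L.toLinearMap ⊔ W' := by rw [hc.sup_eq_top]; trivial
      obtain ⟨_, ⟨y, hy, rfl⟩, z, hz, hyz⟩ := Submodule.mem_sup.1 hx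
      refine Submodule.mem_sup.2 ⟨y, hy, L.symm z, ?_, ?_⟩
      · simpa using hz
      · apply L.injective
        rw [map_add, L.apply_symm_apply]
        exact hyz

/-- A cocycle with values in a representation is a coboundary. -/
theorem IsHomogeneousPart.exists_coboundary [HopfAlgebra ℂ A] {I : Type*} [Fintype I]
    [DecidableEq I] {Λ : Matrix I I A} (h : IsHomogeneousPart Λ) {a : I → A}
    (ha : ∀ i, Coalgebra.comul (R := ℂ) (a i) = ∑ j, Λ i j ⊗ₜ[ℂ] a j + a i ⊗ₜ[ℂ] 1) :
    ∃ x : I → ℂ, ∀ i, a i = x i • 1 - ∑ k, x k • Λ i k := by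
  have hΛ := h.irreducible.1
  have hε : ∀ i, Coalgebra.counit (R := ℂ) (a i) = 0 := by
    intro i
    have h1 := sliceRight_counit (a i)
    rw [ha, map_add, map_sum] at h1
    simp only [sliceRight_tmul, Bialgebra.counit_one, one_smul, add_eq_right] at h1
    have := congrArg (Coalgebra.counit (R := ℂ)) h1
    simpa [hΛ.2] using this
  -- The cocycle defines an extension of the trivial representation by `Λ`; an invariant complement
  -- of the `Λ` part splits it.
  let v : Matrix (I ⊕ Unit) (I ⊕ Unit) A :=
    Matrix.fromBlocks Λ (Matrix.of fun i (_ : Unit) => a i) 0 1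
  have hv : IsRep v := by
    constructor
    · rintro (i | i) (j | j)
      · simp [v, hΛ.1]
      · simp [v, ha]
      · simp [v]
      · simp [v, Algebra.TensorProduct.one_def]
    · rintro (i | i) (j | j)
      · simp [v, hΛ.2]
      · simp [v, hε]
      · simp [v]
      · simp [v]
  let W : Submodule ℂ (I ⊕ Unit → ℂ) := LinearMap.ker (LinearMap.proj (Sum.inr ()))
  have hW : ∀ x, x ∈ W ↔ x (Sum.inr ()) = 0 := fun x => Iff.rfl
  have hinr : ∀ (ρ : A →ₗ[ℂ] ℂ) (x : I ⊕ Unit → ℂ),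
      (v.map ρ).mulVec x (Sum.inr ()) = ρ 1 * x (Sum.inr ()) := by
    intro ρ x
    simp [Matrix.mulVec, dotProduct, v]
  have hinl : ∀ (ρ : A →ₗ[ℂ] ℂ) (x : I ⊕ Unit → ℂ) (i : I),
      (v.map ρ).mulVec x (Sum.inl i) = ∑ k, ρ (Λ i k) * x (Sum.inl k) +
        ρ (a i) * x (Sum.inr ()) := by
    intro ρ x i
    simp [Matrix.mulVec, dotProduct, v]
  obtain ⟨W', hW', hc⟩ := h.isCompletelyReducible hv W (fun ρ x hx => by
    rw [hW] at hx ⊢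
    rw [hinr, hx, mul_zero])
  obtain ⟨y, hy, z, hz, hyz⟩ := Submodule.mem_sup.1
    (show Pi.single (Sum.inr ()) (1 : ℂ) ∈ W ⊔ W' by rw [hc.sup_eq_top]; trivial)
  have hz1 : z (Sum.inr ()) = 1 := by
    have := congrFun hyz (Sum.inr ())
    rw [Pi.add_apply, (hW y).1 hy] at this
    simpa using this
  refine ⟨fun i => z (Sum.inl i), fun i => eq_of_forall_dual fun ρ => ?_⟩
  -- Since the last coordinate of `z` is 1, this difference lies both in `W` and in its complement.
  -- Hence `z` is fixed by `v`, which is the coboundary equation.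
  have h1 : (v.map ρ).mulVec z - ρ 1 • z ∈ W' :=
    sub_mem (hW' ρ z hz) (Submodule.smul_mem _ _ hz)
  have h2 : (v.map ρ).mulVec z - ρ 1 • z ∈ W := by
    rw [hW, Pi.sub_apply, hinr, Pi.smul_apply, smul_eq_mul, sub_self]
  have h3 := congrFun (Submodule.disjoint_def.1 hc.disjoint _ h2 h1) (Sum.inl i)
  rw [Pi.sub_apply, hinl, hz1] at h3
  simp only [Pi.smul_apply, smul_eq_mul, mul_one, Pi.zero_apply] at h3
  simp only [map_sub, map_smul, map_sum, smul_eq_mul]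
  simp only [mul_comm (z _)]
  linear_combination h3

/-- The restriction of a representation to an invariant subspace, in a basis of the subspace. -/
theorem IsRep.exists_restrict [Bialgebra ℂ A] {n : Type*} [Fintype n] [DecidableEq n]
    {v : Matrix n n A} (hv : IsRep v) {W : Submodule ℂ (n → ℂ)} (hW : IsInvariant v W) :
    ∃ (w : Matrix (Fin (Module.finrank ℂ W)) (Fin (Module.finrank ℂ W)) A)
      (E : Matrix n (Fin (Module.finrank ℂ W)) ℂ), IsRep w ∧
        (∀ i j, ∑ k, E k j • v i k = ∑ k, E i k • w k j) ∧ ∀ x ∈ W, ∃ y, x = E.mulVec y := by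
  let b := Module.finBasis ℂ W
  choose β hβ using fun k => LinearMap.exists_extend (b.coord k)
  have hβ' : ∀ k, ∀ y ∈ W, ∀ hy, β k y = b.repr ⟨y, hy⟩ k := fun k y _ hy => by
    simpa using LinearMap.congr_fun (hβ k) ⟨y, hy⟩
  have hsum : ∀ y ∈ W, ∀ i, y i = ∑ k, (b k : n → ℂ) i * β k y := by
    intro y hy i
    have := congrFun (congrArg Subtype.val (b.sum_repr ⟨y, hy⟩)) i
    simp only [Submodule.coe_sum, Submodule.coe_smul, Finset.sum_apply, Pi.smul_apply,
      smul_eq_mul] at this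
    rw [← this]
    refine Finset.sum_congr rfl fun k _ => ?_
    rw [hβ' k y hy hy, mul_comm]
  have hβsum : ∀ k (y : n → ℂ), β k y = ∑ i, β k (Pi.single i 1) * y i := by
    intro k y
    conv_lhs => rw [← Finset.univ_sum_single y]
    rw [map_sum]
    refine Finset.sum_congr rfl fun i _ => ?_
    rw [mul_comm, ← smul_eq_mul, ← map_smul, ← Pi.single_smul, smul_eq_mul, mul_one]
  -- The columns of `E` are a basis of `W`, and `w` is determined by `v E = E w` through extended
  -- coordinate functionals.
  let E : Matrix n (Fin (Module.finrank ℂ W)) ℂ := fun i j => (b j : n → ℂ) i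
  let w : Matrix (Fin (Module.finrank ℂ W)) (Fin (Module.finrank ℂ W)) A :=
    fun k j => ∑ i, β k (Pi.single i 1) • ∑ l, E l j • v i l
  have hEw : ∀ i j, ∑ k, E k j • v i k = ∑ k, E i k • w k j := by
    intro i j
    refine eq_of_forall_dual fun ρ => ?_
    have h1 := hsum _ (hW ρ _ (b j).2) i
    simp only [mulVec_map_apply] at h1
    rw [show ∑ k, E k j • v i k = ∑ k, (b j : n → ℂ) k • v i k from rfl, h1, map_sum]
    refine Finset.sum_congr rfl fun k _ => ?_
    rw [map_smul, smul_eq_mul, hβsum]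
    simp only [w, map_sum, map_smul, smul_eq_mul, mulVec_map_apply, E]
  refine ⟨w, E, ⟨fun k j => ?_, fun k j => ?_⟩, hEw, fun x hx => ⟨fun k => β k x, ?_⟩⟩
  · have h1 : ∀ i, Coalgebra.comul (R := ℂ) (∑ l, E l j • v i l) =
        ∑ q, (∑ m, E m q • v i m) ⊗ₜ[ℂ] w q j := by
      intro i
      simp only [map_sum, map_smul, hv.1, Finset.smul_sum, TensorProduct.sum_tmul,
        TensorProduct.smul_tmul]
      rw [Finset.sum_comm, Finset.sum_comm (s := (Finset.univ : Finset (Fin _)))]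
      refine Finset.sum_congr rfl fun m _ => ?_
      simp only [← TensorProduct.tmul_smul, ← TensorProduct.tmul_sum, hEw]
    change Coalgebra.comul (R := ℂ) (∑ i, β k (Pi.single i 1) • ∑ l, E l j • v i l) = _
    rw [map_sum, Finset.sum_congr rfl fun i _ => (map_smul (Coalgebra.comul (R := ℂ))
      (β k (Pi.single i 1)) (∑ l, E l j • v i l)).trans (congrArg _ (h1 i))]
    simp only [Finset.smul_sum]
    rw [Finset.sum_comm]
    refine Finset.sum_congr rfl fun q _ => ?_
    simp only [w, TensorProduct.sum_tmul, TensorProduct.smul_tmul', Finset.smul_sum]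
  · change Coalgebra.counit (R := ℂ) (∑ i, β k (Pi.single i 1) • ∑ l, E l j • v i l) = _
    simp only [map_sum, map_smul, hv.2, smul_eq_mul, mul_ite, mul_one, mul_zero,
      Finset.sum_ite_eq, Finset.mem_univ, if_true]
    rw [← hβsum k (b j : n → ℂ), hβ' k _ (b j).2 (b j).2]
    simp [Finsupp.single_apply, eq_comm]
  · funext i
    exact hsum x hx i

theorem isIrrep_one [Bialgebra ℂ A] : IsIrrep (1 : Matrix (Fin 1) (Fin 1) A) := by
  refine ⟨⟨fun i j => ?_, fun i j => ?_⟩, inferInstance, fun W _ => ?_⟩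
  · rw [Subsingleton.elim i 0, Subsingleton.elim j 0]
    simp [Algebra.TensorProduct.one_def]
  · rw [Subsingleton.elim i 0, Subsingleton.elim j 0]
    simp
  · have : IsSimpleOrder (Submodule ℂ (Fin 1 → ℂ)) :=
      is_simple_module_of_finrank_eq_one (K := ℂ) (Module.finrank_fin_fun ℂ)
    exact eq_bot_or_eq_top W

/-- The hypothesis on `δ` says that the values `δ_s (v_ik)` intertwine `v` with `Λ ⊗ v`. For
irreducible `v` condition (c) makes them vanish; complete reducibility and induction on the
dimension give the rest. -/
theorem IsHomogeneousPart.apply_rep_eq_zero [HopfAlgebra ℂ A] {I : Type*} [Fintype I]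
    [DecidableEq I] {Λ : Matrix I I A} (h : IsHomogeneousPart Λ) {δ : A →ₗ[ℂ] (I → ℂ)}
    (hδ : ∀ a s, rconv a (ηcomp δ s) = ∑ t, Λ s t * lconv (ηcomp δ t) a) (n : ℕ)
    (v : Matrix (Fin n) (Fin n) A) (hv : IsRep v) (i j : Fin n) : δ (v i j) = 0 := by
  induction n using Nat.strong_induction_on with
  | _ n ih =>
    by_cases hirr : IsIrrep v
    -- Condition (c) concerns two tensor factors; the second is taken to be the trivial
    -- representation.
    · let X : Matrix (I × (Fin n × Fin 1)) (Fin n × Fin 1) ℂ := fun x y => δ (v x.2.1 y.1) x.1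
      have hXa : ∀ s i a k b, X (s, i, a) (k, b) = δ (v i k) s := fun _ _ _ _ _ => rfl
      have hX : X = 0 := by
        refine h.mor_eq_zero n 1 v 1 hirr isIrrep_one X ?_
        ext ⟨s, i, a⟩ ⟨k, b⟩
        have := hδ (v i k) s
        simp only [hv.rconv_apply, hv.lconv_apply] at this
        have ha : a = 0 := Subsingleton.elim _ _
        have hb : b = 0 := Subsingleton.elim _ _
        subst ha hb
        simp only [Matrix.mul_apply, Fintype.sum_prod_type, Matrix.map_apply, hXa,
          Matrix.kroneckerMap_apply, Finset.univ_unique, Fin.default_eq_zero, Finset.sum_singleton,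
          Matrix.one_apply_eq, mul_one]
        simp only [ηcomp, LinearMap.coe_mk, AddHom.coe_mk, Algebra.smul_def] at this
        rw [this]
        refine Finset.sum_congr rfl fun t _ => ?_
        rw [Finset.mul_sum]
        refine Finset.sum_congr rfl fun l _ => ?_
        rw [mul_assoc, Algebra.commutes]
      funext s
      exact congrFun (congrFun hX (s, i, 0)) (j, 0)
    · have hne : ∃ W : Submodule ℂ (Fin n → ℂ), IsInvariant v W ∧ W ≠ ⊥ ∧ W ≠ ⊤ := by
        by_contra hcon
        push Not at hcon
        exact hirr ⟨hv, ⟨i⟩, fun W hW => or_iff_not_imp_left.2 (hcon W hW)⟩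
      obtain ⟨W, hW, hbot, htop⟩ := hne
      obtain ⟨W', hW', hc⟩ := h.completelyReducible n v hv W hW
      have htop' : W' ≠ ⊤ := by
        rintro rfl
        exact hbot (disjoint_top.1 hc.disjoint)
      have key : ∀ U : Submodule ℂ (Fin n → ℂ), IsInvariant v U → U ≠ ⊤ → ∀ x ∈ U,
          δ (∑ k, x k • v i k) = 0 := by
        intro U hU hUtop x hx
        obtain ⟨w, E, hw, hEw, hE⟩ := hv.exists_restrict hU
        obtain ⟨y, rfl⟩ := hE x hx
        have hlt : Module.finrank ℂ U < n := by
          simpa using Submodule.finrank_lt hUtop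
        have : ∑ k, E.mulVec y k • v i k = ∑ q, y q • ∑ k, E i k • w k q := by
          simp only [← hEw, Matrix.mulVec, dotProduct, Finset.sum_smul, Finset.smul_sum, smul_smul]
          rw [Finset.sum_comm]
          simp only [mul_comm]
        rw [this]
        simp only [map_sum, map_smul, ih _ hlt w hw, smul_zero, Finset.sum_const_zero]
      obtain ⟨y, hy, z, hz, hyz⟩ := Submodule.mem_sup.1
        (show Pi.single j (1 : ℂ) ∈ W ⊔ W' by rw [hc.sup_eq_top]; trivial)
      have : v i j = ∑ k, y k • v i k + ∑ k, z k • v i k := by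
        have h2 : ∀ k, y k + z k = (Pi.single j 1 : Fin n → ℂ) k := fun k => congrFun hyz k
        rw [← Finset.sum_add_distrib]
        simp only [← add_smul, h2]
        simp [Pi.single_apply]
      rw [this, map_add, key W hW htop y hy, key W' hW' htop' z hz, add_zero]

theorem IsHomogeneousPart.eq_zero [HopfAlgebra ℂ A] {I : Type*} [Fintype I]
    [DecidableEq I] {Λ : Matrix I I A} (h : IsHomogeneousPart Λ) {δ : A →ₗ[ℂ] (I → ℂ)}
    (hδ : ∀ a s, rconv a (ηcomp δ s) = ∑ t, Λ s t * lconv (ηcomp δ t) a) : δ = 0 := by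
  ext1 a
  obtain ⟨n, v, hv, ha⟩ := exists_rep a
  have hle : Submodule.span ℂ (Set.range fun x : Fin n × Fin n => v x.1 x.2) ≤
      LinearMap.ker δ := by
    refine Submodule.span_le.2 ?_
    rintro _ ⟨x, rfl⟩
    exact h.apply_rep_eq_zero hδ n v hv x.1 x.2
  exact hle ha

end Reducibility

end InhomQG

namespace InhomQG

/-! ### Uniqueness of the functionals and of the translation part. -/

section Uniqueness

variable {A B I : Type*} [Ring A] [HopfAlgebra ℂ A] [Ring B] [Bialgebra ℂ B]
variable [Fintype I] [DecidableEq I] {Λ : Matrix I I A} {ι : A →ₐc[ℂ] B} {p : I → B}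
    {f f₂ : A →ₗ[ℂ] Matrix I I ℂ} {η η₂ : A →ₗ[ℂ] (I → ℂ)} {T T₂ : I × I → ℂ}

namespace IsInhomogeneousQuantumGroup

theorem coeff_unique (H : IsInhomogeneousQuantumGroup Λ ι p f η T) {a a' : A} {b b' : I → A}
    (h : ∑ i, ι (b i) * p i + ι a = ∑ i, ι (b' i) * p i + ι a') : b = b' ∧ a = a' := by
  have hb : b - b' = 0 := by
    refine H.eq_zero_of_sum_mem ⟨a' - a, ?_⟩
    change ι (a' - a) = _
    simp only [Pi.sub_apply, map_sub, sub_mul, Finset.sum_sub_distrib]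
    rw [sub_eq_sub_iff_add_eq_add, add_comm, ← h, add_comm]
  have hb' : b = b' := sub_eq_zero.1 hb
  subst hb'
  exact ⟨rfl, H.injective (add_left_cancel h)⟩

/-- The functionals `f` and `η` are determined by the commutation relations. -/
theorem functionals_unique (H : IsInhomogeneousQuantumGroup Λ ι p f η T)
    (H₂ : IsInhomogeneousQuantumGroup Λ ι p f₂ η₂ T₂) : f = f₂ ∧ η = η₂ := by
  have h := fun a s => H.coeff_unique ((H.p_mul a s).symm.trans (H₂.p_mul a s))
  refine ⟨?_, sub_eq_zero.1 (H.homogeneousPart.eq_zero fun a s => ?_)⟩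
  · ext a s t
    have := congrArg (Coalgebra.counit (R := ℂ)) (congrFun (h a s).1 t)
    simp only [counit_rconv] at this
    exact this
  -- The relations determine only `a * η_s - Λ_st (η_t * a)`, so the difference of two candidates
  -- satisfies the intertwining identity that forces it to vanish.
  · have hsub : ∀ s, ηcomp (η - η₂) s = ηcomp η s - ηcomp η₂ s := fun s => by
      ext a; simp [ηcomp]
    have hr : ∀ ρ σ : A →ₗ[ℂ] ℂ, rconv a (ρ - σ) = rconv a ρ - rconv a σ := fun ρ σ => by
      simp [rconv, LinearMap.rTensor_sub]
    have hl : ∀ ρ σ : A →ₗ[ℂ] ℂ, lconv (ρ - σ) a = lconv ρ a - lconv σ a := fun ρ σ => by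
      simp [lconv, LinearMap.lTensor_sub]
    simp only [hsub, hr, hl, mul_sub, Finset.sum_sub_distrib]
    exact sub_eq_sub_iff_sub_eq_sub.1 (h a s).2

/-- Only `Δ(b_t)(p_t ⊗ 1)` survives `γ_t` on the first leg, and there it acts as the counit. The
whole coefficient `b_t`, not just its counit, is thus recovered. -/
theorem sliceLeft_coord (H : IsInhomogeneousQuantumGroup Λ ι p f η T) {γ : I → B →ₗ[ℂ] ℂ}
    (h0 : ∀ t a, γ t (ι a) = 0)
    (h1 : ∀ t a i, γ t (ι a * p i) = if i = t then Coalgebra.counit (R := ℂ) a else 0)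
    (a : A) (b : I → A) (t : I) :
    sliceLeft B (γ t) (Coalgebra.comul (R := ℂ) (ι a + ∑ i, ι (b i) * p i)) = ι (b t) := by
  have hA : ∀ {z}, z ∈ tens (imA ι) ⊤ → sliceLeft B (γ t) z = 0 := fun hz => by
    refine sliceLeft_eq_zero_of_mem_tens _ ?_ hz
    rintro _ ⟨a, rfl⟩
    exact h0 t a
  have hle : ∀ a, Coalgebra.comul (R := ℂ) (ι a) ∈ tens (imA ι) ⊤ := fun a =>
    Submodule.map₂_le_map₂_right le_top (comul_map_mem ι a)
  have key : ∀ (z : A ⊗[ℂ] A) (i : I), sliceLeft B (γ t)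
      (TensorProduct.map (ι : A →ₗ[ℂ] B) (ι : A →ₗ[ℂ] B) z * p i ⊗ₜ[ℂ] 1) =
        if i = t then ι (sliceLeft A (Coalgebra.counit (R := ℂ)) z) else 0 := by
    intro z i
    induction z with
    | zero => simp
    | tmul y z =>
      simp only [TensorProduct.map_tmul, LinearMap.coe_coe, Algebra.TensorProduct.tmul_mul_tmul,
        mul_one, sliceLeft_tmul, h1]
      split_ifs
      · rw [map_smul]
      · rw [zero_smul]
    | add y z hy hz =>
      simp only [map_add, add_mul, hy, hz]
      split_ifs <;> simp
  have h2 : ∀ i, sliceLeft B (γ t) (Coalgebra.comul (R := ℂ) (ι (b i) * p i)) =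
      if i = t then ι (b i) else 0 := by
    intro i
    rw [Bialgebra.comul_mul, H.comul_p, mul_add, map_add, hA, zero_add, comul_map, key,
      sliceLeft_counit]
    rw [Finset.mul_sum]
    exact Submodule.sum_mem _ fun j _ => tens_mul_tmul
      (fun u hu => mul_mem_imA hu (map_mem_imA ι _)) (fun _ _ => Submodule.mem_top)
      (hle (b i))
  rw [map_add, map_add, hA (hle a), zero_add, map_sum, map_sum]
  simp only [h2, Finset.sum_ite_eq', Finset.mem_univ, if_true]

/-- The elements of degree at most one which transform like the `p_i`. -/
theorem exists_eq_of_comul (H : IsInhomogeneousQuantumGroup Λ ι p f η T) {q : I → B}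
    (hq : ∀ i, q i ∈ filtOne ι p)
    (hΔ : ∀ i, Coalgebra.comul (R := ℂ) (q i) = ∑ j, ι (Λ i j) ⊗ₜ[ℂ] q j + q i ⊗ₜ[ℂ] 1) :
    ∃ (c : ℂ) (h : I → ℂ), ∀ i, q i = c • p i + h i • 1 - ∑ k, h k • ι (Λ i k) := by
  obtain ⟨γ, h0, h1⟩ := H.exists_coord
  choose a b hab using fun i => mem_filtOne.1 (hq i)
  let C : Matrix I I ℂ := fun i t => γ t (q i)
  have hone : ∀ t, γ t 1 = 0 := fun t => by rw [← map_one ι, h0]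
  have hp : ∀ t i, γ t (p i) = if i = t then 1 else 0 := fun t i => by
    simpa using h1 t 1 i
  -- Applying `γ_t` to the first leg of `Δ q_i` kills the terms with `Λ_ij` and leaves a scalar.
  have hb : ∀ i t, ι (b i t) = C i t • 1 := by
    intro i t
    rw [← H.sliceLeft_coord h0 h1 (a i) (b i) t, ← hab, hΔ, map_add, map_sum]
    simp only [sliceLeft_tmul, h0, zero_smul, Finset.sum_const_zero, zero_add]
    rfl
  have hq' : ∀ i, q i = ι (a i) + ∑ j, C i j • p j := by
    intro i
    rw [hab i]
    simp only [hb, smul_mul_assoc, one_mul]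
  -- Applying `γ_t` to the second leg in two ways shows that `C` commutes with `Λ`, so Schur's lemma
  -- makes it a scalar.
  have hC : ∀ i t, ∑ j, C i j • Λ j t = ∑ j, C j t • Λ i j := by
    intro i t
    apply H.injective
    have e1 : sliceRight B (γ t) (Coalgebra.comul (R := ℂ) (q i)) = ∑ j, C j t • ι (Λ i j) := by
      rw [hΔ, map_add, map_sum]
      simp only [sliceRight_tmul, hone, zero_smul, add_zero]
      rfl
    have e2 : sliceRight B (γ t) (Coalgebra.comul (R := ℂ) (q i)) = ∑ j, C i j • ι (Λ j t) := by
      have : sliceRight B (γ t) (Coalgebra.comul (R := ℂ) (ι (a i))) = 0 := by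
        refine sliceRight_eq_zero_of_mem_tens _ ?_ (comul_map_mem ι (a i))
        rintro _ ⟨a, rfl⟩
        exact h0 t a
      rw [hq', map_add, map_add, this, zero_add, map_sum, map_sum]
      simp only [map_smul, H.comul_p, map_add, map_sum, sliceRight_tmul, hone, zero_smul, add_zero,
        hp, ite_smul, one_smul, Finset.sum_ite_eq', Finset.mem_univ, if_true]
    rw [map_sum, map_sum]
    simp only [map_smul]
    rw [← e1, ← e2]
  obtain ⟨c, hc⟩ := H.homogeneousPart.irreducible.eq_smul_one hC
  have hq2 : ∀ i, q i = ι (a i) + c • p i := by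
    intro i
    rw [hq', hc]
    simp [Matrix.one_apply]
  -- The remainder `q - c p` lies in `A` and inherits the cocycle identity from `q` and `p`.
  obtain ⟨x, hx⟩ := H.homogeneousPart.exists_coboundary (a := a) (by
    intro i
    apply TensorProduct.map_injective_of_flat_flat (ι : A →ₗ[ℂ] B) (ι : A →ₗ[ℂ] B)
      H.injective H.injective
    rw [← comul_map]
    have h2 : ι (a i) = q i - c • p i := by rw [hq2]; abel
    rw [h2, map_sub, hΔ, map_smul, H.comul_p]
    simp only [map_add, map_sum, TensorProduct.map_tmul, LinearMap.coe_coe, map_one, hq2,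
      TensorProduct.tmul_add, TensorProduct.add_tmul, Finset.sum_add_distrib,
      TensorProduct.tmul_smul, smul_add, Finset.smul_sum, TensorProduct.smul_tmul']
    abel)
  refine ⟨c, x, fun i => ?_⟩
  rw [hq2, hx]
  simp only [map_sub, map_smul, map_one, map_sum]
  abel

end IsInhomogeneousQuantumGroup

end Uniqueness

end InhomQG

namespace InhomQG

/-! ### Complex matrices acting on vectors over an algebra -/

section Action

variable {B : Type*} [Ring B] [Algebra ℂ B] {n m l : Type*} [Fintype n] [Fintype m]

/-- The action of a complex matrix on vectors over `B`. -/
noncomputable def act (N : Matrix l n ℂ) : (n → B) →ₗ[ℂ] (l → B) where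
  toFun Q y := ∑ x, N y x • Q x
  map_add' P Q := by
    funext y
    simp [Finset.sum_add_distrib]
  map_smul' c Q := by
    funext y
    simp only [Pi.smul_apply, RingHom.id_apply, Finset.smul_sum, smul_comm c]

theorem act_apply (N : Matrix l n ℂ) (Q : n → B) (y : l) : act N Q y = ∑ x, N y x • Q x := rfl

theorem act_act (N : Matrix l m ℂ) (N' : Matrix m n ℂ) (Q : n → B) :
    act N (act N' Q) = act (N * N') Q := by
  funext y
  simp only [act_apply, Matrix.mul_apply, Finset.smul_sum, Finset.sum_smul, smul_smul]
  rw [Finset.sum_comm]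

theorem act_add (N N' : Matrix l n ℂ) (Q : n → B) : act (N + N') Q = act N Q + act N' Q := by
  funext y
  simp [act_apply, add_smul, Finset.sum_add_distrib]

theorem act_sub (N N' : Matrix l n ℂ) (Q : n → B) : act (N - N') Q = act N Q - act N' Q := by
  funext y
  simp [act_apply, sub_smul, Finset.sum_sub_distrib]

theorem act_one [DecidableEq n] (Q : n → B) : act (1 : Matrix n n ℂ) Q = Q := by
  funext y
  simp [act_apply, Matrix.one_apply]

theorem act_zero (Q : n → B) : act (0 : Matrix l n ℂ) Q = 0 := by
  funext y
  simp [act_apply]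

/-- A complex vector as a vector over `B`. -/
noncomputable def cst (B : Type*) [Ring B] [Algebra ℂ B] {n : Type*} : (n → ℂ) →ₗ[ℂ] (n → B) where
  toFun t x := t x • 1
  map_add' s t := by funext x; simp [add_smul]
  map_smul' c t := by funext x; simp [smul_smul]

theorem cst_apply {n : Type*} (t : n → ℂ) (x : n) : cst B t x = t x • (1 : B) := rfl

theorem act_cst (N : Matrix l n ℂ) (t : n → ℂ) : act N (cst B t) = cst B (N.mulVec t) := by
  funext y
  simp [act_apply, cst_apply, Matrix.mulVec, dotProduct, smul_smul, Finset.sum_smul]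

/-- The action of a matrix over `B` on a complex vector. -/
noncomputable def col (v : Matrix l n B) : (n → ℂ) →ₗ[ℂ] (l → B) where
  toFun t x := ∑ z, t z • v x z
  map_add' s t := by funext x; simp [add_smul, Finset.sum_add_distrib]
  map_smul' c t := by funext x; simp [smul_smul, Finset.smul_sum]

theorem col_apply (v : Matrix l n B) (t : n → ℂ) (x : l) : col v t x = ∑ z, t z • v x z := rfl

theorem act_col (N : Matrix n n ℂ) (v : Matrix n n B)
    (h : ∀ y z, ∑ x, N y x • v x z = ∑ x, N x z • v y x) (t : n → ℂ) :
    act N (col v t) = col v (N.mulVec t) := by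
  funext y
  simp only [act_apply, col_apply, Finset.smul_sum, Matrix.mulVec, dotProduct, Finset.sum_smul]
  rw [Finset.sum_comm]
  simp only [smul_comm (N _ _) (t _), ← Finset.smul_sum, h]
  simp only [Finset.smul_sum, smul_smul, mul_comm]
  rw [Finset.sum_comm]

end Action

section Convolution

variable {A : Type*} [Ring A] [Bialgebra ℂ A]

/-- `ρ ↦ a * ρ`. -/
noncomputable def rconvHom (a : A) : (A →ₗ[ℂ] ℂ) →ₗ[ℂ] A where
  toFun := rconv a
  map_add' ρ σ := by simp [rconv, LinearMap.rTensor_add]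
  map_smul' c ρ := by simp [rconv, LinearMap.rTensor_smul]

/-- `ρ ↦ ρ * a`. -/
noncomputable def lconvHom (a : A) : (A →ₗ[ℂ] ℂ) →ₗ[ℂ] A where
  toFun ρ := lconv ρ a
  map_add' ρ σ := by simp [lconv, LinearMap.lTensor_add]
  map_smul' c ρ := by simp [lconv, LinearMap.lTensor_smul]

theorem rconvHom_apply (a : A) (ρ : A →ₗ[ℂ] ℂ) : rconvHom a ρ = rconv a ρ := rfl

theorem lconvHom_apply (a : A) (ρ : A →ₗ[ℂ] ℂ) : lconvHom a ρ = lconv ρ a := rfl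

end Convolution

/-! ### Translation of the `p_i` by a complex vector. -/

section Shift

variable {A B I : Type*} [Ring A] [HopfAlgebra ℂ A] [Ring B] [Bialgebra ℂ B]
variable [Fintype I] [DecidableEq I] {Λ : Matrix I I A} {ι : A →ₐc[ℂ] B} {p : I → B}
    {f : A →ₗ[ℂ] Matrix I I ℂ} {η : A →ₗ[ℂ] (I → ℂ)} {T : I × I → ℂ}

theorem filtOne_le {A B I : Type*} [Ring A] [HopfAlgebra ℂ A] [Ring B] [Bialgebra ℂ B]
    {ι : A →ₐc[ℂ] B} {p p₂ : I → B} (h : ∀ i, p i ∈ filtOne ι p₂) :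
    filtOne ι p ≤ filtOne ι p₂ := by
  refine Submodule.span_le.2 ?_
  rintro x (⟨a, rfl⟩ | ⟨a, i, rfl⟩)
  · exact map_mem_filtOne ι p₂ a
  · exact mul_mem_filtOne ι p₂ a (h i)

/-- The matrix `Λ ⊗ Λ` over `B`. -/
def lamMat (Λ : Matrix I I A) (ι : A →ₐc[ℂ] B) : Matrix (I × I) (I × I) B :=
  fun x z => ι (Λ x.1 z.1 * Λ x.2 z.2)

namespace IsInhomogeneousQuantumGroup

/-- The relation between `Λ` and `f`, evaluated at entries of `Λ`, says that `R` intertwines `Λ ⊗ Λ`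
with itself. -/
theorem Rmat_lamMat (H : IsInhomogeneousQuantumGroup Λ ι p f η T) (y z : I × I) :
    ∑ x, Rmat Λ f y x • lamMat Λ ι x z = ∑ x, Rmat Λ f x z • lamMat Λ ι y x := by
  have h := congrArg ι (H.Λ_f (Λ y.2 z.1) y.1 z.2)
  simp only [H.isRep.rconv_apply, H.isRep.lconv_apply, Finset.mul_sum, Finset.sum_mul,
    mul_smul_comm, smul_mul_assoc, map_sum, map_smul] at h
  simp only [Fintype.sum_prod_type]
  rw [Finset.sum_comm]
  exact h.symm

theorem act_Rmat_lam (H : IsInhomogeneousQuantumGroup Λ ι p f η T) (t : I × I → ℂ) :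
    act (Rmat Λ f) (col (lamMat Λ ι) t) = col (lamMat Λ ι) ((Rmat Λ f).mulVec t) :=
  act_col _ _ H.Rmat_lamMat t

theorem sum_quadratic_eq (Λ : Matrix I I A) (ι : A →ₐc[ℂ] B) (p : I → B)
    (f : A →ₗ[ℂ] Matrix I I ℂ) (η : A →ₗ[ℂ] (I → ℂ)) (T : I × I → ℂ) (y : I × I) :
    ∑ x, (Rmat Λ f - 1) y x •
      (p x.1 * p x.2 - ∑ s, Zmat Λ η x s • p s + T x • 1
        - ∑ z, T z • ι (Λ x.1 z.1 * Λ x.2 z.2)) =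
    act (Rmat Λ f - 1) ((fun x => p x.1 * p x.2) - act (Zmat Λ η) p + cst B T -
      col (lamMat Λ ι) T) y := rfl

/-- `p_i l_j` for `l = Λ k`. -/
theorem p_mul_col (H : IsInhomogeneousQuantumGroup Λ ι p f η T) (k : I → ℂ) (x : I × I) :
    p x.1 * col (Λ.map ι) k x.2 =
      act (Rmat Λ f) (fun y => col (Λ.map ι) k y.1 * p y.2) x +
        act (Zmat Λ η) (col (Λ.map ι) k) x -
          col (lamMat Λ ι) ((Zmat Λ η).mulVec k) x := by
  obtain ⟨i, j⟩ := x
  have h : ∀ n, p i * ι (Λ j n) = ∑ m, ∑ t, Rmat Λ f (i, j) (m, t) • (ι (Λ m n) * p t) +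
      ∑ m, Zmat Λ η (i, j) m • ι (Λ m n) -
        ∑ t, ∑ m, Zmat Λ η (t, m) n • lamMat Λ ι (i, j) (t, m) := by
    intro n
    rw [H.p_mul]
    simp only [H.isRep.rconv_apply, H.isRep.lconv_apply, Finset.mul_sum, Finset.sum_mul,
      mul_smul_comm, smul_mul_assoc, map_sum, map_smul, map_sub, lamMat]
    rw [Finset.sum_comm, add_sub_assoc]
    rfl
  simp only [col_apply, act_apply, Finset.mul_sum, mul_smul_comm, Matrix.map_apply, h, smul_add,
    smul_sub, Finset.sum_add_distrib, Finset.sum_sub_distrib, Fintype.sum_prod_type,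
    Finset.smul_sum, Finset.sum_mul, smul_mul_assoc, Matrix.mulVec, dotProduct, Finset.sum_smul,
    smul_smul]
  congr 1
  · congr 1
    · rw [Finset.sum_comm]
      refine Finset.sum_congr rfl fun m _ => ?_
      rw [Finset.sum_comm]
      refine Finset.sum_congr rfl fun t _ => Finset.sum_congr rfl fun n _ => ?_
      rw [mul_comm]
    · rw [Finset.sum_comm]
      refine Finset.sum_congr rfl fun m _ => Finset.sum_congr rfl fun n _ => ?_
      rw [mul_comm]
  · rw [Finset.sum_comm]
    refine Finset.sum_congr rfl fun m _ => ?_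
    rw [Finset.sum_comm]
    refine Finset.sum_congr rfl fun t _ => Finset.sum_congr rfl fun n _ => ?_
    rw [mul_comm]

/-- After expansion, the new terms that involve `p` or a single `Λ` group into vectors `v + R v`,
which `R - 1` kills because `R² = 1`. Only constants and multiples of `Λ ⊗ Λ` remain, and the
correction to `T` is chosen to cancel them. -/
theorem quadratic_shift (H : IsInhomogeneousQuantumGroup Λ ι p f η T) (k : I → ℂ)
    {η₂ : A →ₗ[ℂ] (I → ℂ)}
    (hη : ∀ a, η₂ a = η a + (f a).mulVec k - Coalgebra.counit (R := ℂ) a • k)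
    {T₂ : I × I → ℂ} (hT : T₂ = T + (1 / 2 : ℂ) • (1 - Rmat Λ f).mulVec
      (-(Zmat Λ η).mulVec k + fun x => k x.1 * k x.2))
    {p₂ : I → B} (hp : p₂ = p - cst B k + col (Λ.map ι) k) :
    act (Rmat Λ f - 1) ((fun x => p₂ x.1 * p₂ x.2) - act (Zmat Λ η₂) p₂ + cst B T₂ -
      col (lamMat Λ ι) T₂) = 0 := by
  set R := Rmat Λ f with hR
  set l := col (Λ.map ι) k with hl
  set kk : I × I → ℂ := fun x => k x.1 * k x.2 with hkk
  have hZ : ∀ (v : I → B) x, act (Zmat Λ η₂) v x = act (Zmat Λ η) v x +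
      act R (fun y => k y.2 • v y.1) x - k x.1 • v x.2 := by
    rintro v ⟨i, j⟩
    have : ∀ s, Zmat Λ η₂ (i, j) s = Zmat Λ η (i, j) s + ∑ m, R (i, j) (s, m) * k m -
        (if j = s then k i else 0) := by
      intro s
      change η₂ (Λ j s) i = _
      rw [hη, H.isRep.2]
      simp only [Pi.add_apply, Pi.sub_apply, Pi.smul_apply, smul_eq_mul, ite_mul, one_mul,
        zero_mul]
      rfl
    simp only [act_apply, this, add_smul, sub_smul, Finset.sum_add_distrib,
      Finset.sum_sub_distrib, ite_smul, zero_smul, Finset.sum_ite_eq, Finset.mem_univ, if_true,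
      Finset.sum_smul, Fintype.sum_prod_type, smul_smul]
  have hll : (fun x : I × I => l x.1 * l x.2) = col (lamMat Λ ι) kk := by
    funext x
    simp only [hl, col_apply, lamMat, hkk, Finset.sum_mul, Finset.mul_sum, smul_mul_assoc,
      mul_smul_comm, Fintype.sum_prod_type, Matrix.map_apply, map_mul]
    rw [Finset.sum_comm]
    simp only [Finset.smul_sum, smul_smul, mul_comm]
  have hRR : R * R = 1 := H.R_sq
  have hN1 : ∀ v : I × I → B, act (R - 1) (v + act R v) = 0 := by
    intro v
    rw [map_add, act_act, ← act_add, sub_mul, hRR, one_mul]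
    have : R - 1 + (1 - R) = 0 := by abel
    rw [this, act_zero]
  -- Since `(R - 1)(1 - R) = 2 (R - 1)`, the factor `1 / 2` in the correction of `T` is what makes
  -- the cancellation exact.
  have hN2 : ∀ t : I × I → ℂ, (R - 1).mulVec ((1 / 2 : ℂ) • (1 - R).mulVec t) =
      (R - 1).mulVec t := by
    intro t
    rw [← Matrix.smul_mulVec, Matrix.mulVec_mulVec]
    congr 1
    have : (R - 1) * (1 - R) = (2 : ℂ) • (R - 1) := by
      rw [two_smul]
      simp only [sub_mul, mul_sub, hRR, mul_one, one_mul]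
      abel
    rw [mul_smul_comm, this, smul_smul]
    norm_num
  have hN3 : ∀ t : I × I → ℂ, act (R - 1) (col (lamMat Λ ι) t) =
      col (lamMat Λ ι) ((R - 1).mulVec t) := by
    intro t
    rw [act_sub, H.act_Rmat_lam, act_one, Matrix.sub_mulVec, Matrix.one_mulVec, map_sub]
  have hN4 : (R - 1).mulVec (R.mulVec kk + kk) = 0 := by
    rw [Matrix.mulVec_add, Matrix.mulVec_mulVec, ← Matrix.add_mulVec, sub_mul, hRR, one_mul]
    have : 1 - R + (R - 1) = 0 := by abel
    rw [this, Matrix.zero_mulVec]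
  set w : I × I → ℂ := -(Zmat Λ η).mulVec k + kk with hw
  set T' : I × I → ℂ := (1 / 2 : ℂ) • (1 - R).mulVec w with hT'
  have main : (fun x => p₂ x.1 * p₂ x.2) - act (Zmat Λ η₂) p₂ + cst B T₂ -
      col (lamMat Λ ι) T₂ =
      ((fun x => p x.1 * p x.2) - act (Zmat Λ η) p + cst B T - col (lamMat Λ ι) T) -
      ((fun x : I × I => k x.2 • p x.1) + act R (fun x : I × I => k x.2 • p x.1)) +
      ((fun x : I × I => l x.1 * p x.2) + act R (fun x : I × I => l x.1 * p x.2)) -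
      ((fun x : I × I => k x.2 • l x.1) + act R (fun x : I × I => k x.2 • l x.1)) +
      cst B ((Zmat Λ η).mulVec k + R.mulVec kk + T') + col (lamMat Λ ι) (w - T') := by
    have hv : (fun y : I × I => k y.2 • p₂ y.1) = (fun y : I × I => k y.2 • p y.1) - cst B kk +
        fun y : I × I => k y.2 • l y.1 := by
      funext y
      rw [hp]
      simp only [Pi.add_apply, Pi.sub_apply, smul_add, smul_sub, cst_apply, smul_smul, hkk]
      rw [mul_comm]
    have e1 : act (Zmat Λ η₂) p₂ = act (Zmat Λ η) p - cst B ((Zmat Λ η).mulVec k) +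
        act (Zmat Λ η) l + (act R (fun y : I × I => k y.2 • p y.1) - cst B (R.mulVec kk) +
        act R (fun y : I × I => k y.2 • l y.1)) - fun x : I × I => k x.1 • p₂ x.2 := by
      funext x
      rw [hZ, hv, hp]
      simp only [map_add, map_sub, act_cst, Pi.add_apply, Pi.sub_apply]
    have e2 : (fun x : I × I => p₂ x.1 * p₂ x.2) = (fun x => p x.1 * p x.2) -
        (fun x : I × I => k x.2 • p x.1) + (fun x : I × I => p x.1 * l x.2) -
        (fun x : I × I => k x.1 • p₂ x.2) +
        (fun x : I × I => l x.1 * p x.2) - (fun x : I × I => k x.2 • l x.1) +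
        (fun x : I × I => l x.1 * l x.2) := by
      funext x
      rw [hp]
      simp only [Pi.add_apply, Pi.sub_apply, cst_apply, mul_add, mul_sub, add_mul, sub_mul,
        smul_mul_assoc, mul_smul_comm, one_mul, mul_one, smul_add, smul_sub,
        smul_comm (k x.2) (k x.1)]
      abel
    have e3 : (fun x : I × I => p x.1 * l x.2) = act R (fun x : I × I => l x.1 * p x.2) +
        act (Zmat Λ η) l - col (lamMat Λ ι) ((Zmat Λ η).mulVec k) := by
      funext x
      exact H.p_mul_col k x
    rw [e1, e2, e3, hll, hT]
    simp only [map_add, map_sub, hw, map_neg]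
    abel
  have hQ : act (R - 1) ((fun x => p x.1 * p x.2) - act (Zmat Λ η) p + cst B T -
      col (lamMat Λ ι) T) = 0 := by
    funext y
    exact (sum_quadratic_eq Λ ι p f η T y).symm.trans (H.quadratic y)
  rw [main, map_add, map_add, map_sub, map_add, map_sub, hQ, hN1, hN1, hN1, hN3, act_cst,
    Matrix.mulVec_sub, hN2, sub_self ((R - 1).mulVec w), map_zero, Matrix.mulVec_add, hN2, ← Matrix.mulVec_add]
  have : (Zmat Λ η).mulVec k + R.mulVec kk + w = R.mulVec kk + kk := by
    rw [hw]; abel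
  rw [this, hN4, map_zero]
  simp

/-- The translation `p ↦ p - k + Λ k`. -/
theorem shift (H : IsInhomogeneousQuantumGroup Λ ι p f η T) (k : I → ℂ)
    {η₂ : A →ₗ[ℂ] (I → ℂ)}
    (hη : ∀ a, η₂ a = η a + (f a).mulVec k - Coalgebra.counit (R := ℂ) a • k)
    {T₂ : I × I → ℂ} (hT : T₂ = T + (1 / 2 : ℂ) • (1 - Rmat Λ f).mulVec
      (-(Zmat Λ η).mulVec k + fun x => k x.1 * k x.2))
    {p₂ : I → B} (hp : p₂ = p - cst B k + col (Λ.map ι) k) :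
    IsInhomogeneousQuantumGroup Λ ι p₂ f η₂ T₂ := by
  have hp' : ∀ i, p₂ i = p i - k i • 1 + ∑ m, k m • ι (Λ i m) := fun i => by rw [hp]; rfl
  have hd : ∀ i, p₂ i - p i = ι (-(k i • 1) + ∑ m, k m • Λ i m) := by
    intro i
    rw [hp', map_add, map_neg, map_smul, map_one, map_sum]
    simp only [map_smul]
    abel
  have hp₂ : ∀ i, p₂ i = p i + ι (-(k i • 1) + ∑ m, k m • Λ i m) := fun i => by
    rw [← hd]; abel
  -- The `p_i` change by elements of `A` only.
  have hF : filtOne ι p₂ = filtOne ι p := by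
    apply le_antisymm
    · refine filtOne_le fun i => ?_
      rw [hp₂]
      exact add_mem (p_mem_filtOne ι p i) (map_mem_filtOne ι p _)
    · refine filtOne_le fun i => ?_
      have : p i = p₂ i - ι (-(k i • 1) + ∑ m, k m • Λ i m) := by rw [← hd]; abel
      rw [this]
      exact sub_mem (p_mem_filtOne ι p₂ i) (map_mem_filtOne ι p₂ _)
  have hηc : ∀ s, ηcomp η₂ s = ηcomp η s + ∑ t, k t • fcomp f s t -
      k s • Coalgebra.counit (R := ℂ) := by
    intro s
    ext a
    change η₂ a s = _
    rw [hη]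
    simp only [Pi.sub_apply, Pi.add_apply, Pi.smul_apply, smul_eq_mul, LinearMap.sub_apply,
      LinearMap.add_apply, LinearMap.sum_apply, LinearMap.smul_apply, mul_comm (k _)]
    rfl
  refine
    { homogeneousPart := H.homogeneousPart
      generated := ?_
      injective := H.injective
      rep := ?_
      exists_notMem := ?_
      mul_mem := by rw [hF]; exact H.mul_mem
      f_one := H.f_one
      f_mul := H.f_mul
      η_one := ?_
      η_mul := ?_
      Λ_f := H.Λ_f
      p_mul := ?_
      R_sq := H.R_sq
      leading_terms := ?_
      R_T := ?_
      quadratic := ?_ }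
  · rw [eq_top_iff, ← H.generated]
    refine Algebra.adjoin_le ?_
    rintro x (⟨a, rfl⟩ | ⟨i, rfl⟩)
    · exact Algebra.subset_adjoin (Or.inl ⟨a, rfl⟩)
    · have : p i = p₂ i - ι (-(k i • 1) + ∑ m, k m • Λ i m) := by rw [← hd]; abel
      rw [this]
      exact sub_mem (Algebra.subset_adjoin (Or.inr ⟨i, rfl⟩))
        (Algebra.subset_adjoin (Or.inl ⟨_, rfl⟩))
  · constructor
    · rintro (i | i) (j | j)
      · simpa using H.rep.1 (Sum.inl i) (Sum.inl j)
      · have h1 : ∀ m, Coalgebra.comul (R := ℂ) (ι (Λ i m)) = ∑ j, ι (Λ i j) ⊗ₜ[ℂ] ι (Λ j m) :=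
          fun m => (H.isRep.map ι).1 i m
        simp only [Matrix.fromBlocks_apply₁₂, Matrix.of_apply, Fintype.sum_sum_type,
          Matrix.fromBlocks_apply₁₁, Matrix.fromBlocks_apply₂₂, Matrix.map_apply, hp', map_add,
          map_sub, map_smul, map_sum, H.comul_p, h1, Bialgebra.comul_one,
          Algebra.TensorProduct.one_def, TensorProduct.tmul_add, TensorProduct.tmul_sub,
          TensorProduct.add_tmul, TensorProduct.sub_tmul, TensorProduct.tmul_sum,
          TensorProduct.sum_tmul, Finset.sum_add_distrib, Finset.sum_sub_distrib,
          TensorProduct.tmul_smul, TensorProduct.smul_tmul', Finset.smul_sum, Finset.univ_unique,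
          Finset.sum_singleton, Matrix.one_apply_eq]
        rw [Finset.sum_comm (f := fun a b => (k a • ι (Λ i b)) ⊗ₜ[ℂ] ι (Λ b a))]
        abel
      · simp
      · simp [Algebra.TensorProduct.one_def]
    · rintro (i | i) (j | j)
      · simpa using H.rep.2 (Sum.inl i) (Sum.inl j)
      · simp [hp', H.counit_p, H.isRep.2]
      · simp
      · simp
  · obtain ⟨i, hi⟩ := H.exists_notMem
    refine ⟨i, fun ⟨a, ha⟩ => hi ⟨a - (-(k i • 1) + ∑ m, k m • Λ i m), ?_⟩⟩
    rw [map_sub, ha, hp₂, add_sub_cancel_right]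
  · rw [hη, H.f_one, H.η_one]
    simp
  · intro a b
    rw [hη, hη, hη, H.f_mul, H.η_mul, Bialgebra.counit_mul]
    simp only [Matrix.mulVec_add, Matrix.mulVec_sub, Matrix.mulVec_smul, Matrix.mulVec_mulVec,
      smul_add, smul_sub, smul_smul]
    rw [mul_comm (Coalgebra.counit (R := ℂ) a)]
    abel
  · intro a s
    have h1 := H.p_mul a s
    have h2 : ∀ m, ∑ t, ι (Λ s t) * ι (lconv (fcomp f t m) a) =
        ∑ t, ι (rconv a (fcomp f s t)) * ι (Λ t m) := by
      intro m
      simpa only [map_sum, map_mul] using congrArg ι (H.Λ_f a s m)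
    have h3 : rconv a (ηcomp η₂ s) = rconv a (ηcomp η s) + ∑ t, k t • rconv a (fcomp f s t) -
        k s • a := by
      rw [← rconvHom_apply, hηc, map_sub, map_add, map_sum, map_smul]
      simp only [map_smul, rconvHom_apply]
      rw [rconv_eq a Coalgebra.counit, sliceLeft_counit]
    have h4 : ∀ t, lconv (ηcomp η₂ t) a = lconv (ηcomp η t) a + ∑ m, k m • lconv (fcomp f t m) a -
        k t • a := by
      intro t
      rw [← lconvHom_apply, hηc, map_sub, map_add, map_sum, map_smul]
      simp only [map_smul, lconvHom_apply]
      rw [lconv_eq Coalgebra.counit, sliceRight_counit]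
    simp only [map_sub, map_sum, map_mul] at h1
    -- The terms that `f` adds to `η₂` cancel against those of `Λ k` in `p₂` by the relation between
    -- `Λ` and `f`.
    have h5 : ∑ t, ∑ m, k m • (ι (Λ s t) * ι (lconv (fcomp f t m) a)) =
        ∑ t, ∑ m, k m • (ι (rconv a (fcomp f s t)) * ι (Λ t m)) := by
      rw [Finset.sum_comm]
      simp only [← Finset.smul_sum, h2]
      simp only [Finset.smul_sum]
      rw [Finset.sum_comm]
    simp only [h3, h4, hp', map_sub, map_add, map_sum, map_mul, map_smul, mul_add, mul_sub, add_mul,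
      sub_mul, Finset.mul_sum, Finset.sum_mul, smul_mul_assoc, mul_smul_comm, one_mul, mul_one,
      Finset.sum_add_distrib, Finset.sum_sub_distrib, h1, h5]
    abel
  · intro a
    rw [← H.leading_terms a, hF]
    -- Quadratic expressions in `p₂` and in `p` have the same leading terms modulo `B¹`.
    have hdiff : ∑ x, ι (a x) * (p₂ x.1 * p₂ x.2) - ∑ x, ι (a x) * (p x.1 * p x.2) ∈
        filtOne ι p := by
      rw [← Finset.sum_sub_distrib]
      refine Submodule.sum_mem _ fun x _ => ?_
      rw [← mul_sub]
      refine mul_mem_filtOne ι p _ ?_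
      have : p₂ x.1 * p₂ x.2 - p x.1 * p x.2 =
          (p₂ x.1 - p x.1) * p₂ x.2 + p x.1 * (p₂ x.2 - p x.2) := by
        rw [sub_mul, mul_sub]; abel
      rw [this, hd, hd]
      refine add_mem (mul_mem_filtOne ι p _ ?_) (H.mul_mem _ (p_mem_filtOne ι p _) _)
      rw [← hF]
      exact p_mem_filtOne ι p₂ _
    rw [← sub_add_cancel (∑ x, ι (a x) * (p₂ x.1 * p₂ x.2)) (∑ x, ι (a x) * (p x.1 * p x.2))]
    exact Submodule.add_mem_iff_right _ hdiff
  · rw [hT, Matrix.mulVec_add, H.R_T, Matrix.mulVec_smul, Matrix.mulVec_mulVec, mul_sub, mul_one,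
      H.R_sq, ← neg_sub, Matrix.neg_mulVec]
    simp only [smul_neg, neg_add]
  · intro y
    rw [sum_quadratic_eq, H.quadratic_shift k hη hT hp]
    rfl

end IsInhomogeneousQuantumGroup

end Shift

end InhomQG

namespace InhomQG

/-! ### Transport along isomorphisms and change of basis -/

section TransportTotal

variable {A B B' I : Type*} [Ring A] [HopfAlgebra ℂ A] [Ring B] [Bialgebra ℂ B] [Ring B']
  [Bialgebra ℂ B'] [Fintype I] [DecidableEq I] {Λ : Matrix I I A} {ι : A →ₐc[ℂ] B} {p : I → B}
  {f : A →ₗ[ℂ] Matrix I I ℂ} {η : A →ₗ[ℂ] (I → ℂ)} {T : I × I → ℂ}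

theorem map_filtOne {A B B' I : Type*} [Ring A] [HopfAlgebra ℂ A] [Ring B] [Bialgebra ℂ B] [Ring B']
    [Bialgebra ℂ B'] {ι : A →ₐc[ℂ] B} {p : I → B} {φ : B ≃ₐc[ℂ] B'} {ι' : A →ₐc[ℂ] B'}
    (hι : ∀ a, ι' a = φ (ι a)) {x : B} :
    φ x ∈ filtOne ι' (fun i => φ (p i)) ↔ x ∈ filtOne ι p := by
  have key : filtOne ι' (fun i => φ (p i)) = (filtOne ι p).map (φ : B →ₗ[ℂ] B') := by
    rw [filtOne, filtOne, Submodule.map_span, Set.image_union]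
    congr 2
    · ext x
      constructor
      · rintro ⟨a, rfl⟩
        exact ⟨ι a, ⟨a, rfl⟩, (hι a).symm⟩
      · rintro ⟨_, ⟨a, rfl⟩, rfl⟩
        exact ⟨a, hι a⟩
    · ext x
      constructor
      · rintro ⟨a, i, rfl⟩
        refine ⟨ι a * p i, ⟨a, i, rfl⟩, ?_⟩
        rw [hι]
        exact map_mul φ _ _
      · rintro ⟨_, ⟨a, i, rfl⟩, rfl⟩
        refine ⟨a, i, ?_⟩
        rw [hι]
        exact map_mul φ _ _
  rw [key]
  constructor
  · rintro ⟨y, hy, hxy⟩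
    have : y = x := φ.injective hxy
    rwa [← this]
  · exact fun hx => ⟨x, hx, rfl⟩

theorem IsInhomogeneousQuantumGroup.congr_total (H : IsInhomogeneousQuantumGroup Λ ι p f η T)
    (φ : B ≃ₐc[ℂ] B') {ι' : A →ₐc[ℂ] B'} (hι : ∀ a, ι' a = φ (ι a)) :
    IsInhomogeneousQuantumGroup Λ ι' (fun i => φ (p i)) f η T := by
  refine
    { homogeneousPart := H.homogeneousPart
      generated := ?_
      injective := ?_
      rep := ?_
      exists_notMem := ?_
      mul_mem := ?_
      f_one := H.f_one
      f_mul := H.f_mul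
      η_one := H.η_one
      η_mul := H.η_mul
      Λ_f := H.Λ_f
      p_mul := ?_
      R_sq := H.R_sq
      leading_terms := ?_
      R_T := H.R_T
      quadratic := ?_ }
  · have h1 : Set.range ι' ∪ Set.range (fun i => φ (p i)) =
        ((φ : B →ₐc[ℂ] B') : B →ₐ[ℂ] B') '' (Set.range ι ∪ Set.range p) := by
      rw [Set.image_union, ← Set.range_comp, ← Set.range_comp]
      congr 2
      funext a
      exact hι a
    rw [h1, ← AlgHom.map_adjoin, H.generated, Algebra.map_top, AlgHom.range_eq_top]
    exact φ.surjective
  · intro a b hab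
    rw [hι, hι] at hab
    exact H.injective (φ.injective hab)
  · convert H.rep.map (φ : B →ₐc[ℂ] B') using 1
    ext (i | i) (j | j)
    · simp [hι]
    · simp
    · simp
    · simp
  · obtain ⟨i, hi⟩ := H.exists_notMem
    refine ⟨i, fun ⟨a, ha⟩ => hi ⟨a, φ.injective ?_⟩⟩
    rw [hι] at ha
    exact ha
  · intro x hx a
    obtain ⟨y, rfl⟩ := φ.surjective x
    have h := H.mul_mem y ((map_filtOne hι).1 hx) a
    have h2 := (map_filtOne hι).2 h
    rw [hι]
    rwa [map_mul] at h2
  · intro a s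
    simp only [hι, ← map_mul, ← map_sum, ← map_add, H.p_mul]
  · intro a
    rw [← H.leading_terms a, ← map_filtOne hι]
    simp only [hι, map_sum, map_mul]
  · intro y
    have h := congrArg φ (H.quadratic y)
    simpa only [map_sum, map_smul, map_sub, map_add, map_mul, map_one, map_zero, ← hι] using h

end TransportTotal

/-! ### Change of basis and of the homogeneous part. -/

section ChangeBasis

/-- A complex matrix as a matrix over an algebra. -/
abbrev scal (B : Type*) [Ring B] [Algebra ℂ B] {n m : Type*} (N : Matrix n m ℂ) : Matrix n m B :=
  N.map (algebraMap ℂ B)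

theorem scal_mul (B : Type*) [Ring B] [Algebra ℂ B] {n m l : Type*} [Fintype m] (N : Matrix n m ℂ)
    (N' : Matrix m l ℂ) : scal B (N * N') = scal B N * scal B N' :=
  Matrix.map_mul

theorem scal_one (B : Type*) [Ring B] [Algebra ℂ B] {n : Type*} [DecidableEq n] :
    scal B (1 : Matrix n n ℂ) = 1 := by
  simp [scal, Matrix.map_one]

theorem scal_mulVec {B : Type*} [Ring B] [Algebra ℂ B] {n m : Type*} [Fintype m] (N : Matrix n m ℂ)
    (Q : m → B) : (scal B N).mulVec Q = act N Q := by
  funext y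
  simp [Matrix.mulVec, dotProduct, act_apply, Algebra.smul_def]

theorem scal_conj_apply {B : Type*} [Ring B] [Algebra ℂ B] {n m : Type*} [Fintype n] [Fintype m]
    (P : Matrix m n ℂ) (X : Matrix n n B) (N : Matrix n m ℂ) (s t : m) :
    (scal B P * X * scal B N) s t = ∑ u, ∑ v, (P s u * N v t) • X u v := by
  simp only [Matrix.mul_apply, Matrix.map_apply, Finset.sum_mul]
  rw [Finset.sum_comm]
  refine Finset.sum_congr rfl fun u _ => Finset.sum_congr rfl fun v _ => ?_
  rw [← Algebra.commutes, ← mul_assoc, ← map_mul, mul_comm, Algebra.smul_def, mul_comm]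

/-- The entrywise tensor square `X_{ik} Y_{jl}`. -/
def entrywise {B I : Type*} [Mul B] (X Y : Matrix I I B) : Matrix (I × I) (I × I) B :=
  fun x z => X x.1 z.1 * Y x.2 z.2

/-- The entries of `X` and `Y` need not commute, but the scalars are central and can be moved to the
front. -/
theorem entrywise_scal_mul {B I : Type*} [Ring B] [Algebra ℂ B] [Fintype I] (P : Matrix I I ℂ)
    (X Y : Matrix I I B) :
    entrywise (scal B P * X) (scal B P * Y) = scal B (P ⊗ₖ P) * entrywise X Y := by
  ext x z
  simp only [entrywise, Matrix.mul_apply, Matrix.map_apply, Fintype.sum_prod_type,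
    Finset.sum_mul_sum, Matrix.kroneckerMap_apply, map_mul]
  refine Finset.sum_congr rfl fun u _ => Finset.sum_congr rfl fun v _ => ?_
  rw [mul_assoc, ← mul_assoc (X u z.1), ← Algebra.commutes, mul_assoc, mul_assoc]

theorem entrywise_mul_scal {B I : Type*} [Ring B] [Algebra ℂ B] [Fintype I] (P : Matrix I I ℂ)
    (X Y : Matrix I I B) :
    entrywise (X * scal B P) (Y * scal B P) = entrywise X Y * scal B (P ⊗ₖ P) := by
  ext x z
  simp only [entrywise, Matrix.mul_apply, Matrix.map_apply, Fintype.sum_prod_type,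
    Finset.sum_mul_sum, Matrix.kroneckerMap_apply, map_mul]
  refine Finset.sum_congr rfl fun u _ => Finset.sum_congr rfl fun v _ => ?_
  rw [mul_assoc, ← mul_assoc _ (Y x.2 v), Algebra.commutes, mul_assoc, mul_assoc]

theorem col_eq {B n m : Type*} [Ring B] [Algebra ℂ B] [Fintype n] (v : Matrix m n B) (t : n → ℂ) :
    col v t = v.mulVec (cst B t) := by
  funext x
  simp [col_apply, Matrix.mulVec, dotProduct, cst_apply]

variable {A A' B I : Type*} [Ring A] [HopfAlgebra ℂ A] [Ring A'] [HopfAlgebra ℂ A']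
  [Ring B] [Bialgebra ℂ B] [Fintype I] [DecidableEq I] {Λ : Matrix I I A} {ι : A →ₐc[ℂ] B}
  {p : I → B} {f : A →ₗ[ℂ] Matrix I I ℂ} {η : A →ₗ[ℂ] (I → ℂ)} {T : I × I → ℂ}

theorem rconv_equiv {A A' : Type*} [Ring A] [Bialgebra ℂ A] [Ring A'] [Bialgebra ℂ A']
    (φ : A ≃ₐc[ℂ] A') (a : A) (ρ : A' →ₗ[ℂ] ℂ) :
    rconv (φ a) ρ = φ (rconv a (ρ ∘ₗ (φ : A →ₗ[ℂ] A'))) := by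
  rw [rconv_eq, rconv_eq, ← CoalgHomClass.map_comp_comul_apply]
  generalize Coalgebra.comul (R := ℂ) a = z
  induction z with
  | zero => simp
  | tmul x y => simp
  | add x y hx hy => simp only [map_add, hx, hy]

theorem lconv_equiv {A A' : Type*} [Ring A] [Bialgebra ℂ A] [Ring A'] [Bialgebra ℂ A']
    (φ : A ≃ₐc[ℂ] A') (a : A) (ρ : A' →ₗ[ℂ] ℂ) :
    lconv ρ (φ a) = φ (lconv (ρ ∘ₗ (φ : A →ₗ[ℂ] A')) a) := by
  rw [lconv_eq, lconv_eq, ← CoalgHomClass.map_comp_comul_apply]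
  generalize Coalgebra.comul (R := ℂ) a = z
  induction z with
  | zero => simp
  | tmul x y => simp
  | add x y hx hy => simp only [map_add, hx, hy]

/-- In `f_im (Λ_js)` the indices `i, j` are row indices of `f` and `Λ` and acquire `P`, while `m, s`
are column indices and acquire `N`. -/
theorem Rmat_change {A A' I : Type*} [Ring A] [HopfAlgebra ℂ A] [Ring A'] [HopfAlgebra ℂ A']
    [Fintype I] {Λ : Matrix I I A} {f : A →ₗ[ℂ] Matrix I I ℂ} {φ : A ≃ₐc[ℂ] A'} {N P : Matrix I I ℂ} {Λ' : Matrix I I A'}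
    (hΛ : Λ' = scal A' P * Λ.map φ * scal A' N) {f' : A' →ₗ[ℂ] Matrix I I ℂ}
    (hf : ∀ a, f' (φ a) = P * f a * N) :
    Rmat Λ' f' = (P ⊗ₖ P) * Rmat Λ f * (N ⊗ₖ N) := by
  ext ⟨i, j⟩ ⟨s, m⟩
  change f' (Λ' j s) i m = _
  rw [hΛ, scal_conj_apply]
  simp only [map_sum, map_smul, Matrix.map_apply, hf, Matrix.sum_apply, Matrix.smul_apply,
    Matrix.mul_apply, Fintype.sum_prod_type, Matrix.kroneckerMap_apply, Finset.sum_mul,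
    Finset.mul_sum, smul_eq_mul]
  simp only [Rmat]
  rw [Finset.sum_comm]
  refine Finset.sum_congr rfl fun y _ => ?_
  rw [Finset.sum_comm]
  refine Finset.sum_congr rfl fun v _ => ?_
  rw [Finset.sum_comm]
  refine Finset.sum_congr rfl fun u _ => Finset.sum_congr rfl fun x _ => ?_
  ring

theorem Zmat_change {A A' I : Type*} [Ring A] [HopfAlgebra ℂ A] [Ring A'] [HopfAlgebra ℂ A']
    [Fintype I] {Λ : Matrix I I A} {η : A →ₗ[ℂ] (I → ℂ)} {φ : A ≃ₐc[ℂ] A'} {N P : Matrix I I ℂ} {Λ' : Matrix I I A'}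
    (hΛ : Λ' = scal A' P * Λ.map φ * scal A' N) {η' : A' →ₗ[ℂ] (I → ℂ)}
    (hη : ∀ a, η' (φ a) = P.mulVec (η a)) :
    Zmat Λ' η' = (P ⊗ₖ P) * Zmat Λ η * N := by
  ext ⟨i, j⟩ m
  change η' (Λ' j m) i = _
  rw [hΛ, scal_conj_apply]
  simp only [map_sum, map_smul, Matrix.map_apply, hη, Finset.sum_apply, Pi.smul_apply,
    Matrix.mul_apply, Fintype.sum_prod_type, Matrix.kroneckerMap_apply, Finset.sum_mul,
    Finset.mul_sum, smul_eq_mul, Matrix.mulVec, dotProduct]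
  simp only [Zmat]
  rw [Finset.sum_comm]
  refine Finset.sum_congr rfl fun y _ => ?_
  rw [Finset.sum_comm]
  refine Finset.sum_congr rfl fun u _ => Finset.sum_congr rfl fun x _ => ?_
  ring

/-- The change of basis `p ↦ N⁻¹ p`, together with an isomorphism of the homogeneous parts. -/
theorem IsInhomogeneousQuantumGroup.change_basis (H : IsInhomogeneousQuantumGroup Λ ι p f η T)
    {φ : A ≃ₐc[ℂ] A'} {ι' : A' →ₐc[ℂ] B} (hι : ∀ a, ι' (φ a) = ι a) {N P : Matrix I I ℂ}
    (hNP : N * P = 1) {Λ' : Matrix I I A'} (hΛ' : IsHomogeneousPart Λ')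
    (hΛ : Λ' = scal A' P * Λ.map φ * scal A' N)
    {p' : I → B} (hp : p' = act P p)
    {f' : A' →ₗ[ℂ] Matrix I I ℂ} (hf : ∀ a, f' (φ a) = P * f a * N)
    {η' : A' →ₗ[ℂ] (I → ℂ)} (hη : ∀ a, η' (φ a) = P.mulVec (η a))
    {T' : I × I → ℂ} (hT : T' = (P ⊗ₖ P).mulVec T) :
    IsInhomogeneousQuantumGroup Λ' ι' p' f' η' T' := by
  have hsurj : ∀ b, ∃ a, φ a = b := fun b => ⟨φ.symm b, φ.apply_symm_apply b⟩
  have hPN : P * N = 1 := mul_eq_one_comm.1 hNP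
  have hp2 : p = act N p' := by rw [hp, act_act, hNP, act_one]
  have hPN2 : (P ⊗ₖ P) * (N ⊗ₖ N) = 1 := by
    rw [← Matrix.mul_kronecker_mul, hPN, Matrix.one_kronecker_one]
  have hNP2 : (N ⊗ₖ N) * (P ⊗ₖ P) = 1 := by
    rw [← Matrix.mul_kronecker_mul, hNP, Matrix.one_kronecker_one]
  have hR := Rmat_change hΛ hf
  have hZ := Zmat_change hΛ hη
  have hrange : Set.range ι' = Set.range ι := by
    ext x
    constructor
    · rintro ⟨a, rfl⟩
      exact ⟨φ.symm a, by rw [← hι, BialgEquiv.apply_symm_apply]⟩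
    · rintro ⟨a, rfl⟩
      exact ⟨φ a, hι a⟩
  have hNPB : scal B N * scal B P = 1 := by rw [← scal_mul, hNP, scal_one]
  have hΛB : Λ'.map ι' = scal B P * Λ.map ι * scal B N := by
    ext i j
    rw [Matrix.map_apply, hΛ, scal_conj_apply, scal_conj_apply]
    simp only [map_sum, map_smul, Matrix.map_apply, hι]
  have hinj : Function.Injective ι' := by
    intro a b hab
    obtain ⟨a, rfl⟩ := hsurj a
    obtain ⟨b, rfl⟩ := hsurj b
    rw [hι, hι] at hab
    rw [H.injective hab]
  have hF : filtOne ι' p' = filtOne ι p := by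
    apply le_antisymm
    · refine Submodule.span_le.2 ?_
      have hp'F : ∀ i, p' i ∈ filtOne ι p := fun i => by
        rw [hp, act_apply]
        exact Submodule.sum_mem _ fun j _ => Submodule.smul_mem _ _ (p_mem_filtOne ι p j)
      rintro x (hx | ⟨a, i, rfl⟩)
      · rw [hrange] at hx
        obtain ⟨a, rfl⟩ := hx
        exact map_mem_filtOne ι p a
      · obtain ⟨a, rfl⟩ := hsurj a
        rw [hι]
        exact mul_mem_filtOne ι p a (hp'F i)
    · refine Submodule.span_le.2 ?_
      have hpF : ∀ i, p i ∈ filtOne ι' p' := fun i => by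
        rw [hp2, act_apply]
        exact Submodule.sum_mem _ fun j _ => Submodule.smul_mem _ _ (p_mem_filtOne ι' p' j)
      rintro x (⟨a, rfl⟩ | ⟨a, i, rfl⟩)
      · rw [← hι]
        exact map_mem_filtOne ι' p' _
      · rw [← hι]
        exact mul_mem_filtOne ι' p' _ (hpF i)
  have hfc : ∀ s t, fcomp f' s t ∘ₗ (φ : A →ₗ[ℂ] A') =
      ∑ u, ∑ v, (P s u * N v t) • fcomp f u v := by
    intro s t
    ext a
    change f' (φ a) s t = _
    rw [hf]
    simp only [Matrix.mul_apply, Finset.sum_mul, LinearMap.sum_apply, LinearMap.smul_apply,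
      smul_eq_mul]
    rw [Finset.sum_comm]
    refine Finset.sum_congr rfl fun u _ => Finset.sum_congr rfl fun v _ => ?_
    rw [mul_right_comm]
    rfl
  have hηc : ∀ s, ηcomp η' s ∘ₗ (φ : A →ₗ[ℂ] A') = ∑ u, P s u • ηcomp η u := by
    intro s
    ext a
    change η' (φ a) s = _
    rw [hη]
    simp only [Matrix.mulVec, dotProduct, LinearMap.sum_apply, LinearMap.smul_apply, smul_eq_mul]
    rfl
  have hr : ∀ a, (Matrix.of fun s t => ι' (rconv (φ a) (fcomp f' s t))) =
      scal B P * (Matrix.of fun s t => ι (rconv a (fcomp f s t))) * scal B N := by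
    intro a
    ext s t
    rw [Matrix.of_apply, rconv_equiv, hι, hfc, scal_conj_apply, ← rconvHom_apply]
    simp only [map_sum, map_smul, rconvHom_apply, Matrix.of_apply]
  have hl : ∀ a, (Matrix.of fun s t => ι' (lconv (fcomp f' s t) (φ a))) =
      scal B P * (Matrix.of fun s t => ι (lconv (fcomp f s t) a)) * scal B N := by
    intro a
    ext s t
    rw [Matrix.of_apply, lconv_equiv, hι, hfc, scal_conj_apply, ← lconvHom_apply]
    simp only [map_sum, map_smul, lconvHom_apply, Matrix.of_apply]
  have hre : ∀ a, (fun s => ι' (rconv (φ a) (ηcomp η' s))) =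
      act P (fun s => ι (rconv a (ηcomp η s))) := by
    intro a
    funext s
    rw [rconv_equiv, hι, hηc, ← rconvHom_apply]
    simp only [map_sum, map_smul, rconvHom_apply, act_apply]
  have hle : ∀ a, (fun s => ι' (lconv (ηcomp η' s) (φ a))) =
      act P (fun s => ι (lconv (ηcomp η s) a)) := by
    intro a
    funext s
    rw [lconv_equiv, hι, hηc, ← lconvHom_apply]
    simp only [map_sum, map_smul, lconvHom_apply, act_apply]
  have hpp : (fun x : I × I => p' x.1 * p' x.2) = act (P ⊗ₖ P) (fun x => p x.1 * p x.2) := by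
    funext x
    rw [hp]
    simp only [act_apply, Finset.sum_mul_sum, Fintype.sum_prod_type, Matrix.kroneckerMap_apply,
      smul_mul_smul_comm]
  have hconj : ∀ X Y : Matrix (I × I) (I × I) ℂ,
      (P ⊗ₖ P) * X * (N ⊗ₖ N) * ((P ⊗ₖ P) * Y) = (P ⊗ₖ P) * (X * Y) := by
    intro X Y
    rw [mul_assoc, ← mul_assoc (N ⊗ₖ N), hNP2, one_mul, mul_assoc]
  refine
    { homogeneousPart := hΛ'
      generated := ?_
      injective := hinj
      rep := ?_
      exists_notMem := ?_
      mul_mem := ?_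
      f_one := ?_
      f_mul := ?_
      η_one := ?_
      η_mul := ?_
      Λ_f := ?_
      p_mul := ?_
      R_sq := ?_
      leading_terms := ?_
      R_T := ?_
      quadratic := ?_ }
  · rw [eq_top_iff, ← H.generated, hrange]
    refine Algebra.adjoin_le ?_
    rintro x (hx | ⟨i, rfl⟩)
    · exact Algebra.subset_adjoin (Or.inl hx)
    · rw [hp2, act_apply]
      refine Subalgebra.sum_mem _ fun j _ => Subalgebra.smul_mem _ ?_ _
      exact Algebra.subset_adjoin (Or.inr ⟨j, rfl⟩)
  · have hrepA : IsRep (Λ'.map ι') := hΛ'.irreducible.1.map ι'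
    constructor
    · rintro (i | i) (j | j)
      · simpa using hrepA.1 i j
      · have h1 : ∀ k, p k = ∑ j, N k j • p' j := fun k => congrFun hp2 k
        have h2 : ∀ i j, ι' (Λ' i j) = ∑ u, ∑ v, (P i u * N v j) • ι (Λ u v) := by
          intro i j
          rw [← Matrix.map_apply (f := ι'), hΛB, scal_conj_apply]
          rfl
        simp only [Matrix.fromBlocks_apply₁₂, Matrix.of_apply, Fintype.sum_sum_type,
          Matrix.fromBlocks_apply₁₁, Matrix.fromBlocks_apply₂₂, Matrix.map_apply,
          Finset.univ_unique, Finset.sum_singleton, Matrix.one_apply_eq]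
        have h3 : Coalgebra.comul (R := ℂ) (p' i) = ∑ u, P i u •
            (∑ v, ι (Λ u v) ⊗ₜ[ℂ] p v + p u ⊗ₜ[ℂ] 1) := by
          rw [hp, act_apply, map_sum]
          simp only [map_smul, H.comul_p]
        rw [h3]
        simp only [smul_add, Finset.sum_add_distrib]
        congr 1
        · simp only [h2, TensorProduct.sum_tmul]
          rw [Finset.sum_comm]
          refine Finset.sum_congr rfl fun u _ => ?_
          rw [Finset.sum_comm, Finset.smul_sum]
          refine Finset.sum_congr rfl fun v _ => ?_
          rw [h1 v, TensorProduct.tmul_sum, Finset.smul_sum]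
          refine Finset.sum_congr rfl fun j _ => ?_
          rw [TensorProduct.tmul_smul, smul_smul, TensorProduct.smul_tmul']
        · rw [hp, act_apply, TensorProduct.sum_tmul]
          simp only [TensorProduct.smul_tmul']
      · simp
      · simp [Algebra.TensorProduct.one_def]
    · rintro (i | i) (j | j)
      · simpa using hrepA.2 i j
      · simp [hp, act_apply, H.counit_p]
      · simp
      · simp
  · by_contra hcon
    push Not at hcon
    obtain ⟨i, hi⟩ := H.exists_notMem
    apply hi
    change p i ∈ imA ι
    rw [hp2, act_apply]
    refine Submodule.sum_mem _ fun j _ => Submodule.smul_mem _ _ ?_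
    have := hcon j
    rw [hrange] at this
    exact this
  · intro x hx a
    rw [hF] at hx ⊢
    obtain ⟨a, rfl⟩ := hsurj a
    rw [hι]
    exact H.mul_mem x hx a
  · rw [← map_one φ, hf, H.f_one, mul_one, hPN]
  · intro a b
    obtain ⟨a, rfl⟩ := hsurj a
    obtain ⟨b, rfl⟩ := hsurj b
    rw [← map_mul, hf, hf, hf, H.f_mul]
    simp only [mul_assoc]
    rw [← mul_assoc N P, hNP, one_mul]
  · rw [← map_one φ, hη, H.η_one, Matrix.mulVec_zero]
  · intro a b
    obtain ⟨a, rfl⟩ := hsurj a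
    obtain ⟨b, rfl⟩ := hsurj b
    rw [← map_mul, hη, hη, hη, hf, H.η_mul, CoalgHomClass.counit_comp_apply, Matrix.mulVec_add,
      Matrix.mulVec_smul, Matrix.mulVec_mulVec, Matrix.mulVec_mulVec, mul_assoc, hNP, mul_one]
  · intro a s r
    obtain ⟨a, rfl⟩ := hsurj a
    apply hinj
    have h1 : Λ.map ι * (Matrix.of fun s t => ι (lconv (fcomp f s t) a)) =
        (Matrix.of fun s t => ι (rconv a (fcomp f s t))) * Λ.map ι := by
      ext s r
      simpa [Matrix.mul_apply] using congrArg ι (H.Λ_f a s r)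
    have h2 : Λ'.map ι' * (Matrix.of fun s t => ι' (lconv (fcomp f' s t) (φ a))) =
        (Matrix.of fun s t => ι' (rconv (φ a) (fcomp f' s t))) * Λ'.map ι' := by
      rw [hΛB, hl, hr]
      have h3 : ∀ X Y : Matrix I I B, scal B P * X * scal B N * (scal B P * Y * scal B N) =
          scal B P * (X * Y) * scal B N := by
        intro X Y
        simp only [mul_assoc]
        rw [← mul_assoc (scal B N) (scal B P), hNPB, one_mul]
      rw [h3, h3, h1]
    have h4 := congrFun (congrFun h2 s) r
    simpa [Matrix.mul_apply] using h4
  · intro a s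
    obtain ⟨a, rfl⟩ := hsurj a
    have h1 : (fun u => p u * ι a) = (Matrix.of fun s t => ι (rconv a (fcomp f s t))).mulVec p +
        ((fun s => ι (rconv a (ηcomp η s))) -
          (Λ.map ι).mulVec (fun s => ι (lconv (ηcomp η s) a))) := by
      funext u
      simpa [Matrix.mulVec, dotProduct] using H.p_mul a u
    have h2 : (fun u => p' u * ι' (φ a)) =
        (Matrix.of fun s t => ι' (rconv (φ a) (fcomp f' s t))).mulVec p' +
        ((fun s => ι' (rconv (φ a) (ηcomp η' s))) -
          (Λ'.map ι').mulVec (fun s => ι' (lconv (ηcomp η' s) (φ a)))) := by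
      have h3 : (fun u => p' u * ι' (φ a)) = act P (fun u => p u * ι a) := by
        funext u
        rw [hp, hι, act_apply, act_apply, Finset.sum_mul]
        simp only [smul_mul_assoc]
      have h4 : ∀ (X : Matrix I I B) (v : I → B), (scal B P * X * scal B N).mulVec (act P v) =
          act P (X.mulVec v) := by
        intro X v
        rw [← scal_mulVec, ← scal_mulVec, Matrix.mulVec_mulVec, Matrix.mulVec_mulVec,
          mul_assoc (scal B P * X), hNPB, mul_one]
      rw [h3, h1, hr, hre, hle, hΛB, hp, h4, h4, map_add, map_sub]
    have h5 := congrFun h2 s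
    simpa [Matrix.mulVec, dotProduct] using h5
  · have h1 : Rmat Λ' f' * Rmat Λ' f' = (P ⊗ₖ P) * Rmat Λ f * (N ⊗ₖ N) *
        ((P ⊗ₖ P) * (Rmat Λ f * (N ⊗ₖ N))) := by
      rw [hR, mul_assoc (P ⊗ₖ P) (Rmat Λ f)]
    rw [h1, hconj, ← mul_assoc (Rmat Λ f), H.R_sq, one_mul, hPN2]
  · intro a
    -- The coefficients `a (P ⊗ P)`, pulled back along `φ`: they express the same quadratic element
    -- in terms of the old `p_i`.
    choose b hb using fun y => hsurj (Matrix.vecMul a (scal A' (P ⊗ₖ P)) y)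
    have h1 : ∑ x, ι' (a x) * (p' x.1 * p' x.2) = ∑ y, ι (b y) * (p y.1 * p y.2) := by
      have h2 : ∀ x : I × I, p' x.1 * p' x.2 = ∑ y, (P ⊗ₖ P) x y • (p y.1 * p y.2) :=
        fun x => congrFun hpp x
      simp only [← hι, hb, h2, Matrix.vecMul, dotProduct, map_sum, map_mul, Matrix.map_apply,
        Finset.mul_sum, Finset.sum_mul]
      rw [Finset.sum_comm]
      refine Finset.sum_congr rfl fun y _ => Finset.sum_congr rfl fun x _ => ?_
      rw [Algebra.algebraMap_eq_smul_one, map_smul, map_one, mul_smul_comm, mul_smul_comm, mul_one,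
        smul_mul_assoc]
    have h3 : Matrix.vecMul (fun y => φ (b y)) (scal A' (Rmat Λ f + 1)) =
        fun y => φ (Matrix.vecMul b (scal A (Rmat Λ f + 1)) y) := by
      funext y
      simp only [Matrix.vecMul, dotProduct, map_sum, map_mul, Matrix.map_apply]
      refine Finset.sum_congr rfl fun x _ => ?_
      rw [Algebra.algebraMap_eq_smul_one, Algebra.algebraMap_eq_smul_one, map_smul, map_one]
    have h4 : scal A' (Rmat Λ' f' + 1) =
        scal A' (P ⊗ₖ P) * scal A' (Rmat Λ f + 1) * scal A' (N ⊗ₖ N) := by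
      rw [← scal_mul, ← scal_mul, hR, mul_add, add_mul, mul_one, hPN2]
    have h5 : scal A' (N ⊗ₖ N) * scal A' (P ⊗ₖ P) = 1 := by rw [← scal_mul, hNP2, scal_one]
    have h6 : Matrix.vecMul a (scal A' (P ⊗ₖ P)) = fun y => φ (b y) := by
      funext y
      exact (hb y).symm
    rw [h1, hF, H.leading_terms b]
    change _ ↔ Matrix.vecMul a (scal A' (Rmat Λ' f' + 1)) = 0
    rw [h4, ← Matrix.vecMul_vecMul, ← Matrix.vecMul_vecMul, h6, h3]
    constructor
    · intro h
      have : (fun y => φ (Matrix.vecMul b (scal A (Rmat Λ f + 1)) y)) = 0 := by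
        funext y
        rw [h, Pi.zero_apply, Pi.zero_apply, map_zero]
      rw [this, Matrix.zero_vecMul]
    · intro h
      have h7 := congrArg (fun v => Matrix.vecMul v (scal A' (P ⊗ₖ P))) h
      simp only [Matrix.vecMul_vecMul, h5, Matrix.vecMul_one, Matrix.zero_vecMul] at h7
      funext y
      apply φ.injective
      exact (congrFun h7 y).trans (map_zero φ).symm
  · rw [hR, hT, Matrix.mulVec_mulVec, mul_assoc, hNP2, mul_one, ← Matrix.mulVec_mulVec, H.R_T,
      Matrix.mulVec_neg]
  · intro y
    have hR1 : Rmat Λ' f' - 1 = (P ⊗ₖ P) * (Rmat Λ f - 1) * (N ⊗ₖ N) := by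
      rw [hR, mul_sub, sub_mul, mul_one, hPN2]
    have hlam : col (lamMat Λ' ι') T' = act (P ⊗ₖ P) (col (lamMat Λ ι) T) := by
      have h1 : lamMat Λ' ι' = entrywise (Λ'.map ι') (Λ'.map ι') := by
        ext x z
        exact map_mul ι' _ _
      have h2 : lamMat Λ ι = entrywise (Λ.map ι) (Λ.map ι) := by
        ext x z
        exact map_mul ι _ _
      rw [h1, hΛB, entrywise_mul_scal, entrywise_scal_mul, ← h2, col_eq, col_eq, hT, ← act_cst,
        ← scal_mulVec, ← scal_mulVec, Matrix.mulVec_mulVec, Matrix.mulVec_mulVec, mul_assoc,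
        ← scal_mul, hNP2, scal_one, mul_one]
    have hQ : (fun x => p' x.1 * p' x.2) - act (Zmat Λ' η') p' + cst B T' -
        col (lamMat Λ' ι') T' = act (P ⊗ₖ P) ((fun x => p x.1 * p x.2) - act (Zmat Λ η) p +
          cst B T - col (lamMat Λ ι) T) := by
      rw [map_sub, map_add, map_sub, hlam, hpp, hZ, ← act_act, ← hp2, ← act_act, act_cst, hT]
    have h0 : act (Rmat Λ f - 1) ((fun x => p x.1 * p x.2) - act (Zmat Λ η) p + cst B T -
        col (lamMat Λ ι) T) = 0 := by
      funext y
      exact (sum_quadratic_eq Λ ι p f η T y).symm.trans (H.quadratic y)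
    rw [sum_quadratic_eq, hQ, hR1, act_act, mul_assoc, hNP2, mul_one, ← act_act, h0, map_zero]
    rfl

end ChangeBasis

end InhomQG

namespace InhomQG

/-! ### Transport of the data along an isomorphism. -/

section Transport

variable {A A' B B' I : Type*} [Ring A] [HopfAlgebra ℂ A] [Ring A'] [HopfAlgebra ℂ A']
  [Ring B] [Bialgebra ℂ B] [Ring B'] [Bialgebra ℂ B'] [Fintype I] [DecidableEq I]
  {Λ : Matrix I I A} {ι : A →ₐc[ℂ] B} {p : I → B}
  {f : A →ₗ[ℂ] Matrix I I ℂ} {η : A →ₗ[ℂ] (I → ℂ)} {T : I × I → ℂ}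
  {Λ' : Matrix I I A'} {ι' : A' →ₐc[ℂ] B'} {p' : I → B'}
  {f' : A' →ₗ[ℂ] Matrix I I ℂ} {η' : A' →ₗ[ℂ] (I → ℂ)} {T' : I × I → ℂ}

theorem eq_conj {A A' I : Type*} [Ring A] [HopfAlgebra ℂ A] [Ring A'] [HopfAlgebra ℂ A']
    [Fintype I] [DecidableEq I] {Λ : Matrix I I A} {Λ' : Matrix I I A'} {φA : A ≃ₐc[ℂ] A'}
    {M : Matrix I I ℂ} (hM : IsUnit M)
    (hΛ : Λ.map φA = scal A' M * Λ' * scal A' M⁻¹) :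
    Λ' = scal A' M⁻¹ * Λ.map φA * scal A' M := by
  have h1 : M⁻¹ * M = 1 := Matrix.nonsing_inv_mul _ ((Matrix.isUnit_iff_isUnit_det M).1 hM)
  have h2 : scal A' M⁻¹ * scal A' M = 1 := by rw [← scal_mul, h1, scal_one]
  rw [hΛ]
  simp only [mul_assoc]
  rw [h2, mul_one, ← mul_assoc, h2, one_mul]

/-- Conjugating `1 - R` by `M ⊗ M` pulls the prefactor out of both terms. What remains is the `T` of
the translation by `M h`, before the change of basis by `c M`. -/
theorem hatT_eq (M : Matrix I I ℂ) (hM : IsUnit M) (c : ℂ) (h : I → ℂ)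
    (R : Matrix (I × I) (I × I) ℂ) (Z : Matrix (I × I) I ℂ) (T : I × I → ℂ) :
    hatT M c h R Z T = ((c⁻¹ • M⁻¹) ⊗ₖ (c⁻¹ • M⁻¹)).mulVec (T + (1 / 2 : ℂ) • (1 - R).mulVec
      (-Z.mulVec (M.mulVec h) + fun x => M.mulVec h x.1 * M.mulVec h x.2)) := by
  have h1 : M⁻¹ * M = 1 := Matrix.nonsing_inv_mul _ ((Matrix.isUnit_iff_isUnit_det M).1 hM)
  have h2 : M * M⁻¹ = 1 := Matrix.mul_nonsing_inv _ ((Matrix.isUnit_iff_isUnit_det M).1 hM)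
  have h3 : (M⁻¹ ⊗ₖ M⁻¹) * (M ⊗ₖ M) = 1 := by
    rw [← Matrix.mul_kronecker_mul, h1, Matrix.one_kronecker_one]
  have h4 : (M ⊗ₖ M) * (M⁻¹ ⊗ₖ M⁻¹) = 1 := by
    rw [← Matrix.mul_kronecker_mul, h2, Matrix.one_kronecker_one]
  have h5 : 1 - hatR M R = (M⁻¹ ⊗ₖ M⁻¹) * (1 - R) * (M ⊗ₖ M) := by
    rw [hatR, mul_sub, sub_mul, mul_one, h3]
  have h6 : (M ⊗ₖ M).mulVec (fun x => h x.1 * h x.2) =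
      fun x => M.mulVec h x.1 * M.mulVec h x.2 := by
    funext x
    simp only [Matrix.mulVec, dotProduct, Matrix.kroneckerMap_apply, Fintype.sum_prod_type,
      Finset.sum_mul_sum]
    refine Finset.sum_congr rfl fun i _ => Finset.sum_congr rfl fun j _ => ?_
    ring
  have h7 : (M ⊗ₖ M).mulVec (-((M⁻¹ ⊗ₖ M⁻¹) * Z * M).mulVec h + fun x => h x.1 * h x.2) =
      -Z.mulVec (M.mulVec h) + fun x => M.mulVec h x.1 * M.mulVec h x.2 := by
    rw [Matrix.mulVec_add, h6, Matrix.mulVec_neg, Matrix.mulVec_mulVec, ← Matrix.mul_assoc,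
      ← Matrix.mul_assoc, h4, Matrix.one_mul, Matrix.mulVec_mulVec]
  rw [hatT, h5, ← h7, Matrix.smul_kronecker, Matrix.kronecker_smul, smul_smul]
  generalize -((M⁻¹ ⊗ₖ M⁻¹) * Z * M).mulVec h + (fun x : I × I => h x.1 * h x.2) = v
  rw [Matrix.smul_mulVec, Matrix.mulVec_add, Matrix.mulVec_smul, smul_add, smul_smul,
    Matrix.mulVec_mulVec, Matrix.mulVec_mulVec, mul_assoc (M⁻¹ ⊗ₖ M⁻¹)]
  congr 2
  · ring
  · ring

theorem act_invertible {B I : Type*} [Ring B] [Algebra ℂ B] [Fintype I] [DecidableEq I]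
    {M : Matrix I I ℂ} (hM : IsUnit M) (Q : I → B) :
    act M (act M⁻¹ Q) = Q ∧ act M⁻¹ (act M Q) = Q := by
  have hdet := (Matrix.isUnit_iff_isUnit_det M).1 hM
  constructor
  · rw [act_act, Matrix.mul_nonsing_inv _ hdet, act_one]
  · rw [act_act, Matrix.nonsing_inv_mul _ hdet, act_one]

namespace IsInhomogeneousQuantumGroup

/-- No data other than the homogeneous part are assumed on the target. This lets the same result
serve the comparison of two given groups and the construction of a new one. -/
theorem transport (H : IsInhomogeneousQuantumGroup Λ ι p f η T) (hΛ' : IsHomogeneousPart Λ')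
    (φ : B ≃ₐc[ℂ] B') (φA : A ≃ₐc[ℂ] A') (hφ : ∀ a, ι' (φA a) = φ (ι a))
    {M : Matrix I I ℂ} (hM : IsUnit M) (hΛ : Λ.map φA = scal A' M * Λ' * scal A' M⁻¹)
    {c : ℂ} (hc : c ≠ 0) (h : I → ℂ)
    (hp : (fun i => φ (p i)) = act M (c • p' + cst B' h - col (Λ'.map ι') h)) :
    ∃ (f' : A' →ₗ[ℂ] Matrix I I ℂ) (η' : A' →ₗ[ℂ] (I → ℂ)),
      (∀ b, f' b = M⁻¹ * f (φA.symm b) * M) ∧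
      (∀ b, η' b = hatη M c h (f (φA.symm b)) (η (φA.symm b)) (Coalgebra.counit (R := ℂ) b)) ∧
      Rmat Λ' f' = hatR M (Rmat Λ f) ∧
      IsInhomogeneousQuantumGroup Λ' ι' p' f' η' (hatT M c h (Rmat Λ f) (Zmat Λ η) T) := by
  have hdet := (Matrix.isUnit_iff_isUnit_det M).1 hM
  have h0 : Λ' = scal A' M⁻¹ * Λ.map φA * scal A' M := eq_conj hM hΛ
  let k := M.mulVec h
  let η₂ : A →ₗ[ℂ] (I → ℂ) :=
    { toFun := fun a => η a + (f a).mulVec k - Coalgebra.counit (R := ℂ) a • k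
      map_add' := fun a b => by
        simp only [map_add, Matrix.add_mulVec, add_smul]
        abel
      map_smul' := fun s a => by
        simp only [map_smul, Matrix.smul_mulVec, smul_sub, smul_add, smul_assoc, RingHom.id_apply] }
  have hη₂ : ∀ a, η₂ a = η a + (f a).mulVec k - Coalgebra.counit (R := ℂ) a • k := fun _ => rfl
  let f'' : A' →ₗ[ℂ] Matrix I I ℂ :=
    { toFun := fun b => M⁻¹ * f (φA.symm b) * M
      map_add' := fun a b => by simp only [map_add, mul_add, add_mul]
      map_smul' := fun s a => by
        simp only [map_smul, mul_smul_comm, smul_mul_assoc, RingHom.id_apply] }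
  let η'' : A' →ₗ[ℂ] (I → ℂ) :=
    (c⁻¹ • M⁻¹).mulVecLin ∘ₗ η₂ ∘ₗ (φA.symm : A' →ₗ[ℂ] A)
  have hf'' : ∀ a, f'' (φA a) = M⁻¹ * f a * M := fun a => by
    change M⁻¹ * f (φA.symm (φA a)) * M = _
    rw [BialgEquiv.symm_apply_apply]
  have hη'' : ∀ a, η'' (φA a) = (c⁻¹ • M⁻¹).mulVec (η₂ a) := fun a => by
    change (c⁻¹ • M⁻¹).mulVec (η₂ (φA.symm (φA a))) = _
    rw [BialgEquiv.symm_apply_apply]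
  refine ⟨f'', η'', fun b => rfl, fun b => ?_, Rmat_change h0 hf'', ?_⟩
  · change (c⁻¹ • M⁻¹).mulVec (η₂ (φA.symm b)) = _
    rw [hη₂, CoalgHomClass.counit_comp_apply, hatη, Matrix.smul_mulVec, one_div]
  · have H1 := H.shift k (η₂ := η₂) hη₂ rfl rfl
    let ι₂ : A →ₐc[ℂ] B' := (φ : B →ₐc[ℂ] B').comp ι
    have H2 := H1.congr_total φ (ι' := ι₂) fun a => rfl
    -- The scalar `c` cancels in the conjugations of `Λ` and `f`, and survives as `c⁻¹` in `η` and
    -- `c⁻²` in `T`.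
    refine H2.change_basis (φ := φA) hφ (N := c • M) (P := c⁻¹ • M⁻¹) ?_ hΛ' ?_ ?_ ?_ hη'' ?_
    · rw [smul_mul_smul_comm, mul_inv_cancel₀ hc, Matrix.mul_nonsing_inv _ hdet, one_smul]
    · rw [h0]
      ext s t
      rw [scal_conj_apply, scal_conj_apply]
      refine Finset.sum_congr rfl fun u _ => Finset.sum_congr rfl fun v _ => ?_
      congr 1
      simp only [Matrix.smul_apply, smul_eq_mul]
      field_simp
    · have h1 : (fun i => φ ((p - cst B k + col (Λ.map ι) k) i)) =
          (fun i => φ (p i)) - cst B' k + col ((Λ.map φA).map ι') k := by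
        funext i
        simp only [Pi.add_apply, Pi.sub_apply, map_add, map_sub, cst_apply, col_apply, map_sum,
          map_smul, map_one, Matrix.map_apply, hφ]
      have h2 : col ((Λ.map φA).map ι') k = act M (col (Λ'.map ι') h) := by
        have h3 : (Λ.map φA).map ι' = scal B' M * Λ'.map ι' * scal B' M⁻¹ := by
          ext i j
          rw [Matrix.map_apply, hΛ, scal_conj_apply, scal_conj_apply]
          simp only [map_sum, map_smul, Matrix.map_apply]
        rw [h3, col_eq, col_eq, ← act_cst, ← scal_mulVec, ← scal_mulVec, Matrix.mulVec_mulVec,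
          Matrix.mulVec_mulVec, mul_assoc, ← scal_mul, Matrix.nonsing_inv_mul _ hdet, scal_one,
          mul_one]
      have h4 : (fun i => φ ((p - cst B k + col (Λ.map ι) k) i)) = act (c • M) p' := by
        rw [h1, hp, h2, ← act_cst, ← map_sub, ← map_add]
        have h5 : c • p' + cst B' h - col (Λ'.map ι') h - cst B' h + col (Λ'.map ι') h =
            c • p' := by abel
        rw [h5]
        funext i
        simp only [act_apply, Pi.smul_apply, Matrix.smul_apply, smul_smul, smul_eq_mul, mul_comm]
      rw [h4, act_act, smul_mul_smul_comm, inv_mul_cancel₀ hc, Matrix.nonsing_inv_mul _ hdet,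
        one_smul, act_one]
    · intro a
      rw [hf'', smul_mul_assoc, smul_mul_assoc, mul_smul_comm, smul_smul, inv_mul_cancel₀ hc,
        one_smul]
    · exact hatT_eq M hM c h _ _ T

theorem exists_form (H : IsInhomogeneousQuantumGroup Λ ι p f η T)
    (H' : IsInhomogeneousQuantumGroup Λ' ι' p' f' η' T')
    (φ : B ≃ₐc[ℂ] B') (φA : A ≃ₐc[ℂ] A') (hφ : ∀ a, ι' (φA a) = φ (ι a))
    {M : Matrix I I ℂ} (hM : IsUnit M) (hΛ : Λ.map φA = scal A' M * Λ' * scal A' M⁻¹) :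
    ∃ (c : ℂ) (h : I → ℂ), c ≠ 0 ∧
      (fun i => φ (p i)) = act M (c • p' + cst B' h - col (Λ'.map ι') h) := by
  have hdet := (Matrix.isUnit_iff_isUnit_det M).1 hM
  let f'' : A' →ₗ[ℂ] Matrix I I ℂ :=
    { toFun := fun b => M⁻¹ * f (φA.symm b) * M
      map_add' := fun a b => by simp only [map_add, mul_add, add_mul]
      map_smul' := fun s a => by
        simp only [map_smul, mul_smul_comm, smul_mul_assoc, RingHom.id_apply] }
  let η'' : A' →ₗ[ℂ] (I → ℂ) := M⁻¹.mulVecLin ∘ₗ η ∘ₗ (φA.symm : A' →ₗ[ℂ] A)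
  let ι₂ : A →ₐc[ℂ] B' := (φ : B →ₐc[ℂ] B').comp ι
  have H2 := H.congr_total φ (ι' := ι₂) fun a => rfl
  -- Changing basis by `M` alone shows that `M⁻¹ φ (p)` has the same coproduct as `p'`, over the
  -- same `Λ'`.
  have H3 : IsInhomogeneousQuantumGroup Λ' ι' (act M⁻¹ fun i => φ (p i)) f'' η'' _ :=
    H2.change_basis (φ := φA) hφ (N := M) (P := M⁻¹) (Matrix.mul_nonsing_inv _ hdet)
      H'.homogeneousPart (eq_conj hM hΛ) rfl
      (fun a => by
        change M⁻¹ * f (φA.symm (φA a)) * M = _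
        rw [BialgEquiv.symm_apply_apply])
      (fun a => by
        change M⁻¹.mulVec (η (φA.symm (φA a))) = _
        rw [BialgEquiv.symm_apply_apply]) rfl
  obtain ⟨c, h, hq⟩ := H'.exists_eq_of_comul (q := act M⁻¹ fun i => φ (p i))
    (fun i => by
      rw [act_apply]
      exact Submodule.sum_mem _ fun j _ => Submodule.smul_mem _ _ (H.equiv_p_mem H' φ j))
    H3.comul_p
  have hform : (fun i => φ (p i)) = act M (c • p' + cst B' h - col (Λ'.map ι') h) := by
    rw [← (act_invertible hM fun i => φ (p i)).1]
    congr 1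
    funext i
    exact hq i
  refine ⟨c, h, ?_, hform⟩
  -- If `c = 0`, every `φ (p_i)` lies in the homogeneous part, and the inverse of `φ` would bring
  -- every `p_i` into `A`.
  rintro rfl
  obtain ⟨i, hi⟩ := H.exists_notMem
  apply hi
  have hmem : φ (p i) ∈ imA ι' := by
    have := congrFun hform i
    rw [this, act_apply]
    refine Submodule.sum_mem _ fun j _ => Submodule.smul_mem _ _ (sub_mem (add_mem ?_ ?_) ?_)
    · rw [zero_smul]
      exact zero_mem _
    · exact Submodule.smul_mem _ _ ⟨1, map_one ι'⟩
    · exact Submodule.sum_mem _ fun k _ => Submodule.smul_mem _ _ (map_mem_imA ι' _)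
  obtain ⟨b, hb⟩ := hmem
  have h1 := H'.equiv_map_mem H φ.symm b
  have h2 : φ.symm (ι' b) = p i := by
    rw [show ι' b = φ (p i) from hb, BialgEquiv.symm_apply_apply]
  rw [h2] at h1
  exact h1

end IsInhomogeneousQuantumGroup

end Transport

end InhomQG
theorem proposition4p4 :
    -- the first part: an isomorphism maps `A` onto `A'` and `B¹` onto `B'¹`
    (∀ {A A' B B' I I' : Type*} [Ring A] [HopfAlgebra ℂ A] [Ring A'] [HopfAlgebra ℂ A']
      [Ring B] [Bialgebra ℂ B] [Ring B'] [Bialgebra ℂ B']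
      [Fintype I] [DecidableEq I] [Fintype I'] [DecidableEq I']
      (Λ : Matrix I I A) (ι : A →ₐc[ℂ] B) (p : I → B)
      (f : A →ₗ[ℂ] Matrix I I ℂ) (η : A →ₗ[ℂ] (I → ℂ)) (T : I × I → ℂ)
      (Λ' : Matrix I' I' A') (ι' : A' →ₐc[ℂ] B') (p' : I' → B')
      (f' : A' →ₗ[ℂ] Matrix I' I' ℂ) (η' : A' →ₗ[ℂ] (I' → ℂ)) (T' : I' × I' → ℂ),
      InhomQG.IsInhomogeneousQuantumGroup Λ ι p f η T →
      InhomQG.IsInhomogeneousQuantumGroup Λ' ι' p' f' η' T' →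
      ∀ φ : B ≃ₐc[ℂ] B',
        φ '' Set.range ι = Set.range ι' ∧
        φ '' (InhomQG.filtOne ι p : Set B) = (InhomQG.filtOne ι' p' : Set B') ∧
        ∃! φA : A ≃ₐc[ℂ] A', ∀ a, ι' (φA a) = φ (ι a)) ∧
    -- the second part: the form of `φ (p)` and of the transformed data
    (∀ {A A' B B' I : Type*} [Ring A] [HopfAlgebra ℂ A] [Ring A'] [HopfAlgebra ℂ A']
      [Ring B] [Bialgebra ℂ B] [Ring B'] [Bialgebra ℂ B'] [Fintype I] [DecidableEq I]
      (Λ : Matrix I I A) (ι : A →ₐc[ℂ] B) (p : I → B)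
      (f : A →ₗ[ℂ] Matrix I I ℂ) (η : A →ₗ[ℂ] (I → ℂ)) (T : I × I → ℂ)
      (Λ' : Matrix I I A') (ι' : A' →ₐc[ℂ] B') (p' : I → B')
      (f' : A' →ₗ[ℂ] Matrix I I ℂ) (η' : A' →ₗ[ℂ] (I → ℂ)) (T' : I × I → ℂ),
      InhomQG.IsInhomogeneousQuantumGroup Λ ι p f η T →
      InhomQG.IsInhomogeneousQuantumGroup Λ' ι' p' f' η' T' →
      ∀ (φ : B ≃ₐc[ℂ] B') (φA : A ≃ₐc[ℂ] A'), (∀ a, ι' (φA a) = φ (ι a)) →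
      ∀ M : Matrix I I ℂ, IsUnit M →
        Λ.map φA = M.map (algebraMap ℂ A') * Λ' * M⁻¹.map (algebraMap ℂ A') →
        ∃ (c : ℂ) (h : I → ℂ), c ≠ 0 ∧
          (∀ i, φ (p i) = ∑ j, M i j • (c • p' j + h j • 1 - ∑ k, h k • ι' (Λ' j k))) ∧
          (∀ b, f' b = M⁻¹ * f (φA.symm b) * M) ∧
          (∀ b, η' b = InhomQG.hatη M c h (f (φA.symm b)) (η (φA.symm b))
            (Coalgebra.counit (R := ℂ) b)) ∧
          InhomQG.Rmat Λ' f' = InhomQG.hatR M (InhomQG.Rmat Λ f) ∧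
          InhomQG.IsInhomogeneousQuantumGroup Λ' ι' p' f' η'
            (InhomQG.hatT M c h (InhomQG.Rmat Λ f) (InhomQG.Zmat Λ η) T)) ∧
    -- the third part: the converse
    (∀ {A A' I : Type*} {B : Type w} [Ring A] [HopfAlgebra ℂ A] [Ring A'] [HopfAlgebra ℂ A']
      [Ring B] [Bialgebra ℂ B] [Fintype I] [DecidableEq I]
      (Λ : Matrix I I A) (ι : A →ₐc[ℂ] B) (p : I → B)
      (f : A →ₗ[ℂ] Matrix I I ℂ) (η : A →ₗ[ℂ] (I → ℂ)) (T : I × I → ℂ)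
      (Λ' : Matrix I I A'),
      InhomQG.IsInhomogeneousQuantumGroup Λ ι p f η T →
      InhomQG.IsHomogeneousPart Λ' →
      ∀ (φA : A ≃ₐc[ℂ] A') (M : Matrix I I ℂ), IsUnit M →
        Λ.map φA = M.map (algebraMap ℂ A') * Λ' * M⁻¹.map (algebraMap ℂ A') →
        ∀ (c : ℂ) (h : I → ℂ), c ≠ 0 →
        ∃ (B' : Type w) (_ : Ring B') (_ : Bialgebra ℂ B') (ι' : A' →ₐc[ℂ] B') (p' : I → B')
          (f' : A' →ₗ[ℂ] Matrix I I ℂ) (η' : A' →ₗ[ℂ] (I → ℂ)) (T' : I × I → ℂ)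
          (φ : B ≃ₐc[ℂ] B'),
          InhomQG.IsInhomogeneousQuantumGroup Λ' ι' p' f' η' T' ∧
          (∀ a, φ (ι a) = ι' (φA a)) ∧
          (∀ i, φ (p i) = ∑ j, M i j • (c • p' j + h j • 1 - ∑ k, h k • ι' (Λ' j k))) ∧
          (∀ b, f' b = M⁻¹ * f (φA.symm b) * M) ∧
          (∀ b, η' b = InhomQG.hatη M c h (f (φA.symm b)) (η (φA.symm b))
            (Coalgebra.counit (R := ℂ) b)) ∧
          InhomQG.Rmat Λ' f' = InhomQG.hatR M (InhomQG.Rmat Λ f) ∧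
          T' = InhomQG.hatT M c h (InhomQG.Rmat Λ f) (InhomQG.Zmat Λ η) T) := by
  refine ⟨?_, ?_, ?_⟩
  · intro A A' B B' I I' _ _ _ _ _ _ _ _ _ _ _ _ Λ ι p f η T Λ' ι' p' f' η' T' H H' φ
    exact ⟨H.image_range H' φ, H.image_filtOne H' φ, H.existsUnique_restrict H' φ⟩
  · intro A A' B B' I _ _ _ _ _ _ _ _ _ _ Λ ι p f η T Λ' ι' p' f' η' T' H H' φ φA hφ M hM hΛ
    obtain ⟨c, h, hc, hp⟩ := H.exists_form H' φ φA hφ hM hΛ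
    obtain ⟨f₂, η₂, hf, hη, hR, H₂⟩ := H.transport H'.homogeneousPart φ φA hφ hM hΛ hc h hp
    -- The given and the transported functionals belong to the same `Λ'` and `p'`, hence coincide;
    -- `T` alone may differ.
    obtain ⟨rfl, rfl⟩ := H'.functionals_unique H₂
    exact ⟨c, h, hc, fun i => congrFun hp i, hf, hη, hR, H₂⟩
  · intro A A' I B _ _ _ _ _ _ _ _ Λ ι p f η T Λ' H hΛ' φA M hM hΛ c h hc
    -- The bialgebra `B` is kept and only its description changes: `A'` embeds through the inverse
    -- of `φA`, and `p'` solves the required formula for `p`.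
    let ι' : A' →ₐc[ℂ] B := ι.comp (φA.symm : A' →ₐc[ℂ] A)
    have hι : ∀ a, ι' (φA a) = ι a := fun a => congrArg ι (φA.symm_apply_apply a)
    let p' : I → B := c⁻¹ • (InhomQG.act M⁻¹ p - InhomQG.cst B h + InhomQG.col (Λ'.map ι') h)
    have hp : p = InhomQG.act M (c • p' + InhomQG.cst B h - InhomQG.col (Λ'.map ι') h) := by
      have h1 : c • p' + InhomQG.cst B h - InhomQG.col (Λ'.map ι') h = InhomQG.act M⁻¹ p := by
        change c • c⁻¹ • _ + _ - _ = _
        rw [smul_smul, mul_inv_cancel₀ hc, one_smul]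
        abel
      rw [h1, (InhomQG.act_invertible hM p).1]
    obtain ⟨f', η', hf, hη, hR, H₂⟩ := H.transport hΛ' (BialgEquiv.refl ℂ B) φA hι hM hΛ hc h hp
    exact ⟨B, _, _, ι', p', f', η', _, BialgEquiv.refl ℂ B, H₂, fun a => (hι a).symm,
      fun i => congrFun hp i, hf, hη, hR, rfl⟩
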